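/- Consider the following three-user deterministic interference channel (user indices modulo 3). The inputs $X_1,X_2,X_3$ take values in a finite non-empty set $\mathcal X$, $g_1,g_2,f_1,f_2,f_3$ are deterministic functions, and $$V_{ii}=g_2(g_1(X_i)),\qquad V_{i+1,i}=g_1(X_{i+1}),\qquad Y_i=f_i(V_{ii},V_{i+1,i},X_{i+2})\qquad(i=1,2,3),$$ so that $V_{13}=g_1(X_1)$, $V_{21}=g_1(X_2)$, $V_{32}=g_1(X_3)$, and for instance $Y_1=f_1(V_{11},V_{21},X_3)$. An *input law* is a pair $p(q),p(x|q)$ with $q$ in a finite set; it gives $p(q,x_1,x_2,x_3)=p(q)p(x_1|q)p(x_2|q)p(x_3|q)$, with the same $p(x|q)$ for all three users. All entropies are in bits. Let $A_{i,i}=\{V_{ii}\}$, $A_{i,i+1}=\{V_{i+1,i},V_{i+1,i+1}\}$, $A_{i,i+2}=\{X_{i+2},V_{i+2,i+2},V_{i+2,i+1}\}$ be the signals of the three transmitters that are to be decoded at receiver $i$. An input law is *admissible* if for every $i$ the following hold. 1. $H(Y_i|V_{ii},Q)=H(V_{i+1,i},X_{i+2}|Q)=H(V_{i+1,i}|Q)+H(X_{i+2}|Q)$.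 2. For $j=i+2$ and every $A\subseteq\bigcup_l A_{il}$ with $A_{il}\subseteq A$ for some $l\ne j$: $I(X_j;Y_i|A,Q)=I(X_j;Y_i|V_{ii},V_{i+1,i},A\cap A_{ij},Q)=H(X_j|A\cap A_{ij},Q)$. 3. For $k=i+2$, $\{j,l\}=\{i,i+1\}$ and every $A\subseteq\bigcup_{l'}A_{il'}$ with $A_{ik}\subseteq A$ or $A_{il}\subseteq A$: $I(V_{ji};Y_i|A,Q)=I(V_{ji};Y_i|V_{li},X_k,A\cap A_{ij},Q)=H(V_{ji}|A\cap A_{ij},Q)$. 4. (Symmetry of the receivers) $I(V_{ii},V_{i+1,i},X_{i+2};Y_i|Q)=I(V_{11},V_{21},X_3;Y_1|Q)$. For an input law $p$ put $$F(p)=\min\Big\{I(V_{11};Y_1|V_{21},X_3,Q),\ \tfrac13 I(V_{11},V_{21},X_3;Y_1|Q)\Big\}.$$ The symmetric capacity belonging to a capacity region $\mathcal C$ is $\max_{(R_1,R_2,R_3)\in\mathcal C}\min\{R_1,R_2,R_3\}$. A capacity region consists of the non-negative rate triples for which, for every $\varepsilon>0$ and all large block lengths $n$, there are codes with at least $2^{n(R_i-\varepsilon)}$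 equally likely messages for user $i$ such that, with probability at least $1-\varepsilon$, every receiver decodes its own message correctly. (a) Let $p$ be an admissible input law. Then the symmetric capacity for the input law $p$ is exactly $F(p)$. Here the codes are random codes: a time-sharing sequence $q^n$, i.i.d. from $p(q)$, is known everywhere; given $q^n$ the codebooks of the three users are drawn independently (from any laws) and are known to the receivers; and given $q^n$ each transmitted letter $X_{i,t}$ has the law $p(\cdot|q_t)$. Moreover $F(p)$ is achieved without message splitting, using joint decoding: for $0\le R<F(p)$, let every user have $\lceil 2^{nR}\rceil$ messages, each with a single codeword, all codewords drawn independently with independent letters from $p(\cdot|q_t)$, and let each receiver $i$ look for the unique message triple for which $q^n$, all the signals in $\bigcup_l A_{il}$ and the received word are jointly $\varepsilon$-typical. Then for all sufficiently small $\varepsilon>0$ the average probability that some receiver fails to recover the whole message triple tends to $0$ as $n\to\infty$. (b) If every input law is admissible, then the symmetric capacity of the channel under identical inputs, that is, over deterministic codes for which at each time $t$ the letters $X_{1,t},X_{2,t},X_{3,t}$ (for uniform messages) have the same law, exists and equals $\sup_p F(p)$, the supremum being over all input laws $p$. -/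

import Mathlib

open Filter Topology

noncomputable section

namespace DetIC

/-! ### Entropy (in bits) of functions on a finite probability space -/

/-- `P(Z = a)` for a random variable `Z` on a finite space with mass function `μ`. -/
def prob {Ω α : Type*} [Fintype Ω] (μ : Ω → ℝ) (Z : Ω → α) (a : α) : ℝ :=
  open Classical in ∑ ω with Z ω = a, μ ω

/-- Shannon entropy `H(Z)`, in bits. -/
def entropy {Ω α : Type*} [Fintype Ω] (μ : Ω → ℝ) (Z : Ω → α) : ℝ :=
  open Classical in
  ∑ a ∈ Finset.univ.image Z, Real.negMulLog (prob μ Z a) / Real.log 2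

/-- `H(Z | W)`. -/
def condEntropy {Ω α β : Type*} [Fintype Ω] (μ : Ω → ℝ) (Z : Ω → α) (W : Ω → β) : ℝ :=
  entropy μ (fun ω => (Z ω, W ω)) - entropy μ W

/-- `I(Z ; W | U)`. -/
def condMutualInfo {Ω α β γ : Type*} [Fintype Ω] (μ : Ω → ℝ)
    (Z : Ω → α) (W : Ω → β) (U : Ω → γ) : ℝ :=
  condEntropy μ Z U - condEntropy μ Z (fun ω => (W ω, U ω))

/-! ### Identical inputs with time sharing -/

/-- The pair `p(q)`, `p(x|q)`. -/
structure InputLaw (𝒬 𝒳 : Type*) [Fintype 𝒬] [Fintype 𝒳] where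
  pQ : 𝒬 → ℝ
  pQ_nonneg : ∀ q, 0 ≤ pQ q
  pQ_sum : ∑ q, pQ q = 1
  pX : 𝒬 → 𝒳 → ℝ
  pX_nonneg : ∀ q x, 0 ≤ pX q x
  pX_sum : ∀ q, ∑ x, pX q x = 1

/-- `p(q, x₁, x₂, x₃) = p(q) p(x₁|q) p(x₂|q) p(x₃|q)`, the same `p(x|q)` for all users. -/
def InputLaw.mass {𝒬 𝒳 : Type*} [Fintype 𝒬] [Fintype 𝒳] (L : InputLaw 𝒬 𝒳)
    (ω : 𝒬 × (Fin 3 → 𝒳)) : ℝ :=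
  L.pQ ω.1 * ∏ i, L.pX ω.1 (ω.2 i)

/-! ### The deterministic channel -/

/-- The deterministic functions of the channel. Users `1, 2, 3` are `0, 1, 2 : Fin 3`, with
arithmetic modulo three. -/
structure Model (𝒳 𝒰 𝒱 : Type*) (𝒴 : Fin 3 → Type*) where
  g₁ : 𝒳 → 𝒰
  g₂ : 𝒰 → 𝒱
  f : (i : Fin 3) → 𝒱 → 𝒰 → 𝒳 → 𝒴 i

/-- The three signals derived from a channel input `X_j`: `full` is `X_j` itself, `fine` is
`g₁(X_j)` and `coarse` is `g₂(g₁(X_j))`. -/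
inductive Level
  | full
  | fine
  | coarse
  deriving DecidableEq

/-- A signal: the transmitter it comes from, and its level. So `V_jj` is `(j, coarse)`, the
signal `V_ji` with `j = i + 1` (that is `V₂₁`, `V₃₂`, `V₁₃`) is `(j, fine)`, and `X_j` is
`(j, full)`. -/
abbrev Signal : Type := Fin 3 × Level

/-- The level at which receiver `i` hears transmitter `j`: receiver `1` hears `V₁₁`, `V₂₁`
and `X₃`, receiver `2` hears `V₂₂`, `V₃₂`, `X₁`, and receiver `3` hears `V₃₃`, `V₁₃`, `X₂`. -/
def heard (i j : Fin 3) : Level :=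
  if j = i then .coarse else if j = i + 1 then .fine else .full

/-- The set `A_ij` of signals of transmitter `j` that are to be decoded at receiver `i`. -/
def decodeSet (i j : Fin 3) : Finset Signal :=
  match heard i j with
  | .coarse => {(j, .coarse)}
  | .fine => {(j, .fine), (j, .coarse)}
  | .full => {(j, .full), (j, .fine), (j, .coarse)}

/-- All signals that are to be decoded at receiver `i`. -/
def decodeAll (i : Fin 3) : Finset Signal :=
  decodeSet i 0 ∪ decodeSet i 1 ∪ decodeSet i 2

namespace Model

variable {𝒳 𝒰 𝒱 : Type*} {𝒴 : Fin 3 → Type*}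

/-- `Y_i`: thus `Y₁ = f₁(V₁₁, V₂₁, X₃)`, `Y₂ = f₂(V₂₂, V₃₂, X₁)`, `Y₃ = f₃(V₃₃, V₁₃, X₂)`. -/
def output (D : Model 𝒳 𝒰 𝒱 𝒴) (i : Fin 3) (x : Fin 3 → 𝒳) : 𝒴 i :=
  D.f i (D.g₂ (D.g₁ (x i))) (D.g₁ (x (i + 1))) (x (i + 2))

/-- The value of a signal. -/
def value (D : Model 𝒳 𝒰 𝒱 𝒴) (x : Fin 3 → 𝒳) : Signal → 𝒳 ⊕ 𝒰 ⊕ 𝒱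
  | (j, .full) => .inl (x j)
  | (j, .fine) => .inr (.inl (D.g₁ (x j)))
  | (j, .coarse) => .inr (.inr (D.g₂ (D.g₁ (x j))))

/-- The joint value of a set of signals. -/
def values (D : Model 𝒳 𝒰 𝒱 𝒴) (S : Finset Signal) (x : Fin 3 → 𝒳) : S → 𝒳 ⊕ 𝒰 ⊕ 𝒱 :=
  fun s => D.value x s

variable {𝒬 : Type*} [Fintype 𝒬] [Fintype 𝒳]

/-- `H(S | A, Q)` for sets of signals `S` and `A`. -/
def hSig (D : Model 𝒳 𝒰 𝒱 𝒴) (L : InputLaw 𝒬 𝒳) (S A : Finset Signal) : ℝ :=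
  condEntropy L.mass (fun ω => D.values S ω.2) (fun ω => (D.values A ω.2, ω.1))

/-- `H(Y_i | A, Q)`. -/
def hOut (D : Model 𝒳 𝒰 𝒱 𝒴) (L : InputLaw 𝒬 𝒳) (i : Fin 3) (A : Finset Signal) : ℝ :=
  condEntropy L.mass (fun ω => D.output i ω.2) (fun ω => (D.values A ω.2, ω.1))

/-- `I(S ; Y_i | A, Q)`. -/
def infoOut (D : Model 𝒳 𝒰 𝒱 𝒴) (L : InputLaw 𝒬 𝒳) (i : Fin 3) (S A : Finset Signal) : ℝ :=
  condMutualInfo L.mass (fun ω => D.values S ω.2) (fun ω => D.output i ω.2)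
    (fun ω => (D.values A ω.2, ω.1))

/-- The interference is clearly observable: `H(Y₁|V₁₁) = H(V₂₁, X₃) = H(V₂₁) + H(X₃)`, and
likewise at the other two receivers. -/
def ClearlyObservable (D : Model 𝒳 𝒰 𝒱 𝒴) (L : InputLaw 𝒬 𝒳) : Prop :=
  ∀ i : Fin 3,
    D.hOut L i {(i, .coarse)} = D.hSig L {(i + 1, .fine), (i + 2, .full)} ∅ ∧
    D.hSig L {(i + 1, .fine), (i + 2, .full)} ∅ =
      D.hSig L {(i + 1, .fine)} ∅ + D.hSig L {(i + 2, .full)} ∅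

/-- The condition on the input `X_j` heard in full at receiver `i`:
`I(X_j;Y_i|A) = I(X_j;Y_i|V_ki for all k, A ∩ A_ij) = H(X_j|A ∩ A_ij)`
if `A_il ⊆ A` for some `l ≠ j`. -/
def StrongCondition (D : Model 𝒳 𝒰 𝒱 𝒴) (L : InputLaw 𝒬 𝒳) : Prop :=
  ∀ (i j l : Fin 3) (A : Finset Signal),
    (j, Level.full) ∈ decodeSet i j → l ≠ j → A ⊆ decodeAll i → decodeSet i l ⊆ A →
      D.infoOut L i {(j, .full)} A =
        D.infoOut L i {(j, .full)} ({(i, .coarse), (i + 1, .fine)} ∪ (A ∩ decodeSet i j)) ∧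
      D.infoOut L i {(j, .full)} ({(i, .coarse), (i + 1, .fine)} ∪ (A ∩ decodeSet i j)) =
        D.hSig L {(j, .full)} (A ∩ decodeSet i j)

/-- The condition on the signals `V_ji` heard at receiver `i`, where `X_k` is the input heard
in full there and `j, k, l` are distinct:
`I(V_ji;Y_i|A) = I(V_ji;Y_i|V_li, X_k, A ∩ A_ij) = H(V_ji|A ∩ A_ij)`
if `A_ik ⊆ A` or `A_il ⊆ A`. -/
def WeakCondition (D : Model 𝒳 𝒰 𝒱 𝒴) (L : InputLaw 𝒬 𝒳) : Prop :=
  ∀ (i j k l : Fin 3) (A : Finset Signal),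
    (k, Level.full) ∈ decodeSet i k → j ≠ k → l ≠ k → l ≠ j → A ⊆ decodeAll i →
    (decodeSet i k ⊆ A ∨ decodeSet i l ⊆ A) →
      D.infoOut L i {(j, heard i j)} A =
        D.infoOut L i {(j, heard i j)} ({(l, heard i l), (k, .full)} ∪ (A ∩ decodeSet i j)) ∧
      D.infoOut L i {(j, heard i j)} ({(l, heard i l), (k, .full)} ∪ (A ∩ decodeSet i j)) =
        D.hSig L {(j, heard i j)} (A ∩ decodeSet i j)

/-- The three receivers are statistically alike under identical inputs:
`I(V₁₁,V₂₁,X₃;Y₁|Q) = I(V₂₂,V₃₂,X₁;Y₂|Q) = I(V₃₃,V₁₃,X₂;Y₃|Q)`. -/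
def Symmetric (D : Model 𝒳 𝒰 𝒱 𝒴) (L : InputLaw 𝒬 𝒳) : Prop :=
  ∀ i : Fin 3,
    D.infoOut L i {(i, .coarse), (i + 1, .fine), (i + 2, .full)} ∅ =
      D.infoOut L 0 {(0, .coarse), (1, .fine), (2, .full)} ∅

/-- The standing assumptions on the model, under the input law `L`. -/
structure Admissible (D : Model 𝒳 𝒰 𝒱 𝒴) (L : InputLaw 𝒬 𝒳) : Prop where
  clearlyObservable : D.ClearlyObservable L
  strong : D.StrongCondition L
  weak : D.WeakCondition L
  symmetric : D.Symmetric L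

/-- `min { I(V₁₁;Y₁|V₂₁,X₃,Q), (1/3) I(V₁₁,V₂₁,X₃;Y₁|Q) }`. -/
def rateFormula (D : Model 𝒳 𝒰 𝒱 𝒴) (L : InputLaw 𝒬 𝒳) : ℝ :=
  min (D.infoOut L 0 {(0, .coarse)} {(1, .fine), (2, .full)})
    (1 / 3 * D.infoOut L 0 {(0, .coarse), (1, .fine), (2, .full)} ∅)

end Model

/-! ### Codes -/

/-- Codebooks for block length `n`; user `i` has messages `Fin (m i)`, each one assigned a
codeword. -/
abbrev Codebooks (𝒳 : Type*) (n : ℕ) (m : Fin 3 → ℕ) : Type _ :=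
  (i : Fin 3) → Fin (m i) → Fin n → 𝒳

/-- A triple of messages. -/
abbrev Messages (m : Fin 3 → ℕ) : Type := (i : Fin 3) → Fin (m i)

/-- The word received by receiver `i` when the messages `w` are sent. -/
def received {𝒳 𝒰 𝒱 : Type*} {𝒴 : Fin 3 → Type*} (D : Model 𝒳 𝒰 𝒱 𝒴) {n : ℕ} {m : Fin 3 → ℕ}
    (c : Codebooks 𝒳 n m) (w : Messages m) (i : Fin 3) : Fin n → 𝒴 i :=
  fun t => D.output i (fun j => c j (w j) t)

/-- The probability of an event that depends on three independent uniform messages. -/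
def uniformProb {m : Fin 3 → ℕ} (E : Messages m → Prop) : ℝ :=
  open Classical in
  ((Finset.univ.filter E).card : ℝ) / (Fintype.card (Messages m) : ℝ)

/-- The probability that some receiver errs on its own message. -/
def codeError {𝒳 𝒰 𝒱 : Type*} {𝒴 : Fin 3 → Type*} (D : Model 𝒳 𝒰 𝒱 𝒴) {n : ℕ} {m : Fin 3 → ℕ}
    (c : Codebooks 𝒳 n m) (dec : (i : Fin 3) → (Fin n → 𝒴 i) → Fin (m i)) : ℝ :=
  uniformProb (fun w => ∃ i, dec i (received D c w i) ≠ w i)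

/-- The law of the letter `X_{i,t}` that user `i` sends at time `t`, for a uniform message and
the codebook `b` of that user. -/
def letterLaw {𝒳 : Type*} {n M : ℕ} (b : Fin M → Fin n → 𝒳) (t : Fin n) (x : 𝒳) : ℝ :=
  open Classical in
  ((Finset.univ.filter (fun w => b w t = x)).card : ℝ) / (M : ℝ)

/-- Probability of a memoryless time-sharing sequence. -/
def timeSharingProb {𝒬 𝒳 : Type*} [Fintype 𝒬] [Fintype 𝒳] (L : InputLaw 𝒬 𝒳) {n : ℕ}
    (q : Fin n → 𝒬) : ℝ := ∏ t, L.pQ (q t)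

/-- Averages a quantity over the time-sharing sequence `q` (memoryless with law `p(q)`) and over
three codebooks that are drawn independently given `q`, user `i`'s with mass function `κ i q`. -/
def ensembleAverage {𝒬 𝒳 : Type*} [Fintype 𝒬] [Fintype 𝒳] (L : InputLaw 𝒬 𝒳) {n : ℕ}
    {m : Fin 3 → ℕ} (κ : (i : Fin 3) → (Fin n → 𝒬) → (Fin (m i) → Fin n → 𝒳) → ℝ)
    (E : (Fin n → 𝒬) → Codebooks 𝒳 n m → ℝ) : ℝ :=
  open Classical in
  ∑ q : Fin n → 𝒬, timeSharingProb L q * ∑ c : Codebooks 𝒳 n m, (∏ i, κ i q (c i)) * E q c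

/-- A random code with input law `L`: the time-sharing sequence `q` is shared by all
transmitters and receivers; given `q` the three codebooks are drawn independently and are known
to the receivers; and every letter `X_{i,t}` sent has the law `p(x|q_t)` given `q`. -/
structure RandomCode {𝒬 𝒳 : Type*} [Fintype 𝒬] [Fintype 𝒳] (L : InputLaw 𝒬 𝒳)
    (𝒴 : Fin 3 → Type*) (n : ℕ) (m : Fin 3 → ℕ) where
  κ : (i : Fin 3) → (Fin n → 𝒬) → (Fin (m i) → Fin n → 𝒳) → ℝ
  κ_nonneg : ∀ i q b, 0 ≤ κ i q b
  κ_sum : ∀ i q, (open Classical in ∑ b, κ i q b) = 1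
  letter : ∀ i q t x, (open Classical in ∑ b, κ i q b * letterLaw b t x) = L.pX (q t) x
  dec : (i : Fin 3) → (Fin n → 𝒬) → Codebooks 𝒳 n m → (Fin n → 𝒴 i) → Fin (m i)

/-- Average probability that some receiver errs on its own message, for a random code. -/
def RandomCode.error {𝒬 𝒳 𝒰 𝒱 : Type*} {𝒴 : Fin 3 → Type*} [Fintype 𝒬] [Fintype 𝒳]
    {L : InputLaw 𝒬 𝒳} {n : ℕ} {m : Fin 3 → ℕ} (C : RandomCode L 𝒴 n m)
    (D : Model 𝒳 𝒰 𝒱 𝒴) : ℝ :=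
  ensembleAverage L C.κ (fun q c => codeError D c (fun i => C.dec i q c))

namespace Model

variable {𝒳 𝒰 𝒱 : Type*} {𝒴 : Fin 3 → Type*} [Fintype 𝒳]

/-- The capacity region for the input law `L`: the rate triples that random codes with this
input law attain with vanishing error probability. -/
def regionWith {𝒬 : Type*} [Fintype 𝒬] (D : Model 𝒳 𝒰 𝒱 𝒴) (L : InputLaw 𝒬 𝒳) :
    Set (Fin 3 → ℝ) :=
  {R | (∀ i, 0 ≤ R i) ∧ ∀ ε > 0, ∃ N : ℕ, ∀ n ≥ N, ∃ (m : Fin 3 → ℕ) (C : RandomCode L 𝒴 n m),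
    (∀ i, (2 : ℝ) ^ ((n : ℝ) * (R i - ε)) ≤ m i) ∧ C.error D ≤ ε}

/-- The capacity region under identical inputs: the rate triples that (deterministic) codes attain
with vanishing error probability, for codes in which the letters `X_{1,t}`, `X_{2,t}`, `X_{3,t}`
have the same law at every time `t`. -/
def region (D : Model 𝒳 𝒰 𝒱 𝒴) : Set (Fin 3 → ℝ) :=
  {R | (∀ i, 0 ≤ R i) ∧ ∀ ε > 0, ∃ N : ℕ, ∀ n ≥ N, ∃ (m : Fin 3 → ℕ) (c : Codebooks 𝒳 n m)
    (dec : (i : Fin 3) → (Fin n → 𝒴 i) → Fin (m i)),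
    (∀ i j t x, letterLaw (c i) t x = letterLaw (c j) t x) ∧
    (∀ i, (2 : ℝ) ^ ((n : ℝ) * (R i - ε)) ≤ m i) ∧ codeError D c dec ≤ ε}

end Model

/-- `C` is the symmetric capacity for a capacity region: `C = max min {R₁, R₂, R₃}` over the
region. -/
def IsSymmetricCapacity (region : Set (Fin 3 → ℝ)) (C : ℝ) : Prop :=
  IsGreatest ((fun R : Fin 3 → ℝ => min (R 0) (min (R 1) (R 2))) '' region) C

/-! ### Random coding without message splitting, and joint decoding -/

/-- The codebook of one user when each message gets one codeword, independently of the other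
messages, with independent letters of law `p(x|q_t)`; no message is split into parts. (Drawing
`V_ii`, then the other `V_ij` given `V_ii`, then `X_i` given both yields this same law.) -/
def unsplitLaw {𝒬 𝒳 : Type*} [Fintype 𝒬] [Fintype 𝒳] (L : InputLaw 𝒬 𝒳) {n M : ℕ}
    (q : Fin n → 𝒬) (b : Fin M → Fin n → 𝒳) : ℝ :=
  ∏ w, ∏ t, L.pX (q t) (b w t)

/-- Joint typicality at receiver `i` of `q`, all the signals that are to be decoded there (as
they result from the codewords `x`), and the received word `y`: the empirical frequency of each
symbol is within a factor `1 ± ε` of its probability. -/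
def JointlyTypical {𝒬 𝒳 𝒰 𝒱 : Type*} {𝒴 : Fin 3 → Type*} [Fintype 𝒬] [Fintype 𝒳]
    (D : Model 𝒳 𝒰 𝒱 𝒴) (L : InputLaw 𝒬 𝒳) (ε : ℝ) (i : Fin 3) {n : ℕ}
    (q : Fin n → 𝒬) (x : Fin 3 → Fin n → 𝒳) (y : Fin n → 𝒴 i) : Prop :=
  ∀ a : 𝒬 × (decodeAll i → 𝒳 ⊕ 𝒰 ⊕ 𝒱) × 𝒴 i,
    |(open Classical in ((Finset.univ.filter (fun t =>
        (q t, D.values (decodeAll i) (fun j => x j t), y t) = a)).card : ℝ) / (n : ℝ))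
      - prob L.mass (fun ω => (ω.1, D.values (decodeAll i) ω.2, D.output i ω.2)) a|
    ≤ ε * prob L.mass (fun ω => (ω.1, D.values (decodeAll i) ω.2, D.output i ω.2)) a

/-- The joint decoder of receiver `i`: it declares the message triple whose codewords are jointly
typical with `y` if there is exactly one, and nothing otherwise. -/
def jointDecoder {𝒬 𝒳 𝒰 𝒱 : Type*} {𝒴 : Fin 3 → Type*} [Fintype 𝒬] [Fintype 𝒳]
    (D : Model 𝒳 𝒰 𝒱 𝒴) (L : InputLaw 𝒬 𝒳) (ε : ℝ) {n : ℕ} {m : Fin 3 → ℕ}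
    (q : Fin n → 𝒬) (c : Codebooks 𝒳 n m) (i : Fin 3) (y : Fin n → 𝒴 i) :
    Option (Messages m) :=
  open Classical in
  if h : ∃! w : Messages m, JointlyTypical D L ε i q (fun j => c j (w j)) y then
    some h.choose
  else none

/-- Average probability that the joint decoder of some receiver fails to recover all three
messages, for random coding without message splitting. -/
def unsplitJointError {𝒬 𝒳 𝒰 𝒱 : Type*} {𝒴 : Fin 3 → Type*} [Fintype 𝒬] [Fintype 𝒳]
    (D : Model 𝒳 𝒰 𝒱 𝒴) (L : InputLaw 𝒬 𝒳) (ε : ℝ) (n : ℕ) (m : Fin 3 → ℕ) : ℝ :=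
  ensembleAverage L (n := n) (m := m) (fun _ q b => unsplitLaw L q b)
    (fun q c => uniformProb (fun w =>
      ∃ i, jointDecoder D L ε q c i (received D c w i) ≠ some w))

end DetIC

end

namespace DetIC

/-! ### Sums over finite product spaces -/

/-! At receiver `i` write C, B, X for the coarse, fine and full signals heard from transmitters `i`,
`i + 1`, `i + 2`, and a, b, c for their entropies given Q. Because the output is a function of (C,
B, X), admissibility says that conditioning Y on any non-empty set of these signals leaves exactly
the sum of the entropies of the others: H(Y|B,X) = a, H(Y|X) = a + b, and so on. With identical
inputs, a ≤ b ≤ c and F = min {a, H(Y₁|Q)/3}. Hence for every non-empty set S of users, |S| F is at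
most the entropy of Y given Q and the signals heard from outside S
(`Model.Admissible.card_mul_rateFormula_le`). All constraints of joint decoding thus follow from the
two terms of F.

Achievability. A wrong message triple that differs from the true one exactly for the users in S
looks typical with probability at most 2^(-n(1-ε)H(Y | signals from outside S, Q)) ≤ β^|S|, where β
= 2^(-n(1-ε)F) (`sum_jointlyTypical_le`, `sum_wrong_typical_le`). Summed over all wrong triples this
is at most ∏(1 + m_j β) - 1, which vanishes for rates below (1-ε)F. The true triple fails the test
with probability O(1/n), by Chebyshev.

Converse. For a fixed code, Fano's inequality bounds log m_i by the entropy of the coarse word of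
user `i`, since the own signal enters the output only in this form. Equality in the clear
observability condition means that C and Y determine B and X on the support
(`Model.Admissible.determines`). Having decoded its message, the first receiver therefore also knows
both interfering words, so the entropy of its output is at least, up to Fano terms, the sum of the
three log m_i. Both word entropies are then bounded by cross entropies against memoryless reference
laws. These are linear in the letter laws, or in products of letter laws of independent codebooks,
so averaging over the ensemble produces exactly the single-letter entropies in F
(`ensemble_converse`).

Identical inputs. In the converse a deterministic code is an ensemble of point masses, and time,
uniform on `Fin n`, serves as Q. For achievability, a good realisation of the random code has three
codebooks with nearly equal letter laws, at mean total distance O(n/√M). Replacing every column by a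
permutation of the corresponding column of one user, matched as well as possible, makes the laws
equal and changes few codewords (`exists_equal_laws`, `codeError_le_add`). -/

theorem sum_pi_prod {ι : Type*} [Fintype ι] [DecidableEq ι] {α : ι → Type*}
    [∀ i, Fintype (α i)] (f : ∀ i, α i → ℝ) :
    ∑ g : ∀ i, α i, ∏ i, f i (g i) = ∏ i, ∑ a, f i a := by
  rw [Finset.prod_univ_sum, Fintype.piFinset_univ]

/-- Marginalisation onto one coordinate. -/
theorem sum_pi_prod_mul {ι : Type*} [Fintype ι] [DecidableEq ι] {α : ι → Type*}
    [∀ i, Fintype (α i)] (p : ∀ i, α i → ℝ) (hp : ∀ i, ∑ a, p i a = 1) (i₀ : ι)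
    (φ : α i₀ → ℝ) :
    ∑ g : ∀ i, α i, (∏ i, p i (g i)) * φ (g i₀) = ∑ a, p i₀ a * φ a := by
  -- The factor `φ` is absorbed into the product as a factor that equals 1 away from `i₀`.
  have h : ∀ g : ∀ i, α i, (∏ i, p i (g i)) * φ (g i₀) =
      ∏ i, p i (g i) * (if h : i = i₀ then φ (h ▸ g i) else 1) := by
    intro g
    rw [Finset.prod_mul_distrib, Finset.prod_eq_single i₀ (f := fun i => dite _ _ _)]
    · simp
    · intro b _ hb
      simp [hb]
    · simp
  simp_rw [h]
  rw [sum_pi_prod (fun i a => p i a * (if h : i = i₀ then φ (h ▸ a) else 1)),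
    Finset.prod_eq_single i₀]
  · simp
  · intro b _ hb
    simp [hb, hp]
  · simp

/-- Second moment of a sum of independent identically distributed centred variables. -/
theorem sum_prod_mul_sum_sq {ι α : Type*} [Fintype ι] [DecidableEq ι] [Fintype α]
    (p : α → ℝ) (hp : ∑ a, p a = 1) (h : α → ℝ) (h0 : ∑ a, p a * h a = 0) :
    ∑ g : ι → α, (∏ i, p (g i)) * (∑ i, h (g i)) ^ 2 =
      Fintype.card ι * ∑ a, p a * h a ^ 2 := by
  -- Cross terms contain the mean of a centred variable as a factor, so only the diagonal survives.
  have key : ∀ i j : ι, ∑ g : ι → α, (∏ k, p (g k)) * (h (g i) * h (g j)) =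
      if i = j then ∑ a, p a * h a ^ 2 else 0 := by
    intro i j
    split_ifs with hij
    · subst hij
      rw [← sum_pi_prod_mul (fun _ : ι => p) (fun _ => hp) i (fun a => h a ^ 2)]
      exact Finset.sum_congr rfl fun g _ => by ring
    · have h1 : ∀ g : ι → α, (∏ k, p (g k)) * (h (g i) * h (g j)) =
          ∏ k, p (g k) * ((if k = i then h (g k) else 1) * (if k = j then h (g k) else 1)) := by
        intro g
        rw [Finset.prod_mul_distrib, Finset.prod_mul_distrib]
        simp [Finset.prod_ite_eq']
      simp_rw [h1]
      rw [sum_pi_prod (fun k a =>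
        p a * ((if k = i then h a else 1) * (if k = j then h a else 1)))]
      apply Finset.prod_eq_zero (Finset.mem_univ i)
      simpa [hij] using h0
  calc ∑ g : ι → α, (∏ i, p (g i)) * (∑ i, h (g i)) ^ 2
      = ∑ g : ι → α, ∑ i, ∑ j, (∏ k, p (g k)) * (h (g i) * h (g j)) := by
        refine Finset.sum_congr rfl fun g _ => ?_
        rw [sq, Finset.sum_mul_sum, Finset.mul_sum]
        simp_rw [Finset.mul_sum]
    _ = ∑ i : ι, ∑ j : ι, ∑ g : ι → α, (∏ k, p (g k)) * (h (g i) * h (g j)) := by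
        rw [Finset.sum_comm]
        exact Finset.sum_congr rfl fun i _ => Finset.sum_comm
    _ = _ := by
        simp_rw [key]
        simp [Finset.card_univ]

/-! ### Elementary properties of probabilities and entropies -/

section Entropy

variable {Ω α β γ : Type*} [Fintype Ω]

theorem prob_eq_sum_ite (μ : Ω → ℝ) (Z : Ω → α) (a : α) :
    prob μ Z a = (open Classical in ∑ ω, if Z ω = a then μ ω else 0) := by
  classical
  rw [prob, Finset.sum_filter]

theorem prob_nonneg {μ : Ω → ℝ} (hμ : ∀ ω, 0 ≤ μ ω) (Z : Ω → α) (a : α) : 0 ≤ prob μ Z a :=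
  Finset.sum_nonneg fun ω _ => hμ ω

theorem le_prob {μ : Ω → ℝ} (hμ : ∀ ω, 0 ≤ μ ω) (Z : Ω → α) (ω : Ω) : μ ω ≤ prob μ Z (Z ω) := by
  classical
  exact Finset.single_le_sum (f := μ) (fun ω _ => hμ ω) (by simp)

theorem prob_pos {μ : Ω → ℝ} (hμ : ∀ ω, 0 ≤ μ ω) (Z : Ω → α) {ω : Ω} (h : 0 < μ ω) :
    0 < prob μ Z (Z ω) :=
  h.trans_le (le_prob hμ Z ω)

theorem exists_of_prob_pos {μ : Ω → ℝ} {Z : Ω → α} {a : α}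
    (h : 0 < prob μ Z a) : ∃ ω, Z ω = a ∧ 0 < μ ω := by
  classical
  by_contra! hne
  have : prob μ Z a ≤ 0 := by
    rw [prob_eq_sum_ite]
    exact Finset.sum_nonpos fun ω _ => by
      split_ifs with hω
      · exact hne ω hω
      · exact le_rfl
  linarith

/-- If `Z'` is determined by `Z` on the support, its symbols are at least as likely. -/
theorem prob_le_prob {μ : Ω → ℝ} (hμ : ∀ ω, 0 ≤ μ ω) {Z : Ω → α} {Z' : Ω → β} (ω : Ω)
    (h : ∀ ω', 0 < μ ω' → Z ω' = Z ω → Z' ω' = Z' ω) :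
    prob μ Z (Z ω) ≤ prob μ Z' (Z' ω) := by
  classical
  rw [prob_eq_sum_ite, prob_eq_sum_ite]
  refine Finset.sum_le_sum fun ω' _ => ?_
  rcases (hμ ω').eq_or_lt with h0 | h0
  · simp [← h0]
  · by_cases hz : Z ω' = Z ω
    · simp [hz, h ω' h0 hz]
    · simp only [hz, if_false]
      split_ifs <;> simp [hμ]

theorem sum_image_prob_mul (μ : Ω → ℝ) (Z : Ω → α) (f : α → ℝ) :
    (open Classical in ∑ a ∈ Finset.univ.image Z, prob μ Z a * f a) = ∑ ω, μ ω * f (Z ω) := by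
  classical
  rw [← Finset.sum_fiberwise_of_maps_to (g := Z) (t := Finset.univ.image Z)
    (fun ω _ => Finset.mem_image_of_mem _ (Finset.mem_univ ω))]
  refine Finset.sum_congr rfl fun a _ => ?_
  rw [prob, Finset.sum_mul]
  refine Finset.sum_congr (by congr) fun ω hω => ?_
  rw [(Finset.mem_filter.1 hω).2]

theorem sum_prob_le {μ : Ω → ℝ} (hμ : ∀ ω, 0 ≤ μ ω) (Z : Ω → α) (s : Finset α) :
    ∑ a ∈ s, prob μ Z a ≤ ∑ ω, μ ω := by
  classical
  calc ∑ a ∈ s, prob μ Z a = ∑ ω, ∑ a ∈ s, if Z ω = a then μ ω else 0 := by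
        simp_rw [prob_eq_sum_ite]
        exact Finset.sum_comm
    _ ≤ ∑ ω, μ ω := by
        refine Finset.sum_le_sum fun ω _ => ?_
        rw [Finset.sum_ite_eq]
        split_ifs <;> simp [hμ]

/-- Entropy as the mean of the information content. -/
theorem entropy_eq_sum (μ : Ω → ℝ) (Z : Ω → α) :
    entropy μ Z = ∑ ω, μ ω * -Real.logb 2 (prob μ Z (Z ω)) := by
  classical
  rw [entropy, ← sum_image_prob_mul μ Z (fun a => -Real.logb 2 (prob μ Z a))]
  refine Finset.sum_congr (by congr) fun a _ => ?_
  rw [Real.negMulLog, Real.logb]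
  ring

theorem entropy_nonneg {μ : Ω → ℝ} (hμ : ∀ ω, 0 ≤ μ ω) (h1 : ∑ ω, μ ω = 1) (Z : Ω → α) :
    0 ≤ entropy μ Z := by
  rw [entropy_eq_sum]
  refine Finset.sum_nonneg fun ω _ => mul_nonneg (hμ ω) ?_
  have h2 : prob μ Z (Z ω) ≤ 1 := by
    have := sum_prob_le hμ Z {Z ω}
    simpa [h1] using this
  have := Real.logb_nonpos (b := 2) (by norm_num) (prob_nonneg hμ Z (Z ω)) h2
  linarith

/-- Gibbs' inequality. -/
theorem entropy_le_cross {μ : Ω → ℝ} (hμ : ∀ ω, 0 ≤ μ ω) (h1 : ∑ ω, μ ω = 1) (Z : Ω → α)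
    (r : α → ℝ) (hr : ∀ a, 0 ≤ r a) (hpos : ∀ ω, 0 < μ ω → 0 < r (Z ω))
    (hsum : ∀ s : Finset α, ∑ a ∈ s, r a ≤ 1) :
    entropy μ Z ≤ ∑ ω, μ ω * -Real.logb 2 (r (Z ω)) := by
  classical
  have hlog2 : 0 < Real.log 2 := Real.log_pos (by norm_num)
  rw [entropy_eq_sum]
  -- The ratio `r / prob` has mean at most 1. The sum runs over the finite range of `Z`, which is
  -- why `hsum` is stated for finite sets: the alphabet may be infinite.
  have h2 : ∑ ω, μ ω * (r (Z ω) / prob μ Z (Z ω)) ≤ 1 := by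
    rw [← sum_image_prob_mul μ Z (fun a => r a / prob μ Z a)]
    refine le_trans (Finset.sum_le_sum fun a _ => ?_) (hsum (Finset.univ.image Z))
    by_cases h0 : prob μ Z a = 0
    · simp [h0, hr]
    · rw [mul_div_cancel₀ _ h0]
  have h3 : ∑ ω, μ ω * (Real.log (r (Z ω)) - Real.log (prob μ Z (Z ω))) ≤ 0 := by
    calc _ ≤ ∑ ω, (μ ω * (r (Z ω) / prob μ Z (Z ω)) - μ ω) := by
          refine Finset.sum_le_sum fun ω _ => ?_
          rcases (hμ ω).eq_or_lt with h0 | h0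
          · simp [← h0]
          · have hp := prob_pos hμ Z h0
            rw [← Real.log_div (hpos ω h0).ne' hp.ne']
            have := Real.log_le_sub_one_of_pos (div_pos (hpos ω h0) hp)
            nlinarith
      _ ≤ 0 := by
          rw [Finset.sum_sub_distrib, h1]
          linarith
  have h4 : ∑ ω, μ ω * -Real.logb 2 (prob μ Z (Z ω)) - ∑ ω, μ ω * -Real.logb 2 (r (Z ω)) =
      (∑ ω, μ ω * (Real.log (r (Z ω)) - Real.log (prob μ Z (Z ω)))) / Real.log 2 := by
    rw [← Finset.sum_sub_distrib, Finset.sum_div]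
    refine Finset.sum_congr rfl fun ω _ => ?_
    simp only [Real.logb]
    ring
  have h5 := div_nonpos_of_nonpos_of_nonneg h3 hlog2.le
  linarith

/-- Coarsening only enlarges the event containing a given point, so the information content drops
pointwise. The dependence is needed on the support alone; the converse uses it in this form, as
interference is recoverable only there. -/
theorem entropy_mono {μ : Ω → ℝ} (hμ : ∀ ω, 0 ≤ μ ω) {Z : Ω → α} {Z' : Ω → β}
    (h : ∀ ω ω', 0 < μ ω → 0 < μ ω' → Z ω' = Z ω → Z' ω' = Z' ω) :
    entropy μ Z' ≤ entropy μ Z := by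
  rw [entropy_eq_sum, entropy_eq_sum]
  refine Finset.sum_le_sum fun ω _ => ?_
  rcases (hμ ω).eq_or_lt with h0 | h0
  · simp [← h0]
  · have h1 := prob_le_prob hμ (Z := Z) (Z' := Z') ω (fun ω' => h ω ω' h0)
    have h2 := Real.logb_le_logb_of_le (b := 2) (by norm_num) (prob_pos hμ Z h0) h1
    nlinarith

theorem entropy_congr {μ : Ω → ℝ} (hμ : ∀ ω, 0 ≤ μ ω) {Z : Ω → α} {Z' : Ω → β}
    (h : ∀ ω ω', Z ω' = Z ω ↔ Z' ω' = Z' ω) : entropy μ Z = entropy μ Z' :=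
  le_antisymm (entropy_mono hμ fun ω ω' _ _ => (h ω ω').2)
    (entropy_mono hμ fun ω ω' _ _ => (h ω ω').1)

/-- If a function of `Z` has the entropy of `Z`, it determines `Z` on the support. -/
theorem determined_of_entropy_le {μ : Ω → ℝ} (hμ : ∀ ω, 0 ≤ μ ω) {Z : Ω → α} {Z' : Ω → β}
    (h : ∀ ω ω', Z ω' = Z ω → Z' ω' = Z' ω) (hle : entropy μ Z ≤ entropy μ Z')
    {ω ω' : Ω} (hω : 0 < μ ω) (hω' : 0 < μ ω') (hZ : Z' ω' = Z' ω) : Z ω' = Z ω := by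
  classical
  by_contra hne
  -- The point `ω'` lies in the event of `Z'` but not in that of `Z`, and it has positive mass.
  have hlt : prob μ Z (Z ω) < prob μ Z' (Z' ω) := by
    rw [prob_eq_sum_ite, prob_eq_sum_ite]
    refine Finset.sum_lt_sum (fun ν _ => ?_) ⟨ω', Finset.mem_univ _, by simp [hne, hZ, hω']⟩
    by_cases hz : Z ν = Z ω
    · simp [hz, h ω ν hz]
    · simp only [hz, if_false]
      split_ifs <;> simp [hμ]
  have : entropy μ Z' < entropy μ Z := by
    rw [entropy_eq_sum, entropy_eq_sum]
    refine Finset.sum_lt_sum (fun ν _ => ?_) ⟨ω, Finset.mem_univ _, ?_⟩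
    · rcases (hμ ν).eq_or_lt with h0 | h0
      · simp [← h0]
      · have h2 := Real.logb_le_logb_of_le (b := 2) (by norm_num) (prob_pos hμ Z h0)
          (prob_le_prob hμ (Z := Z) (Z' := Z') ν (fun ω' _ => h ν ω'))
        nlinarith
    · have h2 := Real.logb_lt_logb (b := 2) (by norm_num) (prob_pos hμ Z hω) hlt
      nlinarith
  linarith

theorem sum_mul_le_one {r : α → ℝ} {s : β → ℝ} (hr : ∀ a, 0 ≤ r a) (hs : ∀ b, 0 ≤ s b)
    (hr1 : ∀ t : Finset α, ∑ a ∈ t, r a ≤ 1) (hs1 : ∀ t : Finset β, ∑ b ∈ t, s b ≤ 1)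
    (t : Finset (α × β)) : ∑ x ∈ t, r x.1 * s x.2 ≤ 1 := by
  classical
  calc ∑ x ∈ t, r x.1 * s x.2
      ≤ ∑ x ∈ t.image Prod.fst ×ˢ t.image Prod.snd, r x.1 * s x.2 := by
        refine Finset.sum_le_sum_of_subset_of_nonneg (fun x hx => ?_)
          (fun x _ _ => mul_nonneg (hr _) (hs _))
        exact Finset.mem_product.2 ⟨Finset.mem_image_of_mem _ hx, Finset.mem_image_of_mem _ hx⟩
    _ = (∑ a ∈ t.image Prod.fst, r a) * ∑ b ∈ t.image Prod.snd, s b := by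
        rw [Finset.sum_product, Finset.sum_mul_sum]
    _ ≤ 1 := mul_le_one₀ (hr1 _) (Finset.sum_nonneg fun b _ => hs b) (hs1 _)

/-- Gibbs' inequality with the product of the two marginals as reference law. -/
theorem entropy_pair_le {μ : Ω → ℝ} (hμ : ∀ ω, 0 ≤ μ ω) (h1 : ∑ ω, μ ω = 1)
    (Z : Ω → α) (W : Ω → β) :
    entropy μ (fun ω => (Z ω, W ω)) ≤ entropy μ Z + entropy μ W := by
  refine (entropy_le_cross hμ h1 (fun ω => (Z ω, W ω)) (fun x => prob μ Z x.1 * prob μ W x.2)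
    (fun x => mul_nonneg (prob_nonneg hμ _ _) (prob_nonneg hμ _ _))
    (fun ω h => mul_pos (prob_pos hμ Z h) (prob_pos hμ W h))
    (sum_mul_le_one (prob_nonneg hμ Z) (prob_nonneg hμ W)
      (fun t => (sum_prob_le hμ Z t).trans_eq h1)
      (fun t => (sum_prob_le hμ W t).trans_eq h1))).trans_eq ?_
  rw [entropy_eq_sum, entropy_eq_sum, ← Finset.sum_add_distrib]
  refine Finset.sum_congr rfl fun ω _ => ?_
  rcases (hμ ω).eq_or_lt with h0 | h0
  · simp [← h0]
  · rw [Real.logb_mul (prob_pos hμ Z h0).ne' (prob_pos hμ W h0).ne']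
    ring

/-- The identity is the finest variable, and the uniform law is the reference in Gibbs' inequality.
The bound refers to the sample space because the alphabet of `Z` can be infinite. -/
theorem entropy_le_card {μ : Ω → ℝ} (hμ : ∀ ω, 0 ≤ μ ω) (h1 : ∑ ω, μ ω = 1) (Z : Ω → α) :
    entropy μ Z ≤ Real.logb 2 (Fintype.card Ω) := by
  have hne : Nonempty Ω := by
    by_contra h
    rw [not_nonempty_iff] at h
    simp at h1
  have hc : (0 : ℝ) < Fintype.card Ω := by exact_mod_cast Fintype.card_pos
  refine (entropy_mono hμ (Z := fun ω => ω) (fun ω ω' _ _ h => by rw [h])).trans ?_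
  refine (entropy_le_cross hμ h1 _ (fun _ => (Fintype.card Ω : ℝ)⁻¹) (fun _ => by positivity)
    (fun _ _ => by positivity) (fun s => ?_)).trans_eq ?_
  · rw [Finset.sum_const, nsmul_eq_mul, ← div_eq_mul_inv, div_le_one hc]
    exact_mod_cast Finset.card_le_univ s
  · rw [← Finset.sum_mul, h1, Real.logb_inv]
    ring

/-- Transport of entropy along a measure preserving map. -/
theorem entropy_comp {Ω' : Type*} [Fintype Ω'] {μ : Ω → ℝ} {ν : Ω' → ℝ} (e : Ω → Ω')
    (h : ∀ φ : Ω' → ℝ, ∑ ω, μ ω * φ (e ω) = ∑ ω', ν ω' * φ ω') (Z : Ω' → α) :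
    entropy μ (fun ω => Z (e ω)) = entropy ν Z := by
  classical
  have hp : ∀ a, prob μ (fun ω => Z (e ω)) a = prob ν Z a := by
    intro a
    rw [prob_eq_sum_ite, prob_eq_sum_ite]
    simpa using h (fun ω' => if Z ω' = a then 1 else 0)
  rw [entropy_eq_sum, entropy_eq_sum]
  simp_rw [hp]
  exact h (fun ω' => -Real.logb 2 (prob ν Z (Z ω')))

end Entropy

/-! ### Input laws -/

/-- The joint law of three independent letters with the same law `p`. -/
def prodLaw {𝒳 : Type*} (p : 𝒳 → ℝ) (x : Fin 3 → 𝒳) : ℝ := ∏ j, p (x j)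

section ProdLaw

variable {𝒳 : Type*} {p : 𝒳 → ℝ}

theorem prodLaw_nonneg (hp : ∀ x, 0 ≤ p x) (x : Fin 3 → 𝒳) : 0 ≤ prodLaw p x :=
  Finset.prod_nonneg fun _ _ => hp _

theorem prodLaw_pos {x : Fin 3 → 𝒳} (h : ∀ j, 0 < p (x j)) : 0 < prodLaw p x :=
  Finset.prod_pos fun _ _ => h _

theorem sum_prodLaw [Fintype 𝒳] (hp : ∑ x, p x = 1) : ∑ x : Fin 3 → 𝒳, prodLaw p x = 1 := by
  simp only [prodLaw]
  rw [sum_pi_prod (fun _ : Fin 3 => p)]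
  simp [hp]

theorem entropy_prodLaw_apply [Fintype 𝒳] (hp : ∑ x, p x = 1) {α : Type*} (Z : 𝒳 → α)
    (j : Fin 3) : entropy (prodLaw p) (fun x => Z (x j)) = entropy p Z :=
  entropy_comp (fun x : Fin 3 → 𝒳 => x j)
    (fun φ => sum_pi_prod_mul (fun _ : Fin 3 => p) (fun _ => hp) j φ) Z

end ProdLaw

section Law

variable {𝒬 𝒳 α : Type*} [Fintype 𝒬] [Fintype 𝒳] (L : InputLaw 𝒬 𝒳)

theorem InputLaw.mass_eq (ω : 𝒬 × (Fin 3 → 𝒳)) :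
    L.mass ω = L.pQ ω.1 * prodLaw (L.pX ω.1) ω.2 := rfl

theorem InputLaw.mass_nonneg (ω : 𝒬 × (Fin 3 → 𝒳)) : 0 ≤ L.mass ω :=
  mul_nonneg (L.pQ_nonneg _) (prodLaw_nonneg (L.pX_nonneg _) _)

theorem InputLaw.sum_mass : ∑ ω, L.mass ω = 1 := by
  rw [Fintype.sum_prod_type]
  simp_rw [L.mass_eq, ← Finset.mul_sum, sum_prodLaw (L.pX_sum _), mul_one]
  exact L.pQ_sum

theorem InputLaw.prob_mass_pair (Z : (Fin 3 → 𝒳) → α) (a : α) (q : 𝒬) :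
    prob L.mass (fun ω => (Z ω.2, ω.1)) (a, q) = L.pQ q * prob (prodLaw (L.pX q)) Z a := by
  classical
  rw [prob_eq_sum_ite, prob_eq_sum_ite, Fintype.sum_prod_type, Finset.sum_eq_single q]
  · rw [Finset.mul_sum]
    refine Finset.sum_congr rfl fun x _ => ?_
    simp [L.mass_eq]
  · intro q' _ hq'
    exact Finset.sum_eq_zero fun x _ => by simp [hq']
  · simp

/-- The chain rule H(Z,Q) = H(Z|Q) + H(Q), with the first term written as a mean over `q`. The term
H(Q) cancels in every conditional entropy below. -/
theorem InputLaw.entropy_mass_pair (Z : (Fin 3 → 𝒳) → α) :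
    entropy L.mass (fun ω => (Z ω.2, ω.1)) =
      ∑ q, L.pQ q * entropy (prodLaw (L.pX q)) Z + ∑ q, L.pQ q * -Real.logb 2 (L.pQ q) := by
  rw [entropy_eq_sum, Fintype.sum_prod_type, ← Finset.sum_add_distrib]
  refine Finset.sum_congr rfl fun q _ => ?_
  have h1 : L.pQ q * -Real.logb 2 (L.pQ q) =
      ∑ x, L.mass (q, x) * -Real.logb 2 (L.pQ q) := by
    simp_rw [L.mass_eq]
    rw [← Finset.sum_mul, ← Finset.mul_sum, sum_prodLaw (L.pX_sum q), mul_one]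
  rw [entropy_eq_sum, Finset.mul_sum, h1, ← Finset.sum_add_distrib]
  refine Finset.sum_congr rfl fun x _ => ?_
  rw [L.prob_mass_pair, L.mass_eq]
  rcases (L.pQ_nonneg q).eq_or_lt with h0 | h0
  · simp [← h0]
  rcases (prodLaw_nonneg (L.pX_nonneg q) x).eq_or_lt with h2 | h2
  · simp [← h2]
  have h3 := prob_pos (prodLaw_nonneg (L.pX_nonneg q)) Z h2
  rw [Real.logb_mul h0.ne' h3.ne']
  ring

end Law

/-! ### Conditional entropies of signals and outputs -/

namespace Model

section Level

variable {𝒳 𝒰 𝒱 : Type*} {𝒴 : Fin 3 → Type*} (D : Model 𝒳 𝒰 𝒱 𝒴)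

/-- The value of a signal of level `l` as a function of the letter of its transmitter. -/
def level (D : Model 𝒳 𝒰 𝒱 𝒴) : Level → 𝒳 → 𝒳 ⊕ 𝒰 ⊕ 𝒱
  | .full, x => .inl x
  | .fine, x => .inr (.inl (D.g₁ x))
  | .coarse, x => .inr (.inr (D.g₂ (D.g₁ x)))

theorem value_eq_level (x : Fin 3 → 𝒳) (j : Fin 3) (l : Level) :
    D.value x (j, l) = D.level l (x j) := by
  cases l <;> rfl

theorem values_eq_iff (A : Finset Signal) (x x' : Fin 3 → 𝒳) :
    D.values A x' = D.values A x ↔ ∀ s ∈ A, D.level s.2 (x' s.1) = D.level s.2 (x s.1) := by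
  simp only [funext_iff, values, Subtype.forall]
  exact forall₂_congr fun s _ => by rw [← value_eq_level, ← value_eq_level]

theorem output_eq_of_level {i : Fin 3} {x x' : Fin 3 → 𝒳}
    (h0 : D.level .coarse (x' i) = D.level .coarse (x i))
    (h1 : D.level .fine (x' (i + 1)) = D.level .fine (x (i + 1)))
    (h2 : D.level .full (x' (i + 2)) = D.level .full (x (i + 2))) :
    D.output i x' = D.output i x := by
  simp only [level, Sum.inr.injEq, Sum.inl.injEq] at h0 h1 h2
  simp [output, h0, h1, h2]

end Level

variable {𝒬 𝒳 𝒰 𝒱 : Type*} {𝒴 : Fin 3 → Type*} [Fintype 𝒬] [Fintype 𝒳]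
  (D : Model 𝒳 𝒰 𝒱 𝒴) (L : InputLaw 𝒬 𝒳)

theorem hOut_eq_sum (i : Fin 3) (A : Finset Signal) :
    D.hOut L i A = ∑ q, L.pQ q *
      (entropy (prodLaw (L.pX q)) (fun x => (D.output i x, D.values A x)) -
        entropy (prodLaw (L.pX q)) (D.values A)) := by
  have h : entropy L.mass (fun ω => (D.output i ω.2, (D.values A ω.2, ω.1))) =
      entropy L.mass (fun ω => ((D.output i ω.2, D.values A ω.2), ω.1)) :=
    entropy_congr L.mass_nonneg fun ω ω' => by simp only [Prod.mk.injEq, and_assoc]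
  rw [hOut, condEntropy, h,
    L.entropy_mass_pair (fun x => (D.output i x, D.values A x)), L.entropy_mass_pair (D.values A)]
  simp_rw [mul_sub]
  rw [Finset.sum_sub_distrib]
  ring

theorem hSig_empty_eq_sum (S : Finset Signal) :
    D.hSig L S ∅ = ∑ q, L.pQ q * entropy (prodLaw (L.pX q)) (D.values S) := by
  have h : entropy L.mass (fun ω => (D.values S ω.2, (D.values ∅ ω.2, ω.1))) =
      entropy L.mass (fun ω => (D.values S ω.2, ω.1)) :=
    entropy_congr L.mass_nonneg fun ω ω' => by
      simp only [Prod.mk.injEq, eq_iff_true_of_subsingleton, true_and]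
  have h' : ∀ q, entropy (prodLaw (L.pX q)) (D.values ∅) = 0 := by
    intro q
    rw [entropy_eq_sum]
    refine Finset.sum_eq_zero fun x _ => ?_
    have : prob (prodLaw (L.pX q)) (D.values ∅) (D.values ∅ x) = 1 := by
      classical
      rw [prob_eq_sum_ite, ← sum_prodLaw (L.pX_sum q)]
      exact Finset.sum_congr rfl fun y _ => if_pos (Subsingleton.elim _ _)
    rw [this]
    simp
  rw [hSig, condEntropy, h, L.entropy_mass_pair (D.values S), L.entropy_mass_pair (D.values ∅)]
  simp [h']

theorem hSig_singleton (j : Fin 3) (l : Level) :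
    D.hSig L {(j, l)} ∅ = ∑ q, L.pQ q * entropy (L.pX q) (D.level l) := by
  rw [hSig_empty_eq_sum]
  refine Finset.sum_congr rfl fun q _ => ?_
  rw [← entropy_prodLaw_apply (L.pX_sum q) (D.level l) j]
  congr 1
  exact entropy_congr (prodLaw_nonneg (L.pX_nonneg q)) fun x x' => by simp [values_eq_iff]

theorem hOut_empty_eq_sum (i : Fin 3) :
    D.hOut L i ∅ = ∑ q, L.pQ q * entropy (prodLaw (L.pX q)) (D.output i) := by
  have h := D.hOut_eq_sum L i ∅
  have h0 := D.hSig_empty_eq_sum L ∅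
  have h1 : D.hSig L ∅ ∅ = 0 := by
    rw [hSig, condEntropy, sub_eq_zero]
    exact entropy_congr L.mass_nonneg fun ω ω' => by
      simp only [Prod.mk.injEq, eq_iff_true_of_subsingleton, true_and]
  simp_rw [h, mul_sub, Finset.sum_sub_distrib]
  rw [← h0, h1, sub_zero]
  refine Finset.sum_congr rfl fun q _ => ?_
  congr 1
  exact entropy_congr (prodLaw_nonneg (L.pX_nonneg q)) fun x x' => by
    simp only [Prod.mk.injEq, eq_iff_true_of_subsingleton, and_true]

/-- By the symmetry of mutual information. In this form the admissibility conditions become linear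
identities between output entropies. -/
theorem infoOut_eq (i : Fin 3) (S A : Finset Signal) :
    D.infoOut L i S A = D.hOut L i A - D.hOut L i (S ∪ A) := by
  have h1 : entropy L.mass (fun ω => (D.values S ω.2, (D.values A ω.2, ω.1))) =
      entropy L.mass (fun ω => (D.values (S ∪ A) ω.2, ω.1)) :=
    entropy_congr L.mass_nonneg fun ω ω' => by
      simp only [Prod.mk.injEq, values_eq_iff, Finset.forall_mem_union, and_assoc]
  have h2 : entropy L.mass
        (fun ω => (D.values S ω.2, (D.output i ω.2, (D.values A ω.2, ω.1)))) =
      entropy L.mass (fun ω => (D.output i ω.2, (D.values (S ∪ A) ω.2, ω.1))) :=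
    entropy_congr L.mass_nonneg fun ω ω' => by
      simp only [Prod.mk.injEq, values_eq_iff, Finset.forall_mem_union]
      tauto
  rw [infoOut, condMutualInfo, hOut, hOut]
  simp only [condEntropy]
  rw [h1, h2]
  ring

theorem hOut_congr (i : Fin 3) {A A' : Finset Signal}
    (h : ∀ x x' : Fin 3 → 𝒳, D.values A x' = D.values A x ↔ D.values A' x' = D.values A' x) :
    D.hOut L i A = D.hOut L i A' := by
  simp only [hOut, condEntropy]
  congr 1 <;> exact entropy_congr L.mass_nonneg fun ω ω' => by simp only [Prod.mk.injEq, h]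

theorem hOut_heard (i : Fin 3) :
    D.hOut L i {(i, .coarse), (i + 1, .fine), (i + 2, .full)} = 0 := by
  rw [hOut, condEntropy, sub_eq_zero]
  refine entropy_congr L.mass_nonneg fun ω ω' => ?_
  simp only [Prod.mk.injEq, values_eq_iff, Finset.mem_insert, Finset.mem_singleton,
    forall_eq_or_imp, forall_eq, and_iff_right_iff_imp]
  rintro ⟨⟨h0, h1, h2⟩, -⟩
  exact D.output_eq_of_level h0 h1 h2

/-- The signals heard at receiver `i` from the users outside `S`. -/
def heardOff (i : Fin 3) (S : Finset (Fin 3)) : Finset Signal :=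
  Sᶜ.image (fun j => (j, heard i j))

variable {D L}

/-- Under the standing assumptions, the conditional output entropy given the signals heard from
the users outside `S` supports `S.card` times the rate formula. -/
theorem Admissible.card_mul_rateFormula_le (h : D.Admissible L) (i : Fin 3) (S : Finset (Fin 3))
    (hS : S.Nonempty) : S.card * D.rateFormula L ≤ D.hOut L i (heardOff i S) := by
  have e0 : heard i i = .coarse := by clear * -; revert i; decide
  have e1 : heard i (i + 1) = .fine := by clear * -; revert i; decide
  have e2 : heard i (i + 2) = .full := by clear * -; revert i; decide
  have d1 : decodeSet i (i + 1) = {(i + 1, .fine), (i + 1, .coarse)} := by clear * -; revert i; decide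
  have d2 : decodeSet i (i + 2) = {(i + 2, .full), (i + 2, .fine), (i + 2, .coarse)} := by
    clear * -; revert i; decide
  have n20 : decodeSet i (i + 2) ∩ decodeSet i i = ∅ := by clear * -; revert i; decide
  have n21 : decodeSet i (i + 2) ∩ decodeSet i (i + 1) = ∅ := by clear * -; revert i; decide
  have n12 : decodeSet i (i + 1) ∩ decodeSet i (i + 2) = ∅ := by clear * -; revert i; decide
  have hX : ((i + 2 : Fin 3), Level.full) ∈ decodeSet i (i + 2) := by clear * -; revert i; decide
  have i02 : i ≠ i + 2 := by clear * -; revert i; decide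
  have i12 : i + 1 ≠ i + 2 := by clear * -; revert i; decide
  have i01 : i + 1 ≠ i := by clear * -; revert i; decide
  have sub1 : decodeSet i (i + 1) ⊆ decodeAll i := by clear * -; revert i; decide
  have sub2 : decodeSet i (i + 2) ⊆ decodeAll i := by clear * -; revert i; decide
  have hCBX := D.hOut_heard L i
  -- With a, b, c the entropies of the coarse, fine and full signals heard here, conditioning sets
  -- `A` that consist of the signals of a single transmitter suffice. The two weak conditions give
  -- H(Y|B,X) = a, H(Y|C,X) = b and H(Y|X) = a + b; the strong one gives H(Y|C,B) = c and H(Y|B) = a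
  -- + c; clear observability gives H(Y|C) = b + c.
  obtain ⟨w1, w1'⟩ := h.weak i i (i + 2) (i + 1) (decodeSet i (i + 2)) hX i02 i12 i01 sub2
    (Or.inl subset_rfl)
  obtain ⟨w2, w2'⟩ := h.weak i (i + 1) (i + 2) i (decodeSet i (i + 2)) hX i12 i02 i01.symm sub2
    (Or.inl subset_rfl)
  obtain ⟨s1, s1'⟩ := h.strong i (i + 2) (i + 1) (decodeSet i (i + 1)) hX i12 sub1 subset_rfl
  obtain ⟨c1, c2⟩ := h.clearlyObservable i
  have sy := h.symmetric i
  rw [w1', n20] at w1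
  rw [w2', n21] at w2
  rw [s1', n12] at s1
  rw [n20] at w1'
  rw [n21] at w2'
  rw [n12] at s1'
  rw [infoOut_eq, e0] at w1
  rw [infoOut_eq, e1] at w2
  rw [infoOut_eq] at s1
  rw [infoOut_eq, e0, e1, Finset.union_empty, Finset.singleton_union, hCBX, sub_zero] at w1'
  rw [infoOut_eq, e0, e1, Finset.union_empty, Finset.singleton_union, Finset.insert_comm,
    hCBX, sub_zero] at w2'
  have p1 : ({(i + 2, .full)} ∪ {(i, .coarse), (i + 1, .fine)} : Finset Signal) =
      {(i, .coarse), (i + 1, .fine), (i + 2, .full)} := by clear * -; revert i; decide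
  rw [infoOut_eq, Finset.union_empty, p1, hCBX, sub_zero] at s1'
  rw [infoOut_eq, Finset.union_empty, hCBX, sub_zero] at sy
  have fineOfFull : ∀ x x' : 𝒳, D.level .full x' = D.level .full x →
      D.level .fine x' = D.level .fine x := by
    intro x x' h; simp only [level, Sum.inl.injEq] at h; rw [h]
  have coarseOfFine : ∀ x x' : 𝒳, D.level .fine x' = D.level .fine x →
      D.level .coarse x' = D.level .coarse x := by
    intro x x' h; simp only [level, Sum.inr.injEq, Sum.inl.injEq] at h; simp [level, h]
  have q1 : D.hOut L i (decodeSet i (i + 2)) = D.hOut L i {(i + 2, .full)} :=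
    D.hOut_congr L i fun x x' => by
      rw [d2]
      simp only [values_eq_iff, Finset.mem_insert, Finset.mem_singleton, forall_eq_or_imp,
        forall_eq]
      exact ⟨fun h => h.1, fun h => ⟨h, fineOfFull _ _ h, coarseOfFine _ _ (fineOfFull _ _ h)⟩⟩
  have q2 : D.hOut L i ({(i, .coarse)} ∪ decodeSet i (i + 2)) =
      D.hOut L i {(i, .coarse), (i + 2, .full)} :=
    D.hOut_congr L i fun x x' => by
      rw [d2]
      simp only [values_eq_iff, Finset.mem_insert, Finset.mem_singleton, forall_eq_or_imp,
        forall_eq, Finset.singleton_union]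
      exact ⟨fun h => ⟨h.1, h.2.1⟩, fun h =>
        ⟨h.1, h.2, fineOfFull _ _ h.2, coarseOfFine _ _ (fineOfFull _ _ h.2)⟩⟩
  have q3 : D.hOut L i (decodeSet i (i + 1)) = D.hOut L i {(i + 1, .fine)} :=
    D.hOut_congr L i fun x x' => by
      rw [d1]
      simp only [values_eq_iff, Finset.mem_insert, Finset.mem_singleton, forall_eq_or_imp,
        forall_eq]
      exact ⟨fun h => h.1, fun h => ⟨h, coarseOfFine _ _ h⟩⟩
  have q4 : D.hOut L i ({(i + 2, .full)} ∪ decodeSet i (i + 1)) =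
      D.hOut L i {(i + 1, .fine), (i + 2, .full)} :=
    D.hOut_congr L i fun x x' => by
      rw [d1]
      simp only [values_eq_iff, Finset.mem_insert, Finset.mem_singleton, forall_eq_or_imp,
        forall_eq, Finset.singleton_union]
      exact ⟨fun h => ⟨h.2.1, h.1⟩, fun h => ⟨h.2, h.1, coarseOfFine _ _ h.1⟩⟩
  rw [q1, q2] at w1
  rw [q3, q4] at s1
  -- Identical inputs are used here: the signals come from different users, but their entropies are
  -- those of functions of one letter with the same law.
  have hab : D.hSig L {(i, .coarse)} ∅ ≤ D.hSig L {(i + 1, .fine)} ∅ := by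
    rw [hSig_singleton, hSig_singleton]
    exact Finset.sum_le_sum fun q _ => mul_le_mul_of_nonneg_left
      (entropy_mono (L.pX_nonneg q) fun x x' _ _ => coarseOfFine x x') (L.pQ_nonneg q)
  have hbc : D.hSig L {(i + 1, .fine)} ∅ ≤ D.hSig L {(i + 2, .full)} ∅ := by
    rw [hSig_singleton, hSig_singleton]
    exact Finset.sum_le_sum fun q _ => mul_le_mul_of_nonneg_left
      (entropy_mono (L.pX_nonneg q) fun x x' _ _ => fineOfFull x x') (L.pQ_nonneg q)
  have hF3 : D.rateFormula L ≤ 1 / 3 * D.hOut L i ∅ := by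
    rw [sy]; exact min_le_right _ _
  have hFa : D.rateFormula L ≤ D.hSig L {(i, .coarse)} ∅ := by
    -- The first term of the rate formula is the entropy of the coarse signal, which is the same for
    -- all users.
    have w0 := (h.weak 0 0 2 1 (decodeSet 0 2) (by decide) (by decide) (by decide) (by decide)
      (by decide) (Or.inl subset_rfl)).2
    have m0 : (decodeSet 0 2 ∩ decodeSet 0 0 : Finset Signal) = ∅ := by decide
    have m1 : heard 0 0 = .coarse := by decide
    have m2 : heard 0 1 = .fine := by decide
    rw [m0, m1, m2, Finset.union_empty] at w0
    rw [hSig_singleton] at w0 ⊢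
    rw [← w0]
    exact min_le_left _ _
  have hcases : S = {i} ∨ S = {i + 1} ∨ S = {i + 2} ∨ S = {i, i + 1} ∨ S = {i, i + 2} ∨
      S = {i + 1, i + 2} ∨ S = Finset.univ := by
    clear * - hS; revert i S; decide
  rcases hcases with rfl | rfl | rfl | rfl | rfl | rfl | rfl
  · have : heardOff i {i} = {(i + 1, .fine), (i + 2, .full)} := by clear * -; revert i; decide
    rw [this, Finset.card_singleton]
    push_cast
    linarith
  · have : heardOff i {i + 1} = {(i, .coarse), (i + 2, .full)} := by clear * -; revert i; decide
    rw [this, Finset.card_singleton]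
    push_cast
    linarith
  · have : heardOff i {i + 2} = {(i, .coarse), (i + 1, .fine)} := by clear * -; revert i; decide
    rw [this, Finset.card_singleton]
    push_cast
    linarith
  · have : heardOff i {i, i + 1} = {(i + 2, .full)} := by clear * -; revert i; decide
    rw [this, Finset.card_pair i01.symm]
    push_cast
    linarith
  · have : heardOff i {i, i + 2} = {(i + 1, .fine)} := by clear * -; revert i; decide
    rw [this, Finset.card_pair i02]
    push_cast
    linarith
  · have : heardOff i {i + 1, i + 2} = {(i, .coarse)} := by clear * -; revert i; decide
    rw [this, Finset.card_pair i12]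
    push_cast
    linarith
  · have : heardOff i Finset.univ = ∅ := by clear * -; revert i; decide
    rw [this, Finset.card_univ, Fintype.card_fin]
    push_cast
    linarith

/-- The rate formula in terms of single-letter entropies. -/
theorem Admissible.rateFormula_eq (h : D.Admissible L) :
    D.rateFormula L = min (∑ q, L.pQ q * entropy (L.pX q) (D.level .coarse))
      (1 / 3 * ∑ q, L.pQ q * entropy (prodLaw (L.pX q)) (D.output 0)) := by
  have w0 := (h.weak 0 0 2 1 (decodeSet 0 2) (by decide) (by decide) (by decide) (by decide)
    (by decide) (Or.inl subset_rfl)).2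
  have m0 : (decodeSet 0 2 ∩ decodeSet 0 0 : Finset Signal) = ∅ := by decide
  have m1 : heard 0 0 = .coarse := by decide
  have m2 : heard 0 1 = .fine := by decide
  rw [m0, m1, m2, Finset.union_empty, hSig_singleton] at w0
  have hCBX := D.hOut_heard L 0
  rw [rateFormula, w0, infoOut_eq, Finset.union_empty, ← hOut_empty_eq_sum]
  rw [zero_add, zero_add] at hCBX
  rw [hCBX, sub_zero]

/-- Clear observability makes the interference a function of the own signal and the output, on
the support of the law. -/
theorem Admissible.determines (h : D.Admissible L) (i : Fin 3) {q : 𝒬} (hq : 0 < L.pQ q)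
    {x x' : Fin 3 → 𝒳} (hx : ∀ j, 0 < L.pX q (x j)) (hx' : ∀ j, 0 < L.pX q (x' j))
    (hC : D.level .coarse (x' i) = D.level .coarse (x i))
    (hY : D.output i x' = D.output i x) :
    D.level .fine (x' (i + 1)) = D.level .fine (x (i + 1)) ∧ x' (i + 2) = x (i + 2) := by
  obtain ⟨c1, -⟩ := h.clearlyObservable i
  rw [hOut_eq_sum, hSig_empty_eq_sum] at c1
  set BX : Finset Signal := {(i + 1, .fine), (i + 2, .full)} with hBX
  have hnn := fun q => prodLaw_nonneg (L.pX_nonneg q)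
  have hdet : ∀ x x' : Fin 3 → 𝒳,
      (D.values {(i, .coarse)} x', D.values BX x') = (D.values {(i, .coarse)} x, D.values BX x) →
      (D.output i x', D.values {(i, .coarse)} x') =
        (D.output i x, D.values {(i, .coarse)} x) := by
    intro x x' hh
    simp only [Prod.mk.injEq, values_eq_iff, hBX, Finset.mem_insert, Finset.mem_singleton,
      forall_eq_or_imp, forall_eq] at hh ⊢
    exact ⟨D.output_eq_of_level hh.1 hh.2.1 hh.2.2, hh.1⟩
  -- The gap in H(Y,C) ≤ H(C,B,X) ≤ H(C) + H(B,X) is non-negative for each `q`. Clear observability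
  -- makes its mean over `q` zero, so it vanishes for every `q` of positive probability, and
  -- equality in the first inequality is determination.
  have hle : ∀ q, 0 ≤ L.pQ q * (entropy (prodLaw (L.pX q)) (D.values {(i, .coarse)}) +
      entropy (prodLaw (L.pX q)) (D.values BX) -
      entropy (prodLaw (L.pX q)) (fun x => (D.output i x, D.values {(i, .coarse)} x))) := by
    intro q
    refine mul_nonneg (L.pQ_nonneg q) ?_
    have h1 := entropy_mono (hnn q) (Z := fun x => (D.values {(i, .coarse)} x, D.values BX x))
      (Z' := fun x => (D.output i x, D.values {(i, .coarse)} x)) (fun x x' _ _ => hdet x x')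
    have h2 := entropy_pair_le (hnn q) (sum_prodLaw (L.pX_sum q)) (D.values {(i, .coarse)})
      (D.values BX)
    linarith
  have hzero : ∑ q, L.pQ q * (entropy (prodLaw (L.pX q)) (D.values {(i, .coarse)}) +
      entropy (prodLaw (L.pX q)) (D.values BX) -
      entropy (prodLaw (L.pX q)) (fun x => (D.output i x, D.values {(i, .coarse)} x))) = 0 := by
    rw [← sub_eq_zero.2 c1.symm, ← Finset.sum_sub_distrib]
    exact Finset.sum_congr rfl fun q _ => by ring
  have hz := (Finset.sum_eq_zero_iff_of_nonneg fun q _ => hle q).1 hzero q (Finset.mem_univ q)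
  have hz' := (mul_eq_zero.1 hz).resolve_left hq.ne'
  have h2 := entropy_pair_le (hnn q) (sum_prodLaw (L.pX_sum q)) (D.values {(i, .coarse)})
    (D.values BX)
  have key := determined_of_entropy_le (hnn q)
    (Z := fun x => (D.values {(i, .coarse)} x, D.values BX x))
    (Z' := fun x => (D.output i x, D.values {(i, .coarse)} x)) hdet (by linarith)
    (prodLaw_pos hx) (prodLaw_pos hx') (by simpa [values_eq_iff] using ⟨hY, hC⟩)
  simp only [Prod.mk.injEq, values_eq_iff, hBX, Finset.mem_insert, Finset.mem_singleton,
      forall_eq_or_imp, forall_eq] at key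
  refine ⟨key.2.1, ?_⟩
  simpa [level] using key.2.2

end Model

/-! ### Robust typicality -/

section Typical

variable {Ω α : Type*} [Fintype Ω]

/-- The empirical frequency of each symbol of `s` is within a factor `1 ± ε` of its probability
under `Z`. -/
def RobustlyTypical (μ : Ω → ℝ) (Z : Ω → α) (ε : ℝ) {n : ℕ} (s : Fin n → α) : Prop :=
  ∀ a, |(open Classical in ((Finset.univ.filter (fun t => s t = a)).card : ℝ) / (n : ℝ))
      - prob μ Z a| ≤ ε * prob μ Z a

theorem RobustlyTypical.prob_pos {μ : Ω → ℝ} (hμ : ∀ ω, 0 ≤ μ ω) {Z : Ω → α} {ε : ℝ} {n : ℕ}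
    {s : Fin n → α} (h : RobustlyTypical μ Z ε s) (t : Fin n) : 0 < prob μ Z (s t) := by
  classical
  refine (prob_nonneg hμ Z (s t)).lt_of_ne' fun h0 => ?_
  have h1 := h (s t)
  rw [h0, mul_zero, sub_zero] at h1
  have h2 := abs_nonpos_iff.1 h1
  have hn : (0 : ℝ) < n := by exact_mod_cast t.pos
  rw [div_eq_zero_iff, or_iff_left hn.ne', Nat.cast_eq_zero, Finset.card_eq_zero] at h2
  have : t ∈ (∅ : Finset (Fin n)) := h2 ▸ (by simp)
  simp at this

/-- Each symbol occurs at least n(1-ε) times its probability, and `φ ≥ 0` allows other symbols to be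
dropped. With the conditional information content as `φ` this produces the error exponent. -/
theorem RobustlyTypical.le_sum {μ : Ω → ℝ} {Z : Ω → α} {ε : ℝ} {n : ℕ}
    {s : Fin n → α} (h : RobustlyTypical μ Z ε s) {φ : α → ℝ} (hφ : ∀ a, 0 ≤ φ a) :
    n * (1 - ε) * ∑ ω, μ ω * φ (Z ω) ≤ ∑ t, φ (s t) := by
  classical
  rcases Nat.eq_zero_or_pos n with rfl | hn
  · simp
  have hn' : (0 : ℝ) < n := by exact_mod_cast hn
  calc n * (1 - ε) * ∑ ω, μ ω * φ (Z ω)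
      = ∑ a ∈ Finset.univ.image Z, n * (1 - ε) * (prob μ Z a * φ a) := by
        rw [← Finset.mul_sum, ← sum_image_prob_mul]
    _ ≤ ∑ a ∈ Finset.univ.image Z, ∑ t, (if s t = a then φ a else 0) := by
        refine Finset.sum_le_sum fun a _ => ?_
        rw [← Finset.sum_filter, Finset.sum_const, nsmul_eq_mul]
        have h1 := (abs_le.1 (h a)).1
        have h2 : (1 - ε) * prob μ Z a ≤
            ((Finset.univ.filter (fun t => s t = a)).card : ℝ) / (n : ℝ) := by
          have : (((Finset.univ.filter (fun t => s t = a)).card : ℝ) / (n : ℝ)) =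
            (open Classical in
              ((Finset.univ.filter (fun t => s t = a)).card : ℝ) / (n : ℝ)) := by congr
          rw [this]
          linarith
        rw [le_div_iff₀ hn'] at h2
        have := mul_le_mul_of_nonneg_right h2 (hφ a)
        linarith
    _ = ∑ t, ∑ a ∈ Finset.univ.image Z, (if s t = a then φ a else 0) := Finset.sum_comm
    _ ≤ ∑ t, φ (s t) := by
        refine Finset.sum_le_sum fun t _ => ?_
        rw [Finset.sum_ite_eq]
        split_ifs
        · exact le_rfl
        · exact hφ _

theorem sum_prod_mul_count_sq (μ : Ω → ℝ) (h1 : ∑ ω, μ ω = 1) (Z : Ω → α) (n : ℕ) (a : α) :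
    ∑ ω : Fin n → Ω, (∏ t, μ (ω t)) *
      ((open Classical in ((Finset.univ.filter (fun t => Z (ω t) = a)).card : ℝ)) -
        n * prob μ Z a) ^ 2 = n * (prob μ Z a - prob μ Z a ^ 2) := by
  classical
  have hP := prob_eq_sum_ite μ Z a
  have key := sum_prod_mul_sum_sq (ι := Fin n) μ h1
    (fun ω => (if Z ω = a then 1 else 0) - prob μ Z a) (by
      simp_rw [mul_sub, Finset.sum_sub_distrib, ← Finset.sum_mul, h1]
      rw [hP]; simp)
  rw [Fintype.card_fin] at key
  convert key using 2 with ω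
  · rw [Finset.sum_sub_distrib]
    simp
  · have : ∀ ω, μ ω * ((if Z ω = a then 1 else 0) - prob μ Z a) ^ 2 =
        (if Z ω = a then μ ω else 0) * (1 - 2 * prob μ Z a) + μ ω * prob μ Z a ^ 2 := by
      intro ω; split_ifs <;> ring
    simp_rw [this, Finset.sum_add_distrib, ← Finset.sum_mul, h1]
    rw [← prob_eq_sum_ite μ Z a]
    ring

/-- Chebyshev's bound: independent sequences are typical with high probability. -/
theorem exists_sum_not_typical_le {μ : Ω → ℝ} (hμ : ∀ ω, 0 ≤ μ ω) (h1 : ∑ ω, μ ω = 1)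
    (Z : Ω → α) {ε : ℝ} (hε : 0 < ε) :
    ∃ K : ℝ, 0 ≤ K ∧ ∀ n : ℕ, 0 < n → (open Classical in ∑ ω : Fin n → Ω, (∏ t, μ (ω t)) *
      (if RobustlyTypical μ Z ε (fun t => Z (ω t)) then 0 else 1)) ≤ K / n := by
  classical
  refine ⟨∑ a ∈ Finset.univ.image Z, 1 / (ε ^ 2 * prob μ Z a), Finset.sum_nonneg fun a _ => by
    have := prob_nonneg hμ Z a; positivity, fun n hn => ?_⟩
  have hn' : (0 : ℝ) < n := by exact_mod_cast hn
  -- Weights under which an atypical symbol contributes at least 1 to the quadratic sum. For a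
  -- symbol of probability zero weight 1 is enough, because its count is an integer; the expected
  -- square is then zero, in agreement with the convention 1/0 = 0 in the constant.
  set κ : α → ℝ := fun a => if prob μ Z a = 0 then 1 else 1 / (n * ε * prob μ Z a) ^ 2 with hκ
  have hκ0 : ∀ a, 0 ≤ κ a := by intro a; simp only [hκ]; split_ifs <;> positivity
  set N : (Fin n → Ω) → α → ℝ := fun ω a =>
    ((Finset.univ.filter (fun t => Z (ω t) = a)).card : ℝ) with hN
  have hpt : ∀ ω : Fin n → Ω, (if RobustlyTypical μ Z ε (fun t => Z (ω t)) then (0 : ℝ) else 1) ≤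
      ∑ a ∈ Finset.univ.image Z, κ a * (N ω a - n * prob μ Z a) ^ 2 := by
    intro ω
    have hnn : ∀ a, 0 ≤ κ a * (N ω a - n * prob μ Z a) ^ 2 :=
      fun a => mul_nonneg (hκ0 a) (sq_nonneg _)
    split_ifs with ht
    · exact Finset.sum_nonneg fun a _ => hnn a
    · simp only [RobustlyTypical, not_forall, not_le] at ht
      obtain ⟨a, ha⟩ := ht
      have ha' : ε * prob μ Z a < |N ω a / n - prob μ Z a| := by
        convert ha using 3
      have haI : a ∈ Finset.univ.image Z := by
        by_contra hne
        have hz : ∀ ω, Z ω ≠ a := fun ω h => hne (h ▸ Finset.mem_image_of_mem _ (Finset.mem_univ _))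
        have h0 : prob μ Z a = 0 := by rw [prob_eq_sum_ite]; simp [hz]
        have h2 : N ω a = 0 := by simp [hN, hz]
        rw [h0, h2] at ha'
        simp at ha'
      refine le_trans ?_ (Finset.single_le_sum (f := fun a => κ a * (N ω a - n * prob μ Z a) ^ 2)
        (fun a _ => hnn a) haI)
      by_cases h0 : prob μ Z a = 0
      · have h2 : N ω a ≠ 0 := by
          intro h2
          rw [h0, h2] at ha'
          simp at ha'
        have h3 : (1 : ℝ) ≤ N ω a := by
          have : (Finset.univ.filter (fun t => Z (ω t) = a)).card ≠ 0 := by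
            intro h; exact h2 (by simp only [hN]; rw [h]; simp)
          simp only [hN]
          exact_mod_cast Nat.one_le_iff_ne_zero.2 this
        simp only [hκ, h0, if_true, mul_zero, sub_zero, one_mul]
        nlinarith
      · have hp : 0 < prob μ Z a := (prob_nonneg hμ Z a).lt_of_ne' h0
        simp only [hκ, h0, if_false]
        rw [one_div, ← div_eq_inv_mul, one_le_div (by positivity), sq_le_sq,
          abs_of_nonneg (by positivity : (0 : ℝ) ≤ n * ε * prob μ Z a)]
        have h4 : N ω a - n * prob μ Z a = n * (N ω a / n - prob μ Z a) := by
          field_simp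
        rw [h4, abs_mul, abs_of_pos hn', mul_assoc]
        exact mul_le_mul_of_nonneg_left ha'.le hn'.le
  calc _ ≤ ∑ ω : Fin n → Ω, (∏ t, μ (ω t)) *
        ∑ a ∈ Finset.univ.image Z, κ a * (N ω a - n * prob μ Z a) ^ 2 :=
        Finset.sum_le_sum fun ω _ => mul_le_mul_of_nonneg_left (hpt ω)
          (Finset.prod_nonneg fun t _ => hμ _)
    _ = ∑ a ∈ Finset.univ.image Z, κ a * ∑ ω : Fin n → Ω, (∏ t, μ (ω t)) *
          (N ω a - n * prob μ Z a) ^ 2 := by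
        simp_rw [Finset.mul_sum]
        rw [Finset.sum_comm]
        exact Finset.sum_congr rfl fun a _ => Finset.sum_congr rfl fun ω _ => by ring
    _ ≤ ∑ a ∈ Finset.univ.image Z, 1 / (ε ^ 2 * prob μ Z a) / n := by
        refine Finset.sum_le_sum fun a _ => ?_
        have := sum_prod_mul_count_sq μ h1 Z n a
        have h2 : ∑ ω : Fin n → Ω, (∏ t, μ (ω t)) * (N ω a - n * prob μ Z a) ^ 2 =
            n * (prob μ Z a - prob μ Z a ^ 2) := by
          rw [← this]
        rw [h2]
        by_cases h0 : prob μ Z a = 0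
        · simp [h0]
        · have hp : 0 < prob μ Z a := (prob_nonneg hμ Z a).lt_of_ne' h0
          simp only [hκ, h0, if_false]
          rw [div_div, one_div, ← div_eq_inv_mul, div_le_div_iff₀ (by positivity) (by positivity)]
          have : 0 ≤ (n : ℝ) ^ 2 * ε ^ 2 * prob μ Z a ^ 3 := by positivity
          nlinarith
    _ = _ := by rw [Finset.sum_div]

end Typical

/-! ### The letterwise change of measure -/

section Letter

variable {Ω β γ : Type*} [Fintype Ω]

theorem prob_pair_le {μ : Ω → ℝ} (hμ : ∀ ω, 0 ≤ μ ω) (Y : Ω → β) (A : Ω → γ) (y : β) (a : γ) :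
    prob μ (fun ω => (Y ω, A ω)) (y, a) ≤ prob μ A a := by
  classical
  rw [prob_eq_sum_ite, prob_eq_sum_ite]
  refine Finset.sum_le_sum fun ω _ => ?_
  by_cases h : A ω = a
  · simp only [Prod.mk.injEq, h, and_true, if_true]
    split_ifs <;> simp [hμ]
  · simp [h]

/-- The conditional probability `P(Y = y | A = a)`. -/
noncomputable def condProb (μ : Ω → ℝ) (Y : Ω → β) (A : Ω → γ) (y : β) (a : γ) : ℝ :=
  prob μ (fun ω => (Y ω, A ω)) (y, a) / prob μ A a

theorem neg_logb_condProb_nonneg {μ : Ω → ℝ} (hμ : ∀ ω, 0 ≤ μ ω) (Y : Ω → β) (A : Ω → γ)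
    (y : β) (a : γ) : 0 ≤ -Real.logb 2 (condProb μ Y A y a) := by
  have h1 := div_le_one_of_le₀ (prob_pair_le hμ Y A y a) (prob_nonneg hμ A a)
  have h2 := div_nonneg (prob_nonneg hμ (fun ω => (Y ω, A ω)) (y, a)) (prob_nonneg hμ A a)
  have := Real.logb_nonpos (b := 2) (by norm_num) h2 h1
  simp only [condProb]
  linarith

theorem entropy_pair_sub {μ : Ω → ℝ} (hμ : ∀ ω, 0 ≤ μ ω) (Y : Ω → β) (A : Ω → γ) :
    entropy μ (fun ω => (Y ω, A ω)) - entropy μ A =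
      ∑ ω, μ ω * -Real.logb 2 (condProb μ Y A (Y ω) (A ω)) := by
  rw [entropy_eq_sum, entropy_eq_sum, ← Finset.sum_sub_distrib]
  refine Finset.sum_congr rfl fun ω _ => ?_
  rcases (hμ ω).eq_or_lt with h0 | h0
  · simp [← h0]
  · rw [condProb, Real.logb_div (prob_pos hμ (fun ω => (Y ω, A ω)) h0).ne' (prob_pos hμ A h0).ne']
    ring

/-- If `y` is determined by `A`, weighting the event `Y = y` by the inverse of `P(Y | A)` gives
total mass at most one. -/
theorem sum_inv_condProb_le {μ : Ω → ℝ} (hμ : ∀ ω, 0 ≤ μ ω) (h1 : ∑ ω, μ ω = 1)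
    (Y : Ω → β) (A : Ω → γ) (y : Ω → β) (hy : ∀ ω ω', A ω = A ω' → y ω = y ω') :
    (open Classical in ∑ ω, μ ω * (if Y ω = y ω then (condProb μ Y A (Y ω) (A ω))⁻¹ else 0))
      ≤ 1 := by
  classical
  set s : Finset Ω := Finset.univ.filter (fun ω => Y ω = y ω) with hs
  set Z : Ω → β × γ := fun ω => (Y ω, A ω) with hZ
  have e1 : (∑ ω, μ ω * (if Y ω = y ω then (condProb μ Y A (Y ω) (A ω))⁻¹ else 0)) =
      ∑ ω ∈ s, μ ω * (prob μ A (A ω) / prob μ Z (Z ω)) := by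
    rw [hs, Finset.sum_filter]
    refine Finset.sum_congr rfl fun ω _ => ?_
    split_ifs with h
    · rw [condProb, inv_div]
    · simp
  rw [e1, ← Finset.sum_fiberwise_of_maps_to (g := Z) (t := s.image Z)
    (fun ω hω => Finset.mem_image_of_mem _ hω)]
  calc _ ≤ ∑ x ∈ s.image Z, prob μ A x.2 := by
        refine Finset.sum_le_sum fun x _ => ?_
        have e2 : ∑ ω ∈ s with Z ω = x, μ ω * (prob μ A (A ω) / prob μ Z (Z ω)) =
            (∑ ω ∈ s with Z ω = x, μ ω) * (prob μ A x.2 / prob μ Z x) := by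
          rw [Finset.sum_mul]
          refine Finset.sum_congr rfl fun ω hω => ?_
          rw [← (Finset.mem_filter.1 hω).2]
        have e3 : ∑ ω ∈ s with Z ω = x, μ ω ≤ prob μ Z x :=
          (Finset.sum_le_sum_of_subset_of_nonneg
            (t := Finset.univ.filter (fun ω => Z ω = x))
            (Finset.filter_subset_filter _ (Finset.subset_univ s)) (fun ω _ _ => hμ ω)).trans_eq
            (by rw [prob]; congr!)
        rw [e2]
        have hA := prob_nonneg hμ A x.2
        have hZ0 := prob_nonneg hμ Z x
        refine (mul_le_mul_of_nonneg_right e3 (div_nonneg hA hZ0)).trans ?_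
        by_cases h0 : prob μ Z x = 0
        · simp [h0, hA]
        · rw [mul_div_cancel₀ _ h0]
    -- On `s` the value of `Y` is `y`, a function of `A`. The pair is thus determined by its second
    -- component, and no value of `A` is counted twice.
    _ = ∑ a ∈ (s.image Z).image Prod.snd, prob μ A a := by
        rw [Finset.sum_image (s := s.image Z) (g := Prod.snd)]
        intro x hx x' hx' hxx
        obtain ⟨ω, hω, rfl⟩ := Finset.mem_image.1 (Finset.mem_coe.1 hx)
        obtain ⟨ω', hω', rfl⟩ := Finset.mem_image.1 (Finset.mem_coe.1 hx')
        have hA : A ω = A ω' := hxx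
        simp only [hZ, Prod.mk.injEq]
        rw [(Finset.mem_filter.1 hω).2, (Finset.mem_filter.1 hω').2]
        exact ⟨hy _ _ hA, hA⟩
    _ ≤ 1 := (sum_prob_le hμ A _).trans_eq h1

end Letter

/-! ### Resampling codewords -/

/-- Exchanging the codewords indexed by `w` with fresh ones preserves the joint weight. The
codewords under test thereby become independent of the rest of the codebooks. -/
theorem sum_codebooks_resample {Z : Type*} [Fintype Z] {m : Fin 3 → ℕ} (P : Z → ℝ)
    (hP : ∑ z, P z = 1) (w : Messages m) (G : ((i : Fin 3) → Fin (m i) → Z) → ℝ) :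
    ∑ c : (i : Fin 3) → Fin (m i) → Z, (∏ i, ∏ k, P (c i k)) * G c =
      ∑ c : (i : Fin 3) → Fin (m i) → Z, (∏ i, ∏ k, P (c i k)) *
        ∑ z : Fin 3 → Z, (∏ i, P (z i)) * G (fun i => Function.update (c i) (w i) (z i)) := by
  classical
  set T : ((i : Fin 3) → Fin (m i) → Z) × (Fin 3 → Z) →
      ((i : Fin 3) → Fin (m i) → Z) × (Fin 3 → Z) :=
    fun x => (fun i => Function.update (x.1 i) (w i) (x.2 i), fun i => x.1 i (w i)) with hT
  have hinv : Function.Involutive T := by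
    intro x
    simp only [hT]
    ext i : 2
    · simp
    · simp
  set W : ((i : Fin 3) → Fin (m i) → Z) × (Fin 3 → Z) → ℝ :=
    fun x => (∏ i, ∏ k, P (x.1 i k)) * ∏ i, P (x.2 i) with hW
  have hWT : ∀ x, W (T x) = W x := by
    intro x
    simp only [hW, hT]
    rw [← Finset.prod_mul_distrib, ← Finset.prod_mul_distrib]
    refine Finset.prod_congr rfl fun i _ => ?_
    rw [← Finset.mul_prod_erase Finset.univ _ (Finset.mem_univ (w i)),
      ← Finset.mul_prod_erase Finset.univ (fun k => P (x.1 i k)) (Finset.mem_univ (w i)),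
      Function.update_self,
      Finset.prod_congr rfl (fun k hk => by
        rw [Function.update_of_ne (Finset.ne_of_mem_erase hk)] :
        ∀ k ∈ Finset.univ.erase (w i),
          P (Function.update (x.1 i) (w i) (x.2 i) k) = P (x.1 i k))]
    ring
  have hz : ∑ z : Fin 3 → Z, ∏ i, P (z i) = 1 := by
    rw [sum_pi_prod (fun _ : Fin 3 => P)]
    simp [hP]
  calc _ = ∑ x : ((i : Fin 3) → Fin (m i) → Z) × (Fin 3 → Z), W x * G x.1 := by
        rw [Fintype.sum_prod_type]
        refine Finset.sum_congr rfl fun c _ => ?_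
        simp only [hW]
        rw [← Finset.sum_mul, ← Finset.mul_sum, hz, mul_one]
    _ = ∑ x : ((i : Fin 3) → Fin (m i) → Z) × (Fin 3 → Z), W x * G (T x).1 := by
        rw [← Equiv.sum_comp hinv.toPerm]
        refine Finset.sum_congr rfl fun x _ => ?_
        rw [Function.Involutive.coe_toPerm, hWT]
    _ = _ := by
        rw [Fintype.sum_prod_type]
        refine Finset.sum_congr rfl fun c _ => ?_
        rw [Finset.mul_sum]
        exact Finset.sum_congr rfl fun z _ => by simp only [hW, hT]; ring

/-! ### Random coding with joint decoding -/

theorem Model.output_eq_of_heard {𝒳 𝒰 𝒱 : Type*} {𝒴 : Fin 3 → Type*} (D : Model 𝒳 𝒰 𝒱 𝒴) {i : Fin 3} {x x' : Fin 3 → 𝒳}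
    (h : ∀ j, D.level (heard i j) (x' j) = D.level (heard i j) (x j)) :
    D.output i x' = D.output i x := by
  have e0 : heard i i = .coarse := by clear * -; revert i; decide
  have e1 : heard i (i + 1) = .fine := by clear * -; revert i; decide
  have e2 : heard i (i + 2) = .full := by clear * -; revert i; decide
  exact D.output_eq_of_level (e0 ▸ h i) (e1 ▸ h (i + 1)) (e2 ▸ h (i + 2))

section RandomCoding

variable {𝒬 𝒳 : Type*} [Fintype 𝒬] [Fintype 𝒳] (L : InputLaw 𝒬 𝒳)

/-- The law of a codeword with independent letters, given the time-sharing sequence. -/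
def seqLaw {n : ℕ} (q : Fin n → 𝒬) (x : Fin n → 𝒳) : ℝ := ∏ t, L.pX (q t) (x t)

theorem seqLaw_nonneg {n : ℕ} (q : Fin n → 𝒬) (x : Fin n → 𝒳) : 0 ≤ seqLaw L q x :=
  Finset.prod_nonneg fun _ _ => L.pX_nonneg _ _

theorem sum_seqLaw {n : ℕ} (q : Fin n → 𝒬) : ∑ x, seqLaw L q x = 1 := by
  simp only [seqLaw]
  rw [sum_pi_prod (fun t => L.pX (q t))]
  simp [L.pX_sum]

theorem unsplitLaw_nonneg {n M : ℕ} (q : Fin n → 𝒬) (b : Fin M → Fin n → 𝒳) :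
    0 ≤ unsplitLaw L q b :=
  Finset.prod_nonneg fun _ _ => seqLaw_nonneg L q _

theorem sum_unsplitLaw {n M : ℕ} (q : Fin n → 𝒬) :
    ∑ b : Fin M → Fin n → 𝒳, unsplitLaw L q b = 1 := by
  change ∑ b : Fin M → Fin n → 𝒳, ∏ w, seqLaw L q (b w) = 1
  rw [sum_pi_prod (fun _ : Fin M => seqLaw L q)]
  simp [sum_seqLaw]

theorem sum_prod_unsplitLaw {n : ℕ} {m : Fin 3 → ℕ} (q : Fin n → 𝒬) :
    ∑ c : Codebooks 𝒳 n m, ∏ i, unsplitLaw L q (c i) = 1 := by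
  rw [sum_pi_prod (fun i (b : Fin (m i) → Fin n → 𝒳) => unsplitLaw L q b)]
  simp [sum_unsplitLaw]

theorem timeSharingProb_nonneg {n : ℕ} (q : Fin n → 𝒬) : 0 ≤ timeSharingProb L q :=
  Finset.prod_nonneg fun _ _ => L.pQ_nonneg _

theorem sum_timeSharingProb (n : ℕ) :
    (open Classical in ∑ q : Fin n → 𝒬, timeSharingProb L q) = 1 := by
  simp only [timeSharingProb]
  rw [sum_pi_prod (fun _ : Fin n => L.pQ)]
  simp [L.pQ_sum]

/-- Summation over three codewords, letter by letter. -/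
theorem sum_seqLaw_mul {n : ℕ} (q : Fin n → 𝒬) (φ : (Fin 3 → Fin n → 𝒳) → ℝ) :
    ∑ z : Fin 3 → Fin n → 𝒳, (∏ i, seqLaw L q (z i)) * φ z =
      ∑ z : Fin n → Fin 3 → 𝒳, (∏ t, prodLaw (L.pX (q t)) (z t)) * φ (fun i t => z t i) := by
  refine Fintype.sum_equiv (Equiv.piComm fun _ _ => 𝒳) _ _ fun z => ?_
  congr 1
  exact Finset.prod_comm

variable {𝒰 𝒱 : Type*} {𝒴 : Fin 3 → Type*} (D : Model 𝒳 𝒰 𝒱 𝒴)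

theorem heard_mem_decodeAll (i j : Fin 3) : (j, heard i j) ∈ decodeAll i := by
  revert i j; decide

theorem jointlyTypical_iff (ε : ℝ) (i : Fin 3) {n : ℕ} (q : Fin n → 𝒬) (x : Fin 3 → Fin n → 𝒳)
    (y : Fin n → 𝒴 i) : JointlyTypical D L ε i q x y ↔
      RobustlyTypical L.mass (fun ω => (ω.1, D.values (decodeAll i) ω.2, D.output i ω.2)) ε
        (fun t => (q t, D.values (decodeAll i) (fun j => x j t), y t)) := by
  unfold JointlyTypical RobustlyTypical
  refine forall_congr' fun a => ?_
  congr!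

/-- The probability that fresh codewords are jointly typical with a received word that depends on
them only through the signals in `A`. -/
theorem sum_jointlyTypical_le {n : ℕ} (ε : ℝ) (i : Fin 3) (q : Fin n → 𝒬)
    {A : Finset Signal} (hA : A ⊆ decodeAll i) (y : Fin n → (Fin 3 → 𝒳) → 𝒴 i)
    (hy : ∀ t x x', D.values A x = D.values A x' → y t x = y t x') :
    (open Classical in ∑ z : Fin 3 → Fin n → 𝒳, (∏ j, seqLaw L q (z j)) *
      (if JointlyTypical D L ε i q z (fun t => y t (fun j => z j t)) then 1 else 0)) ≤
      (2 : ℝ) ^ (-(n * (1 - ε) * D.hOut L i A)) := by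
  classical
  set B : ℝ := (2 : ℝ) ^ (-(n * (1 - ε) * D.hOut L i A)) with hB
  set ψ : 𝒬 → 𝒴 i → (A → 𝒳 ⊕ 𝒰 ⊕ 𝒱) → ℝ := fun q b a =>
    condProb (prodLaw (L.pX q)) (D.output i) (D.values A) b a with hψ
  have hnn := fun q => prodLaw_nonneg (L.pX_nonneg q)
  -- Change of measure: on the typical event the product of the conditional probabilities of the
  -- outputs is at most `B`, so the indicator is at most `B` times the product of their inverses.
  -- The mean of each such factor is at most 1.
  have hpt : ∀ z : Fin n → Fin 3 → 𝒳,
      (if JointlyTypical D L ε i q (fun i t => z t i) (fun t => y t (z t)) then (1 : ℝ) else 0) ≤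
      B * ∏ t, (if D.output i (z t) = y t (z t)
        then (ψ (q t) (D.output i (z t)) (D.values A (z t)))⁻¹ else 0) := by
    intro z
    split_ifs with hJ
    · have hT : RobustlyTypical L.mass
          (fun ω => (ω.1, D.values (decodeAll i) ω.2, D.output i ω.2)) ε
          (fun t => (q t, D.values (decodeAll i) (z t), y t (z t))) :=
        (jointlyTypical_iff L D ε i q _ _).1 hJ
      -- Typical sequences contain no symbol of probability zero, so the received letter is exactly
      -- the output of the tested letters.
      have hsupp : ∀ t, D.output i (z t) = y t (z t) ∧
          0 < ψ (q t) (D.output i (z t)) (D.values A (z t)) := by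
        intro t
        obtain ⟨ω, hω, hpos⟩ := exists_of_prob_pos (hT.prob_pos L.mass_nonneg t)
        simp only [Prod.mk.injEq, Model.values_eq_iff] at hω
        obtain ⟨hq, hv, ho⟩ := hω
        have ho' : D.output i ω.2 = D.output i (z t) :=
          D.output_eq_of_heard fun j => hv _ (heard_mem_decodeAll i j)
        have hvA : D.values A ω.2 = D.values A (z t) :=
          (D.values_eq_iff A _ _).2 fun s hs => hv s (hA hs)
        refine ⟨ho'.symm.trans ho, ?_⟩
        rw [← ho', ← hvA, ← hq]
        have hm : 0 < prodLaw (L.pX ω.1) ω.2 := by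
          rw [L.mass_eq] at hpos
          exact (hnn ω.1 ω.2).lt_of_ne' fun h0 => by rw [h0, mul_zero] at hpos; exact hpos.false
        exact div_pos (prob_pos (hnn _) (fun x => (D.output i x, D.values A x)) hm)
          (prob_pos (hnn _) (D.values A) hm)
      have hsum := hT.le_sum (φ := fun a => -Real.logb 2
          (ψ a.1 a.2.2 (fun s => a.2.1 ⟨s.1, hA s.2⟩)))
        (fun a => neg_logb_condProb_nonneg (hnn _) _ _ _ _)
      have hh : D.hOut L i A = ∑ ω : 𝒬 × (Fin 3 → 𝒳), L.mass ω *
          -Real.logb 2 (ψ ω.1 (D.output i ω.2) (D.values A ω.2)) := by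
        rw [D.hOut_eq_sum, Fintype.sum_prod_type]
        refine Finset.sum_congr rfl fun q _ => ?_
        rw [entropy_pair_sub (hnn q), Finset.mul_sum]
        refine Finset.sum_congr rfl fun x _ => ?_
        rw [L.mass_eq]
        ring
      have hsum' : n * (1 - ε) * D.hOut L i A ≤
          ∑ t, -Real.logb 2 (ψ (q t) (D.output i (z t)) (D.values A (z t))) := by
        rw [hh]
        refine hsum.trans_eq ?_
        refine Finset.sum_congr rfl fun t _ => ?_
        rw [(hsupp t).1]
        rfl
      have hprod : ∏ t, ψ (q t) (D.output i (z t)) (D.values A (z t)) ≤ B := by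
        have h2 : ∏ t, ψ (q t) (D.output i (z t)) (D.values A (z t)) =
            (2 : ℝ) ^ (∑ t, Real.logb 2 (ψ (q t) (D.output i (z t)) (D.values A (z t)))) := by
          rw [Real.rpow_sum_of_pos (by norm_num)]
          exact Finset.prod_congr rfl fun t _ =>
            (Real.rpow_logb (by norm_num) (by norm_num) (hsupp t).2).symm
        rw [h2, hB]
        refine Real.rpow_le_rpow_of_exponent_le (by norm_num) ?_
        rw [Finset.sum_neg_distrib] at hsum'
        linarith
      have hpos : 0 < ∏ t, ψ (q t) (D.output i (z t)) (D.values A (z t)) :=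
        Finset.prod_pos fun t _ => (hsupp t).2
      rw [Finset.prod_congr rfl fun t _ => if_pos (hsupp t).1, Finset.prod_inv_distrib, ← div_eq_mul_inv, one_le_div hpos]
      exact hprod
    · refine mul_nonneg (by positivity) (Finset.prod_nonneg fun t _ => ?_)
      split_ifs
      · exact inv_nonneg.2 (div_nonneg (prob_nonneg (hnn _) _ _) (prob_nonneg (hnn _) _ _))
      · exact le_rfl
  rw [sum_seqLaw_mul L q (fun z =>
    if JointlyTypical D L ε i q z (fun t => y t (fun j => z j t)) then 1 else 0)]
  calc _ ≤ ∑ z : Fin n → Fin 3 → 𝒳, (∏ t, prodLaw (L.pX (q t)) (z t)) *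
        (B * ∏ t, (if D.output i (z t) = y t (z t)
          then (ψ (q t) (D.output i (z t)) (D.values A (z t)))⁻¹ else 0)) :=
        Finset.sum_le_sum fun z _ => mul_le_mul_of_nonneg_left (hpt z)
          (Finset.prod_nonneg fun t _ => hnn _ _)
    _ = B * ∑ z : Fin n → Fin 3 → 𝒳, ∏ t, (prodLaw (L.pX (q t)) (z t) *
        (if D.output i (z t) = y t (z t)
          then (ψ (q t) (D.output i (z t)) (D.values A (z t)))⁻¹ else 0)) := by
        rw [Finset.mul_sum]
        refine Finset.sum_congr rfl fun z _ => ?_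
        rw [Finset.prod_mul_distrib]
        ring
    _ ≤ B * 1 := by
        refine mul_le_mul_of_nonneg_left ?_ (by positivity)
        rw [sum_pi_prod (fun t (x : Fin 3 → 𝒳) => prodLaw (L.pX (q t)) x *
          (if D.output i x = y t x then (ψ (q t) (D.output i x) (D.values A x))⁻¹ else 0))]
        refine Finset.prod_le_one (fun t _ => Finset.sum_nonneg fun x _ => ?_) fun t _ => ?_
        · refine mul_nonneg (hnn _ _) ?_
          split_ifs
          · exact inv_nonneg.2 (div_nonneg (prob_nonneg (hnn _) _ _) (prob_nonneg (hnn _) _ _))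
          · exact le_rfl
        · refine le_trans (le_of_eq ?_) (sum_inv_condProb_le (hnn (q t)) (sum_prodLaw (L.pX_sum _))
            (D.output i) (D.values A) (y t) (hy t))
          exact Finset.sum_congr rfl fun x _ => by congr
    _ = B := mul_one B

/-- Codewords drawn from the input law are jointly typical with the word they produce. -/
theorem exists_sum_not_jointlyTypical_le {ε : ℝ} (hε : 0 < ε) (i : Fin 3) :
    ∃ K : ℝ, 0 ≤ K ∧ ∀ n : ℕ, 0 < n →
      (open Classical in ∑ q : Fin n → 𝒬, timeSharingProb L q *
        ∑ z : Fin 3 → Fin n → 𝒳, (∏ j, seqLaw L q (z j)) *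
          (if JointlyTypical D L ε i q z (fun t => D.output i (fun j => z j t)) then 0 else 1))
        ≤ K / n := by
  classical
  obtain ⟨K, hK, h⟩ := exists_sum_not_typical_le L.mass_nonneg L.sum_mass
    (fun ω => (ω.1, D.values (decodeAll i) ω.2, D.output i ω.2)) hε
  refine ⟨K, hK, fun n hn => (le_of_eq ?_).trans (h n hn)⟩
  simp_rw [fun q : Fin n → 𝒬 => sum_seqLaw_mul L q (fun z =>
    if JointlyTypical D L ε i q z (fun t => D.output i (fun j => z j t)) then (0 : ℝ) else 1),
    Finset.mul_sum]
  rw [← Fintype.sum_prod_type']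
  refine Fintype.sum_equiv (Equiv.arrowProdEquivProdArrow _ _ _).symm _ _ fun x => ?_
  rw [← mul_assoc, jointlyTypical_iff, timeSharingProb, ← Finset.prod_mul_distrib]
  rfl

end RandomCoding

/-! ### The union bound over wrong message triples -/

section JointDecoding

variable {𝒬 𝒳 𝒰 𝒱 : Type*} {𝒴 : Fin 3 → Type*} [Fintype 𝒬] [Fintype 𝒳]
  (D : Model 𝒳 𝒰 𝒱 𝒴) (L : InputLaw 𝒬 𝒳)

/-- The indicator of a proposition. -/
noncomputable def ind (E : Prop) : ℝ := open Classical in if E then 1 else 0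

theorem ind_nonneg (E : Prop) : 0 ≤ ind E := by
  rw [ind]; split_ifs <;> norm_num

theorem ind_of_true {E : Prop} (h : E) : ind E = 1 := if_pos h

theorem ind_of_false {E : Prop} (h : ¬E) : ind E = 0 := if_neg h

theorem uniformProb_eq_sum {m : Fin 3 → ℕ} (E : Messages m → Prop) :
    uniformProb E = (∑ w, ind (E w)) / Fintype.card (Messages m) := by
  classical
  simp only [uniformProb, ind, Finset.sum_boole]

theorem uniformProb_nonneg {m : Fin 3 → ℕ} (E : Messages m → Prop) : 0 ≤ uniformProb E := by
  rw [uniformProb]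
  positivity

theorem uniformProb_mono {m : Fin 3 → ℕ} {E E' : Messages m → Prop} (h : ∀ w, E w → E' w) :
    uniformProb E ≤ uniformProb E' := by
  classical
  rw [uniformProb, uniformProb]
  gcongr
  exact h _

theorem exists_typical_of_jointDecoder_ne {n : ℕ} {m : Fin 3 → ℕ} {ε : ℝ} {q : Fin n → 𝒬}
    {c : Codebooks 𝒳 n m} {i : Fin 3} {y : Fin n → 𝒴 i} {w : Messages m}
    (hw : JointlyTypical D L ε i q (fun j => c j (w j)) y)
    (h : jointDecoder D L ε q c i y ≠ some w) :
    ∃ w', w' ≠ w ∧ JointlyTypical D L ε i q (fun j => c j (w' j)) y := by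
  by_contra! hne
  have hu : ∃! w : Messages m, JointlyTypical D L ε i q (fun j => c j (w j)) y :=
    ⟨w, hw, fun w' hw' => by_contra fun hc => hne w' hc hw'⟩
  apply h
  rw [jointDecoder, dif_pos hu, hu.unique hu.choose_spec.1 hw]

/-- The average probability that a given wrong triple of messages looks right. -/
theorem sum_wrong_typical_le {n : ℕ} {m : Fin 3 → ℕ} (ε : ℝ) (q : Fin n → 𝒬) (i : Fin 3)
    (w w' : Messages m) :
    (open Classical in ∑ c : Codebooks 𝒳 n m, (∏ j, unsplitLaw L q (c j)) *
      (if JointlyTypical D L ε i q (fun j => c j (w' j)) (received D c w i) then 1 else 0)) ≤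
    (2 : ℝ) ^ (-(n * (1 - ε) *
      D.hOut L i (Model.heardOff i (Finset.univ.filter fun j => w j ≠ w' j)))) := by
  classical
  -- The codewords of `w'` are redrawn. Where `w'` agrees with `w` they are also the transmitted
  -- ones, so the received word depends on the fresh letters only through the signals heard from the
  -- users on which the triples agree.
  have h := sum_codebooks_resample (m := m) (seqLaw L q) (sum_seqLaw L q) w'
    (fun c => if JointlyTypical D L ε i q (fun j => c j (w' j)) (received D c w i)
      then (1 : ℝ) else 0)
  refine (le_of_eq h).trans ?_
  refine (Finset.sum_le_sum fun c _ => mul_le_mul_of_nonneg_left (a := ∏ i, unsplitLaw L q (c i))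
    (?_ : _ ≤ (2 : ℝ) ^ (-(n * (1 - ε) *
      D.hOut L i (Model.heardOff i (Finset.univ.filter fun j => w j ≠ w' j)))))
    (Finset.prod_nonneg fun j _ => unsplitLaw_nonneg L q _)).trans ?_
  · have hsub : Model.heardOff i (Finset.univ.filter fun j => w j ≠ w' j) ⊆ decodeAll i := by
      intro s hs
      obtain ⟨j, -, rfl⟩ := Finset.mem_image.1 hs
      exact heard_mem_decodeAll i j
    refine le_trans (le_of_eq ?_) (sum_jointlyTypical_le L D ε i q hsub
      (fun t x => D.output i (fun j => if w j = w' j then x j else c j (w j) t)) ?_)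
    · refine Finset.sum_congr rfl fun z _ => ?_
      congr 2
      · simp only [Function.update_self]
        have hr : received D (fun i => Function.update (c i) (w' i) (z i)) w i =
            fun t => D.output i (fun j => if w j = w' j then z j t else c j (w j) t) := by
          funext t
          simp only [received, Function.update_apply]
          congr 1
          funext j
          split_ifs <;> rfl
        rw [hr]
    · intro t x x' hx
      refine D.output_eq_of_heard fun j => ?_
      split_ifs with hj
      · refine (D.values_eq_iff _ _ _).1 hx (j, heard i j) ?_
        exact Finset.mem_image.2 ⟨j, by simp [hj], rfl⟩
      · rfl
  · rw [← Finset.sum_mul, sum_prod_unsplitLaw, one_mul]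

/-- The summand factors over the users: agreement contributes 1 and each of at most `m j`
disagreements contributes `β`. The subtracted 1 is the term of `w` itself, so all error patterns are
treated at once. -/
theorem sum_pow_hamming_le {m : Fin 3 → ℕ} (w : Messages m) {β : ℝ} (hβ : 0 ≤ β) :
    ∑ w' ∈ Finset.univ.erase w, β ^ (Finset.univ.filter fun j => w j ≠ w' j).card ≤
      ∏ j, (1 + m j * β) - 1 := by
  have h1 : ∀ w' : Messages m, β ^ (Finset.univ.filter fun j => w j ≠ w' j).card =
      ∏ j, (if w j ≠ w' j then β else 1) := by
    intro w'
    rw [Finset.prod_ite]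
    simp
  have h2 : ∑ w' : Messages m, β ^ (Finset.univ.filter fun j => w j ≠ w' j).card ≤
      ∏ j, (1 + m j * β) := by
    simp_rw [h1]
    rw [sum_pi_prod (fun j (k : Fin (m j)) => if w j ≠ k then β else 1)]
    refine Finset.prod_le_prod (fun j _ => Finset.sum_nonneg fun k _ => by
      split_ifs <;> positivity) fun j _ => ?_
    calc ∑ k, (if w j ≠ k then β else 1) ≤ ∑ k, ((if w j = k then 1 else 0) + β) := by
          refine Finset.sum_le_sum fun k _ => ?_
          by_cases h : w j = k <;> simp [h, hβ]
      _ = 1 + m j * β := by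
          rw [Finset.sum_add_distrib]
          simp
  rw [← Finset.add_sum_erase _ _ (Finset.mem_univ w)] at h2
  simp only [ne_eq, not_true_eq_false, Finset.filter_false, Finset.card_empty, pow_zero] at h2
  linarith

/-- The probability that the true codewords are not jointly typical with the received word. -/
noncomputable def missProb (ε : ℝ) (i : Fin 3) {n : ℕ} (q : Fin n → 𝒬) : ℝ :=
  open Classical in ∑ z : Fin 3 → Fin n → 𝒳, (∏ j, seqLaw L q (z j)) *
    (if JointlyTypical D L ε i q z (fun t => D.output i (fun j => z j t)) then 0 else 1)

theorem missProb_nonneg (ε : ℝ) (i : Fin 3) {n : ℕ} (q : Fin n → 𝒬) :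
    0 ≤ missProb D L ε i q :=
  Finset.sum_nonneg fun z _ =>
    mul_nonneg (Finset.prod_nonneg fun j _ => seqLaw_nonneg L q _) (by split_ifs <;> norm_num)

/-- Resampling at the true messages reduces the ensemble to one draw of three codewords, whatever
`w` is. -/
theorem sum_true_not_typical {n : ℕ} {m : Fin 3 → ℕ} (ε : ℝ) (q : Fin n → 𝒬) (i : Fin 3)
    (w : Messages m) :
    (open Classical in ∑ c : Codebooks 𝒳 n m, (∏ j, unsplitLaw L q (c j)) *
      (if JointlyTypical D L ε i q (fun j => c j (w j)) (received D c w i) then 0 else 1)) =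
    missProb D L ε i q := by
  classical
  have hr := sum_codebooks_resample (m := m) (seqLaw L q) (sum_seqLaw L q) w
    (fun c => if JointlyTypical D L ε i q (fun j => c j (w j)) (received D c w i)
      then (0 : ℝ) else 1)
  refine hr.trans ?_
  have e : missProb D L ε i q =
      ∑ c : Codebooks 𝒳 n m, (∏ j, unsplitLaw L q (c j)) * missProb D L ε i q := by
    rw [← Finset.sum_mul, sum_prod_unsplitLaw, one_mul]
  rw [e]
  refine Finset.sum_congr rfl fun c _ => congrArg _ (Finset.sum_congr rfl fun z _ => ?_)
  have hrec : received D (fun i => Function.update (c i) (w i) (z i)) w i =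
      fun t => D.output i (fun j => z j t) := by
    funext t
    simp [received]
  rw [hrec]
  simp only [Function.update_self]

/-- Union bound over the receivers: an error needs an atypical truth or a typical competitor. -/
theorem ite_exists_le_sum {ι W : Type*} [Fintype ι] (s : Finset W) (E : ι → Prop)
    (T : ι → Prop) (T' : ι → W → Prop) (h : ∀ i, T i → E i → ∃ w ∈ s, T' i w) :
    ind (∃ i, E i) ≤
      open Classical in ∑ i, ((if T i then 0 else 1) + ∑ w ∈ s, if T' i w then 1 else 0) := by
  classical
  have h0 : ∀ i, (0 : ℝ) ≤ ∑ w ∈ s, if T' i w then 1 else 0 := fun i =>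
    Finset.sum_nonneg fun w _ => by split_ifs <;> norm_num
  have hnn : ∀ i, (0 : ℝ) ≤ (if T i then 0 else 1) + ∑ w ∈ s, if T' i w then 1 else 0 :=
    fun i => add_nonneg (by split_ifs <;> norm_num) (h0 i)
  by_cases hE : ∃ i, E i
  · rw [ind_of_true hE]
    obtain ⟨i, hi⟩ := hE
    refine le_trans ?_ (Finset.single_le_sum (fun i _ => hnn i) (Finset.mem_univ i))
    by_cases hT : T i
    · obtain ⟨w, hw, hw'⟩ := h i hT hi
      rw [if_pos hT, zero_add]
      refine le_trans (by rw [if_pos hw']) (Finset.single_le_sum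
        (f := fun w => if T' i w then (1 : ℝ) else 0)
        (fun w _ => by split_ifs <;> norm_num) hw)
    · rw [if_neg hT]
      linarith [h0 i]
  · rw [ind_of_false hE]
    exact Finset.sum_nonneg fun i _ => hnn i

theorem sum_jointDecoder_ne_le (h : D.Admissible L) {ε : ℝ} (hε1 : ε < 1) {n : ℕ}
    {m : Fin 3 → ℕ} (q : Fin n → 𝒬) (w : Messages m) :
    ∑ c : Codebooks 𝒳 n m, (∏ j, unsplitLaw L q (c j)) *
      ind (∃ i, jointDecoder D L ε q c i (received D c w i) ≠ some w) ≤
    ∑ i, (missProb D L ε i q +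
      (∏ j, (1 + m j * (2 : ℝ) ^ (-(n * ((1 - ε) * D.rateFormula L)))) - 1)) := by
  classical
  set β : ℝ := (2 : ℝ) ^ (-(n * ((1 - ε) * D.rateFormula L))) with hβ
  have hβ0 : 0 ≤ β := by positivity
  have hpt := fun c : Codebooks 𝒳 n m => ite_exists_le_sum (Finset.univ.erase w)
    (fun i => jointDecoder D L ε q c i (received D c w i) ≠ some w)
    (fun i => JointlyTypical D L ε i q (fun j => c j (w j)) (received D c w i))
    (fun i w' => JointlyTypical D L ε i q (fun j => c j (w' j)) (received D c w i))
    (fun i hT hE => by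
      obtain ⟨w', hne, hw'⟩ := exists_typical_of_jointDecoder_ne D L hT hE
      exact ⟨w', Finset.mem_erase.2 ⟨hne, Finset.mem_univ _⟩, hw'⟩)
  refine (Finset.sum_le_sum fun c _ => mul_le_mul_of_nonneg_left (hpt c)
    (Finset.prod_nonneg fun j _ => unsplitLaw_nonneg L q _)).trans ?_
  simp_rw [Finset.mul_sum]
  rw [Finset.sum_comm]
  refine Finset.sum_le_sum fun i _ => ?_
  simp_rw [mul_add, Finset.sum_add_distrib, Finset.mul_sum]
  refine add_le_add (sum_true_not_typical D L ε q i w).le ?_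
  rw [Finset.sum_comm]
  refine le_trans (Finset.sum_le_sum fun w' hw' => ?_) (sum_pow_hamming_le w hβ0)
  refine (sum_wrong_typical_le D L ε q i w w').trans ?_
  have hS : (Finset.univ.filter fun j => w j ≠ w' j).Nonempty := by
    obtain ⟨j, hj⟩ := Function.ne_iff.1 (Finset.ne_of_mem_erase hw').symm
    exact ⟨j, by simp [hj]⟩
  have hF := h.card_mul_rateFormula_le i _ hS
  -- The rate inequality turns the exponent of each error pattern into a power of the single
  -- quantity `β`.
  rw [hβ, ← Real.rpow_natCast, ← Real.rpow_mul (by norm_num)]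
  refine Real.rpow_le_rpow_of_exponent_le (by norm_num) ?_
  have h3 : 0 ≤ (n : ℝ) * (1 - ε) := mul_nonneg (by positivity) (by linarith)
  have h4 := mul_le_mul_of_nonneg_left hF h3
  linarith

/-- A bound at every block length on the error probability of joint decoding. -/
theorem exists_unsplitJointError_le (h : D.Admissible L) {ε : ℝ} (hε : 0 < ε) (hε1 : ε < 1) :
    ∃ K : ℝ, 0 ≤ K ∧ ∀ (n : ℕ), 0 < n → ∀ m : Fin 3 → ℕ, unsplitJointError D L ε n m ≤
      K / n + 3 * (∏ j, (1 + m j * (2 : ℝ) ^ (-(n * ((1 - ε) * D.rateFormula L)))) - 1) := by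
  classical
  choose K hK0 hK using fun i => exists_sum_not_jointlyTypical_le L D hε i
  refine ⟨∑ i, K i, Finset.sum_nonneg fun i _ => hK0 i, fun n hn m => ?_⟩
  set β : ℝ := (2 : ℝ) ^ (-(n * ((1 - ε) * D.rateFormula L))) with hβ
  have hβ0 : 0 ≤ β := by positivity
  set N : Fin 3 → (Fin n → 𝒬) → ℝ := fun i q => missProb D L ε i q with hN
  set W : ℝ := ∏ j, (1 + m j * β) - 1 with hW
  have hN0 : ∀ i q, 0 ≤ N i q := fun i q => missProb_nonneg D L ε i q
  have hW0 : 0 ≤ W := by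
    have : (1 : ℝ) ≤ ∏ j, (1 + m j * β) := by
      calc (1 : ℝ) = ∏ _j : Fin 3, 1 := by simp
        _ ≤ _ := Finset.prod_le_prod (fun j _ => zero_le_one) fun j _ =>
          le_add_of_nonneg_right (by positivity)
    linarith
  have hq : ∀ q : Fin n → 𝒬, ∑ c : Codebooks 𝒳 n m, (∏ j, unsplitLaw L q (c j)) *
      uniformProb (fun w => ∃ i, jointDecoder D L ε q c i (received D c w i) ≠ some w) ≤
      ∑ i, (N i q + W) := by
    intro q
    have hS0 : 0 ≤ ∑ i, (N i q + W) := Finset.sum_nonneg fun i _ => add_nonneg (hN0 i q) hW0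
    simp_rw [uniformProb_eq_sum, ← mul_div_assoc, ← Finset.sum_div, Finset.mul_sum]
    rw [Finset.sum_comm]
    refine div_le_of_le_mul₀ (by positivity) hS0 ?_
    refine (Finset.sum_le_sum fun w _ => sum_jointDecoder_ne_le D L h hε1 q w).trans_eq ?_
    rw [Finset.sum_const, Finset.card_univ, nsmul_eq_mul, mul_comm]
  calc unsplitJointError D L ε n m
      ≤ ∑ q : Fin n → 𝒬, timeSharingProb L q * ∑ i, (N i q + W) :=
        Finset.sum_le_sum fun q _ =>
          mul_le_mul_of_nonneg_left (hq q) (timeSharingProb_nonneg L q)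
    _ = ∑ i, ∑ q : Fin n → 𝒬, timeSharingProb L q * N i q + 3 * W := by
        simp_rw [Finset.sum_add_distrib, mul_add, Finset.mul_sum, Finset.sum_add_distrib]
        rw [Finset.sum_comm]
        congr 1
        rw [Finset.sum_comm]
        simp_rw [← Finset.sum_mul]
        have := sum_timeSharingProb L n
        rw [this]
        simp
    _ ≤ (∑ i, K i) / n + 3 * W := by
        rw [Finset.sum_div]
        exact add_le_add (Finset.sum_le_sum fun i _ => hK i n hn) le_rfl

theorem tendsto_two_rpow_neg_mul {a : ℝ} (ha : 0 < a) :
    Tendsto (fun n : ℕ => (2 : ℝ) ^ (-((n : ℝ) * a))) atTop (𝓝 0) := by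
  have h : ∀ n : ℕ, (2 : ℝ) ^ (-((n : ℝ) * a)) = ((2 : ℝ) ^ (-a)) ^ n := by
    intro n
    rw [← Real.rpow_natCast, ← Real.rpow_mul (by norm_num)]
    ring_nf
  simp_rw [h]
  exact tendsto_pow_atTop_nhds_zero_of_lt_one (by positivity)
    (Real.rpow_lt_one_of_one_lt_of_neg (by norm_num) (by linarith))

theorem ceil_two_rpow_le {a : ℝ} (ha : 0 ≤ a) : (⌈(2 : ℝ) ^ a⌉₊ : ℝ) ≤ 2 * (2 : ℝ) ^ a := by
  have h1 := Nat.ceil_lt_add_one (a := (2 : ℝ) ^ a) (by positivity)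
  have h2 := Real.one_le_rpow (x := 2) (by norm_num) ha
  linarith

theorem unsplitJointError_nonneg (ε : ℝ) (n : ℕ) (m : Fin 3 → ℕ) :
    0 ≤ unsplitJointError D L ε n m :=
  Finset.sum_nonneg fun q _ => mul_nonneg (timeSharingProb_nonneg L q)
    (Finset.sum_nonneg fun _ _ => mul_nonneg
      (Finset.prod_nonneg fun _ _ => unsplitLaw_nonneg L q _) (uniformProb_nonneg _))

/-- Joint decoding without message splitting achieves every rate below the rate formula. -/
theorem tendsto_unsplitJointError (h : D.Admissible L) {R : ℝ} (hR : 0 ≤ R)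
    (hRF : R < D.rateFormula L) :
    ∃ ε₀ > 0, ∀ ε : ℝ, 0 < ε → ε < ε₀ →
      Tendsto (fun n : ℕ =>
        unsplitJointError D L ε n (fun _ => ⌈(2 : ℝ) ^ ((n : ℝ) * R)⌉₊)) atTop (𝓝 0) := by
  have hF : 0 < D.rateFormula L := hR.trans_lt hRF
  -- With this choice, `ε < ε₀` says precisely that `R < (1 - ε) F`.
  refine ⟨1 - R / D.rateFormula L, sub_pos.2 ((div_lt_one hF).2 hRF), fun ε hε hε0 => ?_⟩
  have hgap : R < (1 - ε) * D.rateFormula L := by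
    rw [← div_lt_iff₀ hF]
    linarith
  have hε1 : ε < 1 := by
    have := div_nonneg hR hF.le
    linarith
  obtain ⟨K, hK, hbound⟩ := exists_unsplitJointError_le D L h hε hε1
  set a := (1 - ε) * D.rateFormula L - R with ha
  have hlim : Tendsto (fun n : ℕ => K / n + 3 * ((1 + 2 * (2 : ℝ) ^ (-((n : ℝ) * a))) ^ 3 - 1))
      atTop (𝓝 0) := by
    have h1 := tendsto_two_rpow_neg_mul (sub_pos.2 hgap : 0 < a)
    have h2 : Tendsto (fun n : ℕ => K / (n : ℝ)) atTop (𝓝 0) :=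
      tendsto_const_nhds.div_atTop tendsto_natCast_atTop_atTop
    have h3 := h2.add ((((h1.const_mul 2).const_add 1).pow 3).sub_const 1 |>.const_mul 3)
    simpa using h3
  refine squeeze_zero' (Eventually.of_forall fun n => unsplitJointError_nonneg D L ε n _)
    ?_ hlim
  filter_upwards [eventually_gt_atTop 0] with n hn
  refine (hbound n hn _).trans ?_
  rw [Finset.prod_const, Finset.card_univ, Fintype.card_fin]
  have h5 : (⌈(2 : ℝ) ^ ((n : ℝ) * R)⌉₊ : ℝ) * (2 : ℝ) ^ (-(n * ((1 - ε) * D.rateFormula L))) ≤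
      2 * (2 : ℝ) ^ (-((n : ℝ) * a)) := by
    calc _ ≤ 2 * (2 : ℝ) ^ ((n : ℝ) * R) * (2 : ℝ) ^ (-(n * ((1 - ε) * D.rateFormula L))) :=
          mul_le_mul_of_nonneg_right (ceil_two_rpow_le (by positivity)) (by positivity)
      _ = 2 * (2 : ℝ) ^ (-((n : ℝ) * a)) := by
          rw [mul_assoc, ← Real.rpow_add (by norm_num), ha]
          ring_nf
  gcongr

end JointDecoding

/-! ### Product laws -/

section Product

theorem sum_pi_resample {ι : Type*} [Fintype ι] [DecidableEq ι] {α : ι → Type*}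
    [∀ i, Fintype (α i)] (p : ∀ i, α i → ℝ) (i : ι) (hp : ∑ a, p i a = 1)
    (G : (∀ i, α i) → ℝ) :
    ∑ f : ∀ i, α i, (∏ j, p j (f j)) * G f =
      ∑ f : ∀ i, α i, (∏ j, p j (f j)) * ∑ a, p i a * G (Function.update f i a) := by
  set T : (∀ i, α i) × α i → (∀ i, α i) × α i :=
    fun x => (Function.update x.1 i x.2, x.1 i) with hT
  have hinv : Function.Involutive T := fun x => by simp [hT]
  set W : (∀ i, α i) × α i → ℝ := fun x => (∏ j, p j (x.1 j)) * p i x.2 with hW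
  have hWT : ∀ x, W (T x) = W x := by
    intro x
    simp only [hW, hT]
    rw [← Finset.mul_prod_erase Finset.univ _ (Finset.mem_univ i),
      ← Finset.mul_prod_erase Finset.univ (fun j => p j (x.1 j)) (Finset.mem_univ i),
      Function.update_self,
      Finset.prod_congr rfl (fun k hk => by
        rw [Function.update_of_ne (Finset.ne_of_mem_erase hk)] :
        ∀ k ∈ Finset.univ.erase i, p k (Function.update x.1 i x.2 k) = p k (x.1 k))]
    ring
  calc _ = ∑ x : (∀ i, α i) × α i, W x * G x.1 := by
        rw [Fintype.sum_prod_type]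
        refine Finset.sum_congr rfl fun c _ => ?_
        simp only [hW]
        rw [← Finset.sum_mul, ← Finset.mul_sum, hp, mul_one]
    _ = ∑ x : (∀ i, α i) × α i, W x * G (T x).1 := by
        rw [← Equiv.sum_comp hinv.toPerm]
        refine Finset.sum_congr rfl fun x _ => ?_
        rw [Function.Involutive.coe_toPerm, hWT]
    _ = _ := by
        rw [Fintype.sum_prod_type]
        refine Finset.sum_congr rfl fun c _ => ?_
        rw [Finset.mul_sum]
        exact Finset.sum_congr rfl fun z _ => by simp only [hW, hT]; ring

variable {ι : Type*} [Fintype ι] [DecidableEq ι] {Ω β : ι → Type*} [∀ i, Fintype (Ω i)]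

theorem prob_pi (p : ∀ i, Ω i → ℝ) (Z : ∀ i, Ω i → β i) (b : ∀ i, β i) :
    prob (fun w : ∀ i, Ω i => ∏ i, p i (w i)) (fun w i => Z i (w i)) b =
      ∏ i, prob (p i) (Z i) (b i) := by
  classical
  simp_rw [prob_eq_sum_ite]
  rw [← sum_pi_prod (fun i ω => if Z i ω = b i then p i ω else 0)]
  refine Finset.sum_congr rfl fun w _ => ?_
  rw [Finset.prod_ite_zero]
  simp [funext_iff]

theorem sum_prod_eq_one (p : ∀ i, Ω i → ℝ) (hp1 : ∀ i, ∑ a, p i a = 1) :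
    ∑ w : ∀ i, Ω i, ∏ i, p i (w i) = 1 := by
  rw [sum_pi_prod p]
  simp [hp1]

theorem entropy_pi (p : ∀ i, Ω i → ℝ) (hp : ∀ i a, 0 ≤ p i a) (hp1 : ∀ i, ∑ a, p i a = 1)
    (Z : ∀ i, Ω i → β i) :
    entropy (fun w : ∀ i, Ω i => ∏ i, p i (w i)) (fun w i => Z i (w i)) =
      ∑ i, entropy (p i) (Z i) := by
  have h1 : ∀ i, entropy (p i) (Z i) = ∑ w : ∀ i, Ω i, (∏ j, p j (w j)) *
      -Real.logb 2 (prob (p i) (Z i) (Z i (w i))) := fun i => by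
    rw [entropy_eq_sum,
      sum_pi_prod_mul p hp1 i (fun ω => -Real.logb 2 (prob (p i) (Z i) (Z i ω)))]
  simp_rw [h1]
  rw [Finset.sum_comm, entropy_eq_sum]
  refine Finset.sum_congr rfl fun w _ => ?_
  rw [prob_pi, ← Finset.mul_sum]
  rcases (Finset.prod_nonneg fun i _ => hp i (w i) : 0 ≤ ∏ i, p i (w i)).eq_or_lt with h0 | h0
  · simp [← h0]
  · have hne : ∀ i, p i (w i) ≠ 0 := fun i => (Finset.prod_ne_zero_iff.1 h0.ne') i (Finset.mem_univ i)
    rw [Real.logb_prod _ _ fun i _ =>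
      (prob_pos (hp i) (Z i) ((hp i (w i)).lt_of_ne' (hne i))).ne', Finset.sum_neg_distrib]

theorem sum_univ_prob_mul {Ω α : Type*} [Fintype Ω] [Fintype α] (μ : Ω → ℝ) (Z : Ω → α)
    (f : α → ℝ) : ∑ a, prob μ Z a * f a = ∑ ω, μ ω * f (Z ω) := by
  classical
  rw [← Finset.sum_fiberwise Finset.univ Z]
  refine Finset.sum_congr rfl fun a _ => ?_
  rw [prob, Finset.sum_mul]
  refine Finset.sum_congr (by congr) fun ω hω => ?_
  rw [(Finset.mem_filter.1 hω).2]

end Product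

/-! ### Fano's inequality -/

/-- The uniform law. -/
noncomputable def unif (M : ℕ) (_ : Fin M) : ℝ := (M : ℝ)⁻¹

theorem unif_nonneg {M : ℕ} (k : Fin M) : 0 ≤ unif M k := by
  rw [unif]; positivity

theorem unif_pos {M : ℕ} (k : Fin M) : 0 < unif M k := by
  have : (0 : ℝ) < M := by exact_mod_cast k.pos
  rw [unif]; positivity

theorem sum_unif {M : ℕ} (hM : 0 < M) : ∑ k, unif M k = 1 := by
  have : (M : ℝ) ≠ 0 := by exact_mod_cast hM.ne'
  simp [unif, this]

theorem entropy_unif_id {M : ℕ} (hM : 0 < M) :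
    entropy (unif M) (fun k => k) = Real.logb 2 M := by
  classical
  have h : ∀ k, prob (unif M) (fun k => k) k = (M : ℝ)⁻¹ := fun k => by
    rw [prob_eq_sum_ite, Finset.sum_eq_single k] <;> simp +contextual [unif]
  rw [entropy_eq_sum]
  simp_rw [h, ← Finset.sum_mul, sum_unif hM, Real.logb_inv]
  ring

theorem letterLaw_eq_prob {𝒳 : Type*} {n M : ℕ} (b : Fin M → Fin n → 𝒳) (t : Fin n) (x : 𝒳) :
    letterLaw b t x = prob (unif M) (fun k => b k t) x := by
  classical
  rw [letterLaw, prob]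
  simp only [unif, Finset.sum_const, nsmul_eq_mul]
  rw [div_eq_mul_inv]

/-- Gibbs' inequality against the law that keeps the law of `Y` and gives the guess `g Y` weight
1/2, spreading the other half uniformly over all messages. The information content exceeds that of
`Y` by one bit, plus log M on errors. -/
theorem fano {Ω α : Type*} [Fintype Ω] {μ : Ω → ℝ} (hμ : ∀ ω, 0 ≤ μ ω) (h1 : ∑ ω, μ ω = 1)
    {M : ℕ} (hM : 0 < M) (W : Ω → Fin M) (Y : Ω → α) (g : α → Fin M) :
    entropy μ (fun ω => (W ω, Y ω)) ≤
      entropy μ Y + 1 + (∑ ω, μ ω * ind (g (Y ω) ≠ W ω)) * Real.logb 2 M := by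
  classical
  have hM' : (0 : ℝ) < M := by exact_mod_cast hM
  set r : Fin M × α → ℝ := fun x =>
    prob μ Y x.2 * (if x.1 = g x.2 then 1 / 2 else 0) + prob μ Y x.2 * (1 / (2 * M)) with hr
  set r' : Fin M × α → ℝ := fun x =>
    prob μ Y x.2 * (if x.1 = g x.2 then (1 / 2 : ℝ) else 1 / (2 * (M : ℝ))) with hr'
  have hP := prob_nonneg hμ Y
  have hrr : ∀ x, r' x ≤ r x := by
    intro x
    simp only [hr, hr', ← mul_add]
    refine mul_le_mul_of_nonneg_left ?_ (hP _)
    split_ifs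
    · exact le_add_of_nonneg_right (by positivity)
    · simp
  have hr0 : ∀ x, 0 ≤ r x := by
    intro x
    simp only [hr, ← mul_add]
    refine mul_nonneg (hP _) ?_
    split_ifs <;> positivity
  refine (entropy_le_cross hμ h1 (fun ω => (W ω, Y ω)) r' (fun x => mul_nonneg (hP _) (by
    split_ifs <;> positivity)) (fun ω hω => mul_pos (prob_pos hμ Y hω) (by
    split_ifs <;> positivity)) (fun s => ?_)).trans (le_of_eq ?_)
  · calc ∑ x ∈ s, r' x ≤ ∑ x ∈ s, r x := Finset.sum_le_sum fun x _ => hrr x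
      _ ≤ ∑ x ∈ Finset.univ ×ˢ s.image Prod.snd, r x :=
          Finset.sum_le_sum_of_subset_of_nonneg (fun x hx => Finset.mem_product.2
            ⟨Finset.mem_univ _, Finset.mem_image_of_mem _ hx⟩) fun x _ _ => hr0 x
      _ = ∑ y ∈ s.image Prod.snd, prob μ Y y := by
          rw [Finset.sum_product_right]
          refine Finset.sum_congr rfl fun y _ => ?_
          simp only [hr]
          rw [Finset.sum_add_distrib, ← Finset.mul_sum, ← Finset.mul_sum]
          simp only [Finset.sum_ite_eq', Finset.mem_univ, if_true, Finset.sum_const,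
            Finset.card_univ, Fintype.card_fin, nsmul_eq_mul]
          field_simp
          ring
      _ ≤ 1 := (sum_prob_le hμ Y _).trans_eq h1
  · rw [entropy_eq_sum, Finset.sum_mul, ← h1, ← Finset.sum_add_distrib, ← Finset.sum_add_distrib]
    refine Finset.sum_congr rfl fun ω _ => ?_
    rcases (hμ ω).eq_or_lt with h0 | h0
    · simp [← h0]
    · have hp := (prob_pos hμ Y h0).ne'
      simp only [hr']
      by_cases hg : W ω = g (Y ω)
      · rw [if_pos hg, ind_of_false (by simp [hg]), Real.logb_mul hp (by norm_num), one_div,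
          Real.logb_inv, Real.logb_self_eq_one (by norm_num)]
        ring
      · rw [if_neg hg, ind_of_true (Ne.symm hg), Real.logb_mul hp (by positivity), one_div,
          Real.logb_inv, Real.logb_mul (by norm_num) hM'.ne', Real.logb_self_eq_one (by norm_num)]
        ring

/-! ### The converse for a fixed code -/

section Converse

variable {𝒳 𝒰 𝒱 : Type*} {𝒴 : Fin 3 → Type*} (D : Model 𝒳 𝒰 𝒱 𝒴)
  {n : ℕ} {m : Fin 3 → ℕ}

/-- The law of three independent uniform messages. -/
noncomputable def msgLaw (m : Fin 3 → ℕ) (w : Messages m) : ℝ := ∏ i, unif (m i) (w i)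

theorem msgLaw_nonneg (w : Messages m) : 0 ≤ msgLaw m w :=
  Finset.prod_nonneg fun _ _ => unif_nonneg _

theorem sum_msgLaw (hm : ∀ i, 0 < m i) : ∑ w, msgLaw m w = 1 :=
  sum_prod_eq_one (fun i => unif (m i)) fun i => sum_unif (hm i)

theorem uniformProb_eq_msgLaw (E : Messages m → Prop) :
    uniformProb E = ∑ w, msgLaw m w * ind (E w) := by
  have h : ∀ w, msgLaw m w = (Fintype.card (Messages m) : ℝ)⁻¹ := by
    intro w
    rw [Fintype.card_pi]
    simp [msgLaw, unif]
  simp_rw [h]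
  rw [uniformProb_eq_sum, ← Finset.mul_sum, div_eq_inv_mul]

theorem sum_error_le (c : Codebooks 𝒳 n m) (dec : (i : Fin 3) → (Fin n → 𝒴 i) → Fin (m i))
    (i : Fin 3) :
    ∑ w, msgLaw m w * ind (dec i (received D c w i) ≠ w i) ≤ codeError D c dec := by
  rw [codeError, uniformProb_eq_msgLaw]
  refine Finset.sum_le_sum fun w _ => mul_le_mul_of_nonneg_left ?_ (msgLaw_nonneg w)
  by_cases h : dec i (received D c w i) ≠ w i
  · rw [ind_of_true h, ind_of_true ⟨i, h⟩]
  · rw [ind_of_false h]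
    exact ind_nonneg _

/-- The own signal has to carry the message. -/
theorem log_le_entropy_coarse (hm : ∀ i, 0 < m i) (c : Codebooks 𝒳 n m)
    (dec : (i : Fin 3) → (Fin n → 𝒴 i) → Fin (m i)) (i : Fin 3) :
    (1 - codeError D c dec) * Real.logb 2 (m i) - 1 ≤
      entropy (unif (m i)) (fun k t => D.level .coarse (c i k t)) := by
  have hsum := sum_error_le D c dec i
  rw [← one_mul (codeError D c dec), ← sum_msgLaw hm, Finset.sum_mul] at hsum
  have hres := sum_pi_resample (fun i => unif (m i)) i (sum_unif (hm i))
    (fun w => ind (dec i (received D c w i) ≠ w i))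
  have hsum' := hres.symm.le.trans hsum
  have hne : Nonempty (Messages m) := ⟨fun i => ⟨0, hm i⟩⟩
  -- Some choice of the other two messages has an error probability, over the message of user `i`,
  -- no larger than the average. With these messages fixed, the received word is a function of the
  -- coarse word of user `i`.
  obtain ⟨w, -, hw⟩ := Finset.exists_le_of_sum_le
    (Finset.univ_nonempty (α := Messages m)) hsum'
  have hpos : 0 < msgLaw m w := Finset.prod_pos fun j _ => unif_pos _
  have hw' : ∑ k, unif (m i) k * ind (dec i (received D c (Function.update w i k) i) ≠
      Function.update w i k i) ≤ codeError D c dec := le_of_mul_le_mul_left hw hpos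
  have hfac : ∀ k k' : Fin (m i), (fun t => D.level .coarse (c i k' t)) =
      (fun t => D.level .coarse (c i k t)) →
      received D c (Function.update w i k') i = received D c (Function.update w i k) i := by
    intro k k' h
    funext t
    simp only [received]
    have n1 : i + 1 ≠ i := by clear * -; revert i; decide
    have n2 : i + 2 ≠ i := by clear * -; revert i; decide
    refine D.output_eq_of_level ?_ ?_ ?_
    · simpa using congrFun h t
    · simp [n1]
    · simp [n2]
  set Y : Fin (m i) → (Fin n → 𝒴 i) := fun k => received D c (Function.update w i k) i
  have hF := fano unif_nonneg (sum_unif (hm i)) (hm i) (fun k => k) Y (dec i)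
  have h1 : entropy (unif (m i)) (fun k => k) ≤ entropy (unif (m i)) (fun k => (k, Y k)) :=
    entropy_mono unif_nonneg fun k k' _ _ h => (Prod.mk.inj h).1
  have h2 : entropy (unif (m i)) Y ≤
      entropy (unif (m i)) (fun k t => D.level .coarse (c i k t)) :=
    entropy_mono unif_nonneg fun k k' _ _ h => hfac k k' h
  rw [entropy_unif_id (hm i)] at h1
  have hlog : 0 ≤ Real.logb 2 (m i) :=
    Real.logb_nonneg (by norm_num) (by exact_mod_cast hm i)
  have h3 : (∑ k, unif (m i) k * ind (dec i (Y k) ≠ k)) ≤ codeError D c dec := by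
    simpa [Y] using hw'
  have h4 := mul_le_mul_of_nonneg_right h3 hlog
  linarith

/-- The first receiver resolves its message and both interfering signals. -/
theorem sum_log_le_entropy_received (hm : ∀ i, 0 < m i) (c : Codebooks 𝒳 n m)
    (dec : (i : Fin 3) → (Fin n → 𝒴 i) → Fin (m i))
    (hdet : ∀ t (w w' : Messages m),
      D.level .coarse (c 0 (w' 0) t) = D.level .coarse (c 0 (w 0) t) →
      D.output 0 (fun j => c j (w' j) t) = D.output 0 (fun j => c j (w j) t) →
      D.level .fine (c 1 (w' 1) t) = D.level .fine (c 1 (w 1) t) ∧ c 2 (w' 2) t = c 2 (w 2) t) :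
    (1 - codeError D c dec) * ∑ i, Real.logb 2 (m i) - 3 ≤
      entropy (msgLaw m) (fun w => received D c w 0) := by
  have hμ : ∀ w, 0 ≤ msgLaw m w := msgLaw_nonneg
  have hF := fano hμ (sum_msgLaw hm) (hm 0) (fun w => w 0) (fun w => received D c w 0) (dec 0)
  -- From the first user the message itself is recorded, from the others the words heard. By `hdet`
  -- all this is a function of the first message and the output, and its components are independent.
  set Z : (i : Fin 3) → Fin (m i) → ℕ × (Fin n → 𝒳 ⊕ 𝒰 ⊕ 𝒱) := fun i k =>
    (if i = 0 then (k : ℕ) else 0, fun t => D.level (heard 0 i) (c i k t)) with hZ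
  have h1 : entropy (msgLaw m) (fun w i => Z i (w i)) ≤
      entropy (msgLaw m) (fun w => (w 0, received D c w 0)) := by
    refine entropy_mono hμ fun w w' _ _ h => ?_
    obtain ⟨h0, hY⟩ := Prod.mk.inj h
    have hd := fun t => hdet t w w' (by rw [h0]) (congrFun hY t)
    funext i
    have e0 : heard 0 0 = .coarse := by decide
    have e1 : heard 0 1 = .fine := by decide
    have e2 : heard 0 2 = .full := by decide
    fin_cases i
    · simp [hZ, h0]
    · simp [hZ, e1, fun t => (hd t).1]
    · simp [hZ, e2, fun t => (hd t).2]
  have h2 := entropy_pi (fun i => unif (m i)) (fun i => unif_nonneg) (fun i => sum_unif (hm i)) Z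
  have h2' : entropy (msgLaw m) (fun w i => Z i (w i)) = ∑ i, entropy (unif (m i)) (Z i) := h2
  rw [Fin.sum_univ_three] at h2' ⊢
  have h3 : Real.logb 2 (m 0) ≤ entropy (unif (m 0)) (Z 0) := by
    rw [← entropy_unif_id (hm 0)]
    refine entropy_mono unif_nonneg fun k k' _ _ h => ?_
    have := (Prod.mk.inj h).1
    simpa [Fin.ext_iff] using this
  have h4 : ∀ i, entropy (unif (m i)) (fun k t => D.level .coarse (c i k t)) ≤
      entropy (unif (m i)) (Z i) := by
    -- Every level determines the coarse one, so the coarse bound of each interferer applies to the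
    -- word heard from it. The three applications of Fano's inequality account for the constant 3.
    intro i
    refine entropy_mono unif_nonneg fun k k' _ _ h => ?_
    have := (Prod.mk.inj h).2
    funext t
    have ht : D.level (heard 0 i) (c i k' t) = D.level (heard 0 i) (c i k t) := congrFun this t
    rcases hl : heard 0 i with _ | _ | _ <;> rw [hl] at ht
    · simp only [Model.level, Sum.inl.injEq] at ht
      rw [ht]
    · simp only [Model.level, Sum.inr.injEq, Sum.inl.injEq] at ht
      simp only [Model.level, ht]
    · exact ht
  have h5 := log_le_entropy_coarse D hm c dec 1
  have h6 := log_le_entropy_coarse D hm c dec 2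
  have hlog : 0 ≤ Real.logb 2 (m 0) :=
    Real.logb_nonneg (by norm_num) (by exact_mod_cast hm 0)
  have h7 := mul_le_mul_of_nonneg_right (sum_error_le D c dec 0) hlog
  have h8 := h4 1
  have h9 := h4 2
  linarith

variable [Fintype 𝒳]

/-- A cross entropy bound for the words that a code produces, with reference letter laws `P t`. -/
theorem entropy_received_le (hm : ∀ i, 0 < m i) (c : Codebooks 𝒳 n m) (i₀ : Fin 3)
    (P : Fin n → 𝒳 → ℝ) (hP : ∀ t x, 0 ≤ P t x) (hP1 : ∀ t, ∑ x, P t x = 1)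
    (hsupp : ∀ i k t, 0 < P t (c i k t)) :
    entropy (msgLaw m) (fun w => received D c w i₀) ≤
      ∑ t, ∑ x : Fin 3 → 𝒳, (∏ i, letterLaw (c i) t (x i)) *
        -Real.logb 2 (prob (prodLaw (P t)) (D.output i₀) (D.output i₀ x)) := by
  have hpr : ∀ t x, 0 ≤ prodLaw (P t) x := fun t => prodLaw_nonneg (hP t)
  have hpos : ∀ w t, 0 < prob (prodLaw (P t)) (D.output i₀) (received D c w i₀ t) :=
    fun w t => prob_pos (hpr t) (D.output i₀) (ω := fun j => c j (w j) t)
      (prodLaw_pos fun j => hsupp j (w j) t)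
  refine (entropy_le_cross msgLaw_nonneg (sum_msgLaw hm) (fun w => received D c w i₀)
    (fun y => ∏ t, prob (prodLaw (P t)) (D.output i₀) (y t))
    (fun y => Finset.prod_nonneg fun t _ => prob_nonneg (hpr t) _ _)
    (fun w _ => Finset.prod_pos fun t _ => hpos w t) (fun s => ?_)).trans_eq ?_
  · simp_rw [← prob_pi (fun t => prodLaw (P t)) (fun _ => D.output i₀)]
    exact (sum_prob_le (fun z => Finset.prod_nonneg fun t _ => hpr t (z t)) _ s).trans_eq
      (sum_prod_eq_one (fun t => prodLaw (P t)) fun t => sum_prodLaw (hP1 t))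
  · simp_rw [Real.logb_prod _ _ fun t _ => (hpos _ t).ne', ← Finset.sum_neg_distrib,
      Finset.mul_sum]
    rw [Finset.sum_comm]
    refine Finset.sum_congr rfl fun t _ => ?_
    simp_rw [letterLaw_eq_prob]
    simp_rw [← prob_pi (fun i => unif (m i)) (fun i k => c i k t)]
    rw [sum_univ_prob_mul (fun w : Messages m => ∏ i, unif (m i) (w i))
      (fun w i => c i (w i) t)
      (fun x => -Real.logb 2 (prob (prodLaw (P t)) (D.output i₀) (D.output i₀ x)))]
    rfl

/-- The reference law in Gibbs' inequality is memoryless, and the letter laws of `b` need not be `P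
t`. The bound is linear in these laws, so it can be averaged over codebooks. -/
theorem entropy_word_le {M : ℕ} (hM : 0 < M) {α : Type*} (φ : 𝒳 → α) (b : Fin M → Fin n → 𝒳)
    (P : Fin n → 𝒳 → ℝ) (hP : ∀ t x, 0 ≤ P t x) (hP1 : ∀ t, ∑ x, P t x = 1)
    (hsupp : ∀ k t, 0 < P t (b k t)) :
    entropy (unif M) (fun k t => φ (b k t)) ≤
      ∑ t, ∑ x, letterLaw b t x * -Real.logb 2 (prob (P t) φ (φ x)) := by
  have hpos : ∀ k t, 0 < prob (P t) φ (φ (b k t)) := fun k t => prob_pos (hP t) φ (hsupp k t)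
  refine (entropy_le_cross unif_nonneg (sum_unif hM) (fun k t => φ (b k t))
    (fun y => ∏ t, prob (P t) φ (y t))
    (fun y => Finset.prod_nonneg fun t _ => prob_nonneg (hP t) _ _)
    (fun w _ => Finset.prod_pos fun t _ => hpos w t) (fun s => ?_)).trans_eq ?_
  · simp_rw [← prob_pi P (fun _ => φ)]
    exact (sum_prob_le (fun z => Finset.prod_nonneg fun t _ => hP t (z t)) _ s).trans_eq
      (sum_prod_eq_one P hP1)
  · simp_rw [Real.logb_prod _ _ fun t _ => (hpos _ t).ne', ← Finset.sum_neg_distrib,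
      Finset.mul_sum]
    rw [Finset.sum_comm]
    refine Finset.sum_congr rfl fun t _ => ?_
    simp_rw [letterLaw_eq_prob]
    rw [sum_univ_prob_mul (unif M) (fun k => b k t)
      (fun x => -Real.logb 2 (prob (P t) φ (φ x)))]

/-- The converse for an ensemble of independent codebooks with letter laws `P t`. -/
theorem ensemble_converse (hm : ∀ i, 0 < m i)
    (P : Fin n → 𝒳 → ℝ) (hP : ∀ t x, 0 ≤ P t x) (hP1 : ∀ t, ∑ x, P t x = 1)
    (κ : (i : Fin 3) → (Fin (m i) → Fin n → 𝒳) → ℝ) (hκ : ∀ i b, 0 ≤ κ i b)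
    (hκ1 : ∀ i, ∑ b, κ i b = 1) (hlet : ∀ i t x, ∑ b, κ i b * letterLaw b t x = P t x)
    (hdet : ∀ t (x x' : Fin 3 → 𝒳), (∀ j, 0 < P t (x j)) → (∀ j, 0 < P t (x' j)) →
      D.level .coarse (x' 0) = D.level .coarse (x 0) → D.output 0 x' = D.output 0 x →
      D.level .fine (x' 1) = D.level .fine (x 1) ∧ x' 2 = x 2)
    (dec : Codebooks 𝒳 n m → (i : Fin 3) → (Fin n → 𝒴 i) → Fin (m i)) {δ : ℝ}
    (hδ : ∑ c : Codebooks 𝒳 n m, (∏ i, κ i (c i)) * codeError D c (dec c) = δ) :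
    (∀ i, (1 - δ) * Real.logb 2 (m i) - 1 ≤ ∑ t, entropy (P t) (D.level .coarse)) ∧
    (1 - δ) * ∑ i, Real.logb 2 (m i) - 3 ≤ ∑ t, entropy (prodLaw (P t)) (D.output 0) := by
  have hκp : ∀ c : Codebooks 𝒳 n m, 0 ≤ ∏ i, κ i (c i) :=
    fun c => Finset.prod_nonneg fun i _ => hκ i _
  have hκs : ∑ c : Codebooks 𝒳 n m, ∏ i, κ i (c i) = 1 := sum_prod_eq_one κ hκ1
  -- A letter used by a codebook of positive weight has positive mean frequency. This makes the
  -- cross entropy bounds applicable and places the letters in the support where `hdet` holds.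
  have hsupp : ∀ c : Codebooks 𝒳 n m, 0 < ∏ i, κ i (c i) → ∀ i k t, 0 < P t (c i k t) := by
    intro c hc i k t
    have hi : 0 < κ i (c i) := (hκ i _).lt_of_ne'
      ((Finset.prod_ne_zero_iff.1 hc.ne') i (Finset.mem_univ i))
    have hl : 0 < letterLaw (c i) t (c i k t) := by
      rw [letterLaw_eq_prob]
      exact prob_pos unif_nonneg (fun k => c i k t) (unif_pos k)
    have hl0 : ∀ b x, 0 ≤ letterLaw (M := m i) (n := n) (𝒳 := 𝒳) b t x := fun b x => by
      rw [letterLaw_eq_prob]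
      exact prob_nonneg unif_nonneg _ _
    rw [← hlet i t]
    exact (mul_pos hi hl).trans_le (Finset.single_le_sum
      (f := fun b => κ i b * letterLaw b t (c i k t))
      (fun b _ => mul_nonneg (hκ i b) (hl0 b _)) (Finset.mem_univ (c i)))
  -- The lower bounds are affine in the error probability, so they are the means of their values
  -- over the ensemble.
  have havg : ∀ (a b : ℝ), (1 - δ) * a - b =
      ∑ c : Codebooks 𝒳 n m, (∏ i, κ i (c i)) * ((1 - codeError D c (dec c)) * a - b) := by
    intro a b
    have : ∀ c : Codebooks 𝒳 n m, (∏ i, κ i (c i)) * ((1 - codeError D c (dec c)) * a - b) =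
        (∏ i, κ i (c i)) * (a - b) - (∏ i, κ i (c i)) * codeError D c (dec c) * a :=
      fun c => by ring
    simp_rw [this, Finset.sum_sub_distrib, ← Finset.sum_mul]
    rw [hκs, hδ]
    ring
  refine ⟨fun i => ?_, ?_⟩
  · rw [havg]
    calc _ ≤ ∑ c : Codebooks 𝒳 n m, (∏ j, κ j (c j)) * ∑ t, ∑ x, letterLaw (c i) t x *
          -Real.logb 2 (prob (P t) (D.level .coarse) (D.level .coarse x)) := by
          refine Finset.sum_le_sum fun c _ => ?_
          rcases (hκp c).eq_or_lt with h0 | h0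
          · simp [← h0]
          · exact mul_le_mul_of_nonneg_left ((log_le_entropy_coarse D hm c (dec c) i).trans
              (entropy_word_le (hm i) _ (c i) P hP hP1 (hsupp c h0 i))) h0.le
      _ = ∑ b, κ i b * ∑ t, ∑ x, letterLaw b t x *
          -Real.logb 2 (prob (P t) (D.level .coarse) (D.level .coarse x)) :=
          sum_pi_prod_mul κ hκ1 i (fun b => ∑ t, ∑ x, letterLaw b t x *
            -Real.logb 2 (prob (P t) (D.level .coarse) (D.level .coarse x)))
      _ = ∑ t, entropy (P t) (D.level .coarse) := by
          simp_rw [Finset.mul_sum]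
          rw [Finset.sum_comm]
          refine Finset.sum_congr rfl fun t _ => ?_
          rw [Finset.sum_comm, entropy_eq_sum]
          refine Finset.sum_congr rfl fun x _ => ?_
          simp_rw [← mul_assoc]
          rw [← Finset.sum_mul, hlet]
  · rw [havg]
    calc _ ≤ ∑ c : Codebooks 𝒳 n m, (∏ j, κ j (c j)) * ∑ t, ∑ x : Fin 3 → 𝒳,
          (∏ i, letterLaw (c i) t (x i)) *
          -Real.logb 2 (prob (prodLaw (P t)) (D.output 0) (D.output 0 x)) := by
          refine Finset.sum_le_sum fun c _ => ?_
          rcases (hκp c).eq_or_lt with h0 | h0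
          · simp [← h0]
          · refine mul_le_mul_of_nonneg_left ((sum_log_le_entropy_received D hm c (dec c)
              fun t w w' => ?_).trans
              (entropy_received_le D hm c 0 P hP hP1 (hsupp c h0))) h0.le
            exact hdet t _ _ (fun j => hsupp c h0 j _ t) (fun j => hsupp c h0 j _ t)
      _ = ∑ t, entropy (prodLaw (P t)) (D.output 0) := by
          simp_rw [Finset.mul_sum]
          rw [Finset.sum_comm]
          refine Finset.sum_congr rfl fun t _ => ?_
          rw [Finset.sum_comm, entropy_eq_sum]
          refine Finset.sum_congr rfl fun x _ => ?_
          simp_rw [← mul_assoc, ← Finset.prod_mul_distrib]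
          -- Independence of the three codebooks: the mean of the product of their letter laws is
          -- the product of the means.
          rw [← Finset.sum_mul, sum_pi_prod (fun i b => κ i b * letterLaw b t (x i))]
          simp_rw [hlet]
          rfl

end Converse

/-! ### The symmetric capacity for an input law -/

section InputLawCapacity

theorem codeError_eq_zero_of_card_one {𝒳 𝒰 𝒱 : Type*} {𝒴 : Fin 3 → Type*}
    (D : Model 𝒳 𝒰 𝒱 𝒴) {n : ℕ} (c : Codebooks 𝒳 n (fun _ => 1))
    (dec : (i : Fin 3) → (Fin n → 𝒴 i) → Fin 1) : codeError D c dec = 0 := by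
  rw [codeError, uniformProb_eq_sum, Finset.sum_eq_zero, zero_div]
  intro w _
  exact ind_of_false fun ⟨i, hi⟩ => hi (Subsingleton.elim _ _)

variable {𝒬 𝒳 𝒰 𝒱 : Type*} {𝒴 : Fin 3 → Type*} [Fintype 𝒬] [Fintype 𝒳]
  (D : Model 𝒳 𝒰 𝒱 𝒴) (L : InputLaw 𝒬 𝒳)

theorem sum_timeSharingProb_mul {n : ℕ} (h : 𝒬 → ℝ) :
    ∑ q : Fin n → 𝒬, timeSharingProb L q * ∑ t, h (q t) = n * ∑ q, L.pQ q * h q := by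
  simp_rw [Finset.mul_sum]
  rw [Finset.sum_comm]
  have : ∀ t : Fin n, ∑ q : Fin n → 𝒬, timeSharingProb L q * h (q t) = ∑ q, L.pQ q * h q :=
    fun t => sum_pi_prod_mul (fun _ : Fin n => L.pQ) (fun _ => L.pQ_sum) t h
  simp_rw [this]
  simp [Finset.mul_sum]

variable {L}

/-- Given `q`, the code is an ensemble with letter laws `L.pX (q t)`. Sequences of probability zero
are set aside, since the interference is determined only where `L.pQ (q t)` is positive. -/
theorem RandomCode.converse {n : ℕ} {m : Fin 3 → ℕ} (C : RandomCode L 𝒴 n m)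
    (h : D.Admissible L) (hm : ∀ i, 0 < m i) :
    (∀ i, (1 - C.error D) * Real.logb 2 (m i) - 1 ≤
      n * ∑ q, L.pQ q * entropy (L.pX q) (D.level .coarse)) ∧
    (1 - C.error D) * ∑ i, Real.logb 2 (m i) - 3 ≤
      n * ∑ q, L.pQ q * entropy (prodLaw (L.pX q)) (D.output 0) := by
  set δ : (Fin n → 𝒬) → ℝ := fun q => ∑ c : Codebooks 𝒳 n m, (∏ i, C.κ i q (c i)) *
    codeError D c (fun i => C.dec i q c) with hδ
  have herr : C.error D = ∑ q : Fin n → 𝒬, timeSharingProb L q * δ q := rfl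
  have hconv : ∀ q : Fin n → 𝒬, 0 < timeSharingProb L q → _ := fun q hq =>
    ensemble_converse D hm (fun t => L.pX (q t)) (fun t => L.pX_nonneg _) (fun t => L.pX_sum _)
      (fun i => C.κ i q) (fun i => C.κ_nonneg i q) (fun i => C.κ_sum i q)
      (fun i => C.letter i q) (fun t x x' hx hx' hC hY => h.determines 0
        ((L.pQ_nonneg _).lt_of_ne' ((Finset.prod_ne_zero_iff.1 hq.ne') t (Finset.mem_univ t)))
        hx hx' hC hY)
      (fun c i => C.dec i q c) (δ := δ q) rfl
  have havg : ∀ a b : ℝ, (1 - C.error D) * a - b =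
      ∑ q : Fin n → 𝒬, timeSharingProb L q * ((1 - δ q) * a - b) := by
    intro a b
    have e : ∀ q : Fin n → 𝒬, timeSharingProb L q * ((1 - δ q) * a - b) =
        timeSharingProb L q * (a - b) - timeSharingProb L q * δ q * a := fun q => by ring
    have h1 := sum_timeSharingProb L n
    simp_rw [e, Finset.sum_sub_distrib, ← Finset.sum_mul]
    rw [h1, ← herr]
    ring
  refine ⟨fun i => ?_, ?_⟩
  · rw [havg, ← sum_timeSharingProb_mul]
    refine Finset.sum_le_sum fun q _ => ?_
    rcases (timeSharingProb_nonneg L q).eq_or_lt with h0 | h0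
    · simp [← h0]
    · exact mul_le_mul_of_nonneg_left ((hconv q h0).1 i) h0.le
  · rw [havg, ← sum_timeSharingProb_mul]
    refine Finset.sum_le_sum fun q _ => ?_
    rcases (timeSharingProb_nonneg L q).eq_or_lt with h0 | h0
    · simp [← h0]
    · exact mul_le_mul_of_nonneg_left (hconv q h0).2 h0.le

theorem pos_of_two_rpow_le {a : ℝ} {M : ℕ} (h : (2 : ℝ) ^ a ≤ M) : 0 < M := by
  have : (0 : ℝ) < M := (by positivity : (0 : ℝ) < (2 : ℝ) ^ a).trans_le h
  exact_mod_cast this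

/-- The finite block length form of the converse, for a common rate `r`. -/
theorem rate_le_of_converse {n : ℕ} {m : Fin 3 → ℕ} {R : Fin 3 → ℝ} {ε e a b : ℝ} (hε : ε < 1)
    (he : e ≤ ε) (hR : ∀ i, (2 : ℝ) ^ ((n : ℝ) * (R i - ε)) ≤ m i)
    (h1 : ∀ i, (1 - e) * Real.logb 2 (m i) - 1 ≤ n * a)
    (h2 : (1 - e) * ∑ i, Real.logb 2 (m i) - 3 ≤ n * b) :
    (1 - ε) * (n * (min (R 0) (min (R 1) (R 2)) - ε)) ≤ n * min a (1 / 3 * b) + 1 := by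
  set r := min (R 0) (min (R 1) (R 2)) with hr
  have hrR : ∀ i, r ≤ R i := by
    intro i
    fin_cases i
    · exact min_le_left _ _
    · exact (min_le_right _ _).trans (min_le_left _ _)
    · exact (min_le_right _ _).trans (min_le_right _ _)
  have hlog : ∀ i, n * (r - ε) ≤ Real.logb 2 (m i) := by
    intro i
    have hm : (0 : ℝ) < m i := by exact_mod_cast pos_of_two_rpow_le (hR i)
    have := (Real.le_logb_iff_rpow_le (by norm_num) hm).2 (hR i)
    have h3 := mul_le_mul_of_nonneg_left (sub_le_sub_right (hrR i) ε) (Nat.cast_nonneg (α := ℝ) n)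
    linarith
  have hlog0 : ∀ i, 0 ≤ Real.logb 2 (m i) := fun i =>
    Real.logb_nonneg (by norm_num) (by exact_mod_cast pos_of_two_rpow_le (hR i))
  have key : ∀ i, (1 - ε) * (n * (r - ε)) ≤ (1 - e) * Real.logb 2 (m i) := by
    intro i
    calc _ ≤ (1 - ε) * Real.logb 2 (m i) :=
          mul_le_mul_of_nonneg_left (hlog i) (by linarith)
      _ ≤ _ := mul_le_mul_of_nonneg_right (by linarith) (hlog0 i)
  have hn : (0 : ℝ) ≤ n := Nat.cast_nonneg n
  -- Division of the sum bound by 3 turns its constant 3 into 1, the constant of the individual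
  -- bounds.
  rw [mul_min_of_nonneg _ _ hn, ← min_add_add_right]
  refine le_min ?_ ?_
  · have := key 0
    have := h1 0
    linarith
  · rw [Fin.sum_univ_three] at h2
    have := key 0
    have := key 1
    have := key 2
    linarith

/-- Large `n` removes the additive constant for fixed `ε`; then `ε` tends to zero. -/
theorem le_of_forall_eps {r C : ℝ} (h : ∀ ε : ℝ, 0 < ε → ε < 1 → ∃ N : ℕ, ∀ n ≥ N,
    (1 - ε) * (n * (r - ε)) ≤ n * C + 1) : r ≤ C := by
  have h1 : ∀ ε : ℝ, 0 < ε → ε < 1 → (1 - ε) * (r - ε) ≤ C := by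
    intro ε h0 h1
    obtain ⟨N, hN⟩ := h ε h0 h1
    by_contra! hlt
    obtain ⟨K, hK⟩ := exists_nat_gt (1 / ((1 - ε) * (r - ε) - C))
    have hd : 0 < (1 - ε) * (r - ε) - C := sub_pos.2 hlt
    have h2 := hN (max N K) (le_max_left _ _)
    have h3 : (K : ℝ) ≤ (max N K : ℕ) := by exact_mod_cast le_max_right _ _
    rw [div_lt_iff₀ hd] at hK
    have h4 := mul_le_mul_of_nonneg_right h3 hd.le
    linarith
  have hlim : Tendsto (fun ε : ℝ => (1 - ε) * (r - ε)) (𝓝[>] 0) (𝓝 r) := by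
    have : Continuous (fun ε : ℝ => (1 - ε) * (r - ε)) := by fun_prop
    have h2 := (this.tendsto 0).mono_left (nhdsWithin_le_nhds (s := Set.Ioi 0))
    simpa using h2
  refine le_of_tendsto hlim ?_
  filter_upwards [Ioo_mem_nhdsGT (zero_lt_one' ℝ)] with ε hε
  exact h1 ε hε.1 hε.2

theorem Model.Admissible.rateFormula_nonneg (h : D.Admissible L) : 0 ≤ D.rateFormula L := by
  rw [h.rateFormula_eq]
  refine le_min (Finset.sum_nonneg fun q _ => mul_nonneg (L.pQ_nonneg q)
    (entropy_nonneg (L.pX_nonneg q) (L.pX_sum q) _)) (mul_nonneg (by norm_num)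
    (Finset.sum_nonneg fun q _ => mul_nonneg (L.pQ_nonneg q)
      (entropy_nonneg (prodLaw_nonneg (L.pX_nonneg q)) (sum_prodLaw (L.pX_sum q)) _)))

theorem sum_unsplitLaw_mul_letterLaw (L : InputLaw 𝒬 𝒳) {n M : ℕ} (hM : 0 < M) (q : Fin n → 𝒬)
    (t : Fin n) (x : 𝒳) :
    ∑ b : Fin M → Fin n → 𝒳, unsplitLaw L q b * letterLaw b t x = L.pX (q t) x := by
  classical
  have h1 : ∀ k : Fin M, ∑ b : Fin M → Fin n → 𝒳, unsplitLaw L q b * (if b k t = x then 1 else 0) =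
      L.pX (q t) x := by
    intro k
    have h2 := sum_pi_prod_mul (fun _ : Fin M => seqLaw L q) (fun _ => sum_seqLaw L q) k
      (fun z => if z t = x then (1 : ℝ) else 0)
    have h3 := sum_pi_prod_mul (fun t => L.pX (q t)) (fun t => L.pX_sum (q t)) t
      (fun a => if a = x then (1 : ℝ) else 0)
    refine h2.trans (h3.trans ?_)
    simp
  simp_rw [letterLaw_eq_prob, prob_eq_sum_ite, Finset.mul_sum]
  rw [Finset.sum_comm, ← one_mul (L.pX (q t) x), ← sum_unif hM, Finset.sum_mul]
  refine Finset.sum_congr rfl fun k _ => ?_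
  rw [← h1 k, Finset.mul_sum]
  refine Finset.sum_congr rfl fun b _ => ?_
  split_ifs <;> simp [unif, mul_comm]

/-- The random code without message splitting. -/
noncomputable def unsplitCode (L : InputLaw 𝒬 𝒳) (𝒴 : Fin 3 → Type*) {n : ℕ} {m : Fin 3 → ℕ}
    (hm : ∀ i, 0 < m i)
    (dec : (i : Fin 3) → (Fin n → 𝒬) → Codebooks 𝒳 n m → (Fin n → 𝒴 i) → Fin (m i)) :
    RandomCode L 𝒴 n m where
  κ := fun _ q b => unsplitLaw L q b
  κ_nonneg := fun _ q b => unsplitLaw_nonneg L q b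
  κ_sum := fun _ q => sum_unsplitLaw L q
  letter := fun i q t x => sum_unsplitLaw_mul_letterLaw L (hm i) q t x
  dec := dec

/-- The joint decoder of receiver `i`, restricted to the own message. -/
noncomputable def ownDecoder (L : InputLaw 𝒬 𝒳) (ε : ℝ) {n : ℕ} {m : Fin 3 → ℕ}
    (hm : ∀ i, 0 < m i) (q : Fin n → 𝒬) (c : Codebooks 𝒳 n m) (i : Fin 3) (y : Fin n → 𝒴 i) :
    Fin (m i) :=
  ((jointDecoder D L ε q c i y).getD (fun i => ⟨0, hm i⟩)) i

/-- When every joint decoder finds the whole triple, the own messages are correct; the default of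
`getD` matters only when a joint decoder declares nothing. -/
theorem unsplitCode_error_le (L : InputLaw 𝒬 𝒳) (ε : ℝ) {n : ℕ} {m : Fin 3 → ℕ}
    (hm : ∀ i, 0 < m i) :
    (unsplitCode L 𝒴 (n := n) hm (fun i q c y => ownDecoder D L ε hm q c i y)).error D ≤
      unsplitJointError D L ε n m := by
  refine Finset.sum_le_sum fun q _ => mul_le_mul_of_nonneg_left
    (Finset.sum_le_sum fun c _ => mul_le_mul_of_nonneg_left (uniformProb_mono fun w => ?_)
      (Finset.prod_nonneg fun _ _ => unsplitLaw_nonneg L q _)) (timeSharingProb_nonneg L q)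
  rintro ⟨i, hi⟩
  refine ⟨i, fun hs => hi ?_⟩
  simp only [unsplitCode, ownDecoder]
  rw [hs]
  rfl

theorem min_const_three (a : ℝ) : min a (min a a) = a := by simp

theorem isSymmetricCapacity_regionWith (h : D.Admissible L) :
    IsSymmetricCapacity (D.regionWith L) (D.rateFormula L) := by
  have hF0 := h.rateFormula_nonneg D
  refine ⟨⟨fun _ => D.rateFormula L, ⟨fun _ => hF0, fun ε hε => ?_⟩, min_const_three _⟩, ?_⟩
  -- The rate to be attained is F - ε. If it is not positive, one message per user and no error
  -- suffice.
  · rcases le_or_gt (D.rateFormula L) ε with hle | hlt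
    · refine ⟨0, fun n _ => ⟨fun _ => 1, unsplitCode L 𝒴 (fun _ => one_pos)
        (fun _ _ _ _ => 0), fun _ => ?_, ?_⟩⟩
      · rw [Nat.cast_one]
        exact Real.rpow_le_one_of_one_le_of_nonpos (by norm_num)
          (mul_nonpos_of_nonneg_of_nonpos (Nat.cast_nonneg n) (by linarith))
      · refine le_of_eq_of_le ?_ hε.le
        rw [RandomCode.error, ensembleAverage]
        refine Finset.sum_eq_zero fun q _ => ?_
        rw [Finset.sum_eq_zero, mul_zero]
        intro c _
        rw [codeError_eq_zero_of_card_one, mul_zero]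
    · obtain ⟨ε₀, hε₀, hlim⟩ := tendsto_unsplitJointError D L h (R := D.rateFormula L - ε)
        (by linarith) (by linarith)
      have hev := (hlim (ε₀ / 2) (by linarith) (by linarith)).eventually (eventually_le_nhds hε)
      obtain ⟨N, hN⟩ := eventually_atTop.1 hev
      refine ⟨N, fun n hn => ⟨fun _ => ⌈(2 : ℝ) ^ ((n : ℝ) * (D.rateFormula L - ε))⌉₊,
        unsplitCode L 𝒴 (fun _ => Nat.ceil_pos.2 (by positivity))
          (fun i q c y => ownDecoder D L (ε₀ / 2) (fun _ => Nat.ceil_pos.2 (by positivity)) q c i y),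
        fun _ => Nat.le_ceil _, ?_⟩⟩
      exact (unsplitCode_error_le D L (ε₀ / 2) _).trans (hN n hn)
  · rintro _ ⟨R, ⟨-, hR⟩, rfl⟩
    refine le_of_forall_eps fun ε h0 h1 => ?_
    obtain ⟨N, hN⟩ := hR ε h0
    refine ⟨N, fun n hn => ?_⟩
    obtain ⟨m, C, hm, hC⟩ := hN n hn
    obtain ⟨c1, c2⟩ := C.converse D h fun i => pos_of_two_rpow_le (hm i)
    rw [h.rateFormula_eq]
    exact rate_le_of_converse h1 hC hm c1 c2

end InputLawCapacity

/-! ### Equalising the letter laws of codebooks -/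

/-- Two words of the same length can be matched up to the differences of their letter counts. -/
theorem exists_perm_card_ne_le {ι α : Type*} [Fintype ι] [Fintype α] (β γ : ι → α) :
    ∃ σ : Equiv.Perm ι, ∑ k, ind (γ (σ k) ≠ β k) ≤
      ∑ x, |∑ k, ind (β k = x) - ∑ k, ind (γ k = x)| := by
  classical
  -- A matching with the fewest mismatches: if a letter held at one mismatched place were wanted at
  -- another, a swap would repair the latter.
  obtain ⟨σ, -, hσ⟩ := Finset.exists_min_image (Finset.univ : Finset (Equiv.Perm ι))
    (fun σ => ∑ k, ind (γ (σ k) ≠ β k)) Finset.univ_nonempty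
  refine ⟨σ, ?_⟩
  have hswap : ∀ k k', γ (σ k) ≠ β k → γ (σ k') ≠ β k' → γ (σ k) ≠ β k' := by
    intro k k' hk hk' heq
    have hne : k ≠ k' := by rintro rfl; exact hk heq
    have hmin := hσ (Equiv.swap k k' |>.trans σ) (Finset.mem_univ _)
    refine absurd hmin (not_le.2 (Finset.sum_lt_sum (fun l _ => ?_) ⟨k', Finset.mem_univ _, ?_⟩))
    · by_cases h1 : l = k
      · subst h1
        rw [ind_of_true hk]
        simp only [ind]; split_ifs <;> norm_num
      · by_cases h2 : l = k'
        · subst h2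
          simp only [Equiv.trans_apply, Equiv.swap_apply_right]
          rw [ind_of_false (not_not.2 heq)]
          exact ind_nonneg _
        · rw [Equiv.trans_apply, Equiv.swap_apply_of_ne_of_ne h1 h2]
    · simp only [Equiv.trans_apply, Equiv.swap_apply_right]
      rw [ind_of_false (not_not.2 heq), ind_of_true hk']
      norm_num
  have hperm : ∀ x, ∑ k, ind (γ k = x) = ∑ k, ind (γ (σ k) = x) := fun x =>
    (Equiv.sum_comp σ (fun k => ind (γ k = x))).symm
  -- If `x` is wanted at some mismatched place, every occurrence of `x` is already well placed. The
  -- mismatches that want `x` then number exactly the excess of its count in `β` over that in `γ`.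
  have hcount : ∀ x, ∑ k, (if β k = x then ind (γ (σ k) ≠ β k) else 0) ≤
      |∑ k, ind (β k = x) - ∑ k, ind (γ k = x)| := by
    intro x
    by_cases hex : ∃ k, β k = x ∧ γ (σ k) ≠ β k
    · obtain ⟨k₀, hx, hk₀⟩ := hex
      refine le_trans (le_of_eq ?_) (le_abs_self _)
      rw [hperm, ← Finset.sum_sub_distrib]
      refine Finset.sum_congr rfl fun k _ => ?_
      by_cases hb : β k = x
      · by_cases hg : γ (σ k) = β k
        · rw [if_pos hb, ind_of_false (not_not.2 hg), ind_of_true hb, ind_of_true (hg.trans hb)]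
          ring
        · rw [if_pos hb, ind_of_true hg, ind_of_true hb, ind_of_false (fun h => hg (h.trans hb.symm))]
          ring
      · rw [if_neg hb, ind_of_false hb, ind_of_false, sub_zero]
        intro hgx
        exact hswap k k₀ (fun h => hb (h.symm.trans hgx)) hk₀ (hgx.trans hx.symm)
    · push Not at hex
      rw [Finset.sum_eq_zero]
      · exact abs_nonneg _
      · intro k _
        split_ifs with hb
        · exact ind_of_false (not_not.2 (hex k hb))
        · rfl
  calc ∑ k, ind (γ (σ k) ≠ β k)
      = ∑ x, ∑ k, (if β k = x then ind (γ (σ k) ≠ β k) else 0) := by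
        rw [Finset.sum_comm]
        refine Finset.sum_congr rfl fun k _ => ?_
        rw [Finset.sum_ite_eq, if_pos (Finset.mem_univ _)]
    _ ≤ _ := Finset.sum_le_sum fun x _ => hcount x

theorem letterLaw_eq_sum {𝒳 : Type*} {n M : ℕ} (b : Fin M → Fin n → 𝒳) (t : Fin n) (x : 𝒳) :
    letterLaw b t x = (∑ k, ind (b k t = x)) / M := by
  classical
  rw [letterLaw]
  simp only [ind, Finset.sum_boole]

theorem sum_ind_eq {𝒳 : Type*} {n M : ℕ} (b : Fin M → Fin n → 𝒳) (t : Fin n) (x : 𝒳) :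
    ∑ k, ind (b k t = x) = M * letterLaw b t x := by
  rcases Nat.eq_zero_or_pos M with rfl | hM
  · simp
  · have : (M : ℝ) ≠ 0 := by exact_mod_cast hM.ne'
    rw [letterLaw_eq_sum, mul_div_cancel₀ _ this]

theorem exists_le_of_weighted_sum_le {Ω : Type*} [Fintype Ω] {w f : Ω → ℝ} {a : ℝ}
    (hw : ∀ ω, 0 ≤ w ω) (hw1 : ∑ ω, w ω = 1) (h : ∑ ω, w ω * f ω ≤ a) : ∃ ω, f ω ≤ a := by
  by_contra! hf
  have hpos : ∃ ω, 0 < w ω := by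
    by_contra! h0
    have : ∑ ω, w ω ≤ 0 := Finset.sum_nonpos fun ω _ => h0 ω
    linarith
  obtain ⟨ω₀, h0⟩ := hpos
  have : ∑ ω, w ω * a < ∑ ω, w ω * f ω :=
    Finset.sum_lt_sum (fun ω _ => mul_le_mul_of_nonneg_left (hf ω).le (hw ω))
      ⟨ω₀, Finset.mem_univ _, mul_lt_mul_of_pos_left (hf ω₀) h0⟩
  rw [← Finset.sum_mul, hw1, one_mul] at this
  linarith

/-! ### Deterministic codes with equal letter laws -/

section Region

variable {𝒳 𝒰 𝒱 : Type*} {𝒴 : Fin 3 → Type*} [Fintype 𝒳] (D : Model 𝒳 𝒰 𝒱 𝒴)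

/-- The mean deviation of the letter frequencies of a random codebook. -/
theorem sum_unsplitLaw_abs_le {𝒬 : Type*} [Fintype 𝒬] (L : InputLaw 𝒬 𝒳) {n M : ℕ} (hM : 0 < M)
    (q : Fin n → 𝒬) (t : Fin n) (x : 𝒳) :
    ∑ b : Fin M → Fin n → 𝒳, unsplitLaw L q b * |letterLaw b t x - L.pX (q t) x| ≤
      1 / √M := by
  classical
  have hM' : (0 : ℝ) < M := by exact_mod_cast hM
  set p := L.pX (q t) x with hp
  have hp0 : 0 ≤ p := L.pX_nonneg _ _
  have hp1 : p ≤ 1 := by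
    rw [← L.pX_sum (q t)]
    exact Finset.single_le_sum (fun a _ => L.pX_nonneg (q t) a) (Finset.mem_univ x)
  have hmean : ∑ z : Fin n → 𝒳, seqLaw L q z * (ind (z t = x) - p) = 0 := by
    refine (sum_pi_prod_mul (fun t => L.pX (q t)) (fun t => L.pX_sum (q t)) t
      (fun a => ind (a = x) - p)).trans ?_
    simp_rw [mul_sub, Finset.sum_sub_distrib, ← Finset.sum_mul, L.pX_sum]
    rw [Finset.sum_eq_single x]
    · rw [ind_of_true rfl, ← hp]; ring
    · intro a _ ha
      rw [ind_of_false ha, mul_zero]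
    · simp
  have hvar : ∑ z : Fin n → 𝒳, seqLaw L q z * (ind (z t = x) - p) ^ 2 ≤ 1 := by
    rw [← sum_seqLaw L q]
    refine Finset.sum_le_sum fun z _ => mul_le_of_le_one_right (seqLaw_nonneg L q z) ?_
    simp only [ind]
    split_ifs <;> nlinarith
  have hsq := sum_prod_mul_sum_sq (ι := Fin M) (seqLaw L q) (sum_seqLaw L q)
    (fun z => ind (z t = x) - p) hmean
  rw [Fintype.card_fin] at hsq
  have hdev : ∀ b : Fin M → Fin n → 𝒳, ∑ k, (ind (b k t = x) - p) =
      M * (letterLaw b t x - p) := by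
    intro b
    rw [Finset.sum_sub_distrib, sum_ind_eq]
    simp
    ring
  have hs : 0 < √(M : ℝ) := Real.sqrt_pos.2 hM'
  have hss : √(M : ℝ) ^ 2 = M := Real.sq_sqrt hM'.le
  have h2 : ∑ b : Fin M → Fin n → 𝒳, unsplitLaw L q b * (letterLaw b t x - p) ^ 2 ≤ 1 / M := by
    rw [le_div_iff₀ hM']
    have e : (∑ b : Fin M → Fin n → 𝒳, unsplitLaw L q b * (letterLaw b t x - p) ^ 2) * M * M =
        ∑ b : Fin M → Fin n → 𝒳, (∏ i, seqLaw L q (b i)) *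
          (∑ k, (ind (b k t = x) - p)) ^ 2 := by
      rw [Finset.sum_mul, Finset.sum_mul]
      refine Finset.sum_congr rfl fun b _ => ?_
      rw [hdev]
      change (∏ i, seqLaw L q (b i)) * _ * _ * _ = _
      ring
    have h3 : (∑ b : Fin M → Fin n → 𝒳, unsplitLaw L q b * (letterLaw b t x - p) ^ 2) * M * M ≤
        1 * M := by
      rw [e, hsq, mul_comm]
      exact mul_le_mul_of_nonneg_right hvar hM'.le
    exact le_of_mul_le_mul_right h3 hM'
  -- An elementary substitute for the Cauchy–Schwarz inequality, balanced for a second moment of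
  -- order 1/M.
  have hpt : ∀ a : ℝ, |a| ≤ √(M : ℝ) / 2 * a ^ 2 + 1 / (2 * √(M : ℝ)) := by
    intro a
    have h4 : 0 ≤ (√(M : ℝ) * |a| - 1) ^ 2 / (2 * √(M : ℝ)) := by positivity
    have h5 : (√(M : ℝ) * |a| - 1) ^ 2 / (2 * √(M : ℝ)) =
        √(M : ℝ) / 2 * a ^ 2 + 1 / (2 * √(M : ℝ)) - |a| := by
      rw [← sq_abs a]
      field_simp
      ring
    linarith
  calc _ ≤ ∑ b : Fin M → Fin n → 𝒳, unsplitLaw L q b *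
        (√(M : ℝ) / 2 * (letterLaw b t x - p) ^ 2 + 1 / (2 * √(M : ℝ))) :=
        Finset.sum_le_sum fun b _ => mul_le_mul_of_nonneg_left (hpt _) (unsplitLaw_nonneg L q b)
    _ = √(M : ℝ) / 2 * ∑ b : Fin M → Fin n → 𝒳, unsplitLaw L q b * (letterLaw b t x - p) ^ 2 +
        1 / (2 * √(M : ℝ)) := by
        simp_rw [mul_add, Finset.sum_add_distrib, ← Finset.sum_mul]
        rw [sum_unsplitLaw, one_mul, Finset.mul_sum]
        congr 1
        exact Finset.sum_congr rfl fun b _ => by ring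
    _ ≤ √(M : ℝ) / 2 * (1 / M) + 1 / (2 * √(M : ℝ)) := by gcongr
    _ = 1 / √M := by
        have : (1 : ℝ) / M = 1 / √(M : ℝ) ^ 2 := by rw [hss]
        rw [this]
        field_simp
        norm_num

/-- The spread of the letter laws of the three codebooks. -/
noncomputable def lawSpread {n M : ℕ} (c : Codebooks 𝒳 n (fun _ => M)) : ℝ :=
  ∑ i, ∑ t, ∑ x, |letterLaw (c i) t x - letterLaw (c 0) t x|

/-- Codebooks can be given equal letter laws at the price of the spread of these laws. -/
theorem exists_equal_laws {n M : ℕ} (c : Codebooks 𝒳 n (fun _ => M)) :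
    ∃ c' : Codebooks 𝒳 n (fun _ => M),
      (∀ i j t x, letterLaw (c' i) t x = letterLaw (c' j) t x) ∧
      ∑ i, ∑ k, unif M k * ind (c' i k ≠ c i k) ≤ lawSpread c := by
  classical
  -- At each time, user `i` is given a permutation of the column of user 0, as close as possible to
  -- its own column. Permuted columns have the same letter law.
  choose σ hσ using fun (i : Fin 3) (t : Fin n) =>
    exists_perm_card_ne_le (fun k => c i k t) (fun k => c 0 k t)
  have hlaw : ∀ i t x, letterLaw (fun (k : Fin M) (t : Fin n) => c 0 (σ i t k) t) t x =
      letterLaw (c 0) t x := by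
    intro i t x
    rw [letterLaw_eq_sum, letterLaw_eq_sum]
    congr 1
    exact Equiv.sum_comp (σ i t) (fun k => ind (c 0 k t = x))
  refine ⟨fun i k t => c 0 (σ i t k) t, fun i j t x => ?_, ?_⟩
  · rw [hlaw, hlaw]
  · refine Finset.sum_le_sum fun i _ => ?_
    simp only [unif]
    rw [← Finset.mul_sum]
    have h1 : ∑ k, ind ((fun t => c 0 (σ i t k) t) ≠ c i k) ≤
        ∑ t, ∑ k, ind (c 0 (σ i t k) t ≠ c i k t) := by
      rw [Finset.sum_comm]
      refine Finset.sum_le_sum fun k _ => ?_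
      by_cases h : (fun t => c 0 (σ i t k) t) ≠ c i k
      · obtain ⟨t, ht⟩ := Function.ne_iff.1 h
        rw [ind_of_true h, ← ind_of_true ht]
        exact Finset.single_le_sum (f := fun t => ind (c 0 (σ i t k) t ≠ c i k t))
          (fun t _ => ind_nonneg _) (Finset.mem_univ t)
      · rw [ind_of_false h]
        exact Finset.sum_nonneg fun t _ => ind_nonneg _
    refine (mul_le_mul_of_nonneg_left (h1.trans (Finset.sum_le_sum fun t _ => hσ i t))
      (by positivity)).trans (le_of_eq ?_)
    rw [Finset.mul_sum]
    refine Finset.sum_congr rfl fun t _ => ?_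
    rw [Finset.mul_sum]
    refine Finset.sum_congr rfl fun x _ => ?_
    rw [letterLaw_eq_sum, letterLaw_eq_sum, ← sub_div, abs_div, Nat.abs_cast, inv_mul_eq_div]

/-- The decoders keep the codebooks `c` while `c'` is sent. Only messages whose codewords were
changed can cause additional errors. -/
theorem codeError_le_add {n M : ℕ} (hM : 0 < M) {𝒬 : Type*} [Fintype 𝒬] (L : InputLaw 𝒬 𝒳)
    (ε : ℝ) (q : Fin n → 𝒬) (c c' : Codebooks 𝒳 n (fun _ => M)) :
    codeError D c' (fun i y => ownDecoder D L ε (fun _ => hM) q c i y) ≤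
      uniformProb (fun w => ∃ i, jointDecoder D L ε q c i (received D c w i) ≠ some w) +
      ∑ i, ∑ k, unif M k * ind (c' i k ≠ c i k) := by
  have hm : ∀ i, ∑ k, unif M k * ind (c' i k ≠ c i k) =
      ∑ w : Messages fun _ => M, msgLaw (fun _ => M) w * ind (c' i (w i) ≠ c i (w i)) := fun i =>
    (sum_pi_prod_mul (fun _ : Fin 3 => unif M) (fun _ => sum_unif hM) i
      (fun k => ind (c' i k ≠ c i k))).symm
  simp_rw [hm]
  rw [codeError, uniformProb_eq_msgLaw, uniformProb_eq_msgLaw, Finset.sum_comm,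
    ← Finset.sum_add_distrib]
  refine Finset.sum_le_sum fun w _ => ?_
  rw [← Finset.mul_sum, ← mul_add]
  refine mul_le_mul_of_nonneg_left ?_ (msgLaw_nonneg w)
  have h0 : 0 ≤ ∑ i, ind (c' i (w i) ≠ c i (w i)) := Finset.sum_nonneg fun i _ => ind_nonneg _
  by_cases hc : ∀ i, c' i (w i) = c i (w i)
  · have hr : ∀ i, received D c' w i = received D c w i := by
      intro i
      funext t
      simp only [received, hc]
    by_cases hJ : ∃ i, jointDecoder D L ε q c i (received D c w i) ≠ some w
    · rw [ind_of_true hJ]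
      have : ∀ E : Prop, ind E ≤ 1 := fun E => by rw [ind]; split_ifs <;> norm_num
      linarith [this (∃ i, ownDecoder D L ε (fun _ => hM) q c i (received D c' w i) ≠ w i)]
    · rw [ind_of_false hJ, ind_of_false]
      · linarith
      · rintro ⟨i, hi⟩
        push Not at hJ
        apply hi
        rw [ownDecoder, hr, hJ i]
        rfl
  · push Not at hc
    obtain ⟨i, hi⟩ := hc
    have h1 : 1 ≤ ∑ i, ind (c' i (w i) ≠ c i (w i)) := by
      rw [← ind_of_true hi]
      exact Finset.single_le_sum (f := fun i => ind (c' i (w i) ≠ c i (w i)))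
        (fun i _ => ind_nonneg _) (Finset.mem_univ i)
    have h2 : ∀ E : Prop, ind E ≤ 1 := fun E => by rw [ind]; split_ifs <;> norm_num
    have h3 := h2 (∃ i, ownDecoder D L ε (fun _ => hM) q c i (received D c' w i) ≠ w i)
    have h4 := ind_nonneg (∃ i, jointDecoder D L ε q c i (received D c w i) ≠ some w)
    linarith

/-- The mean spread of the letter laws of random codebooks. -/
theorem sum_lawSpread_le {𝒬 : Type*} [Fintype 𝒬] (L : InputLaw 𝒬 𝒳) {n M : ℕ} (hM : 0 < M)
    (q : Fin n → 𝒬) :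
    ∑ c : Codebooks 𝒳 n (fun _ => M), (∏ i, unsplitLaw L q (c i)) * lawSpread c ≤
      6 * Fintype.card 𝒳 * (n * (1 / √M)) := by
  have hone : ∀ (i : Fin 3) t x, ∑ c : Codebooks 𝒳 n (fun _ => M),
      (∏ i, unsplitLaw L q (c i)) * |letterLaw (c i) t x - L.pX (q t) x| ≤ 1 / √M :=
    fun i t x => (sum_pi_prod_mul (fun (_ : Fin 3) (b : Fin M → Fin n → 𝒳) => unsplitLaw L q b)
      (fun _ => sum_unsplitLaw L q) i (fun b => |letterLaw b t x - L.pX (q t) x|)).trans_le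
      (sum_unsplitLaw_abs_le L hM q t x)
  have htwo : ∀ (i : Fin 3) t x, ∑ c : Codebooks 𝒳 n (fun _ => M),
      (∏ i, unsplitLaw L q (c i)) * |letterLaw (c i) t x - letterLaw (c 0) t x| ≤
        1 / √M + 1 / √M := by
    intro i t x
    refine le_trans ?_ (add_le_add (hone i t x) (hone 0 t x))
    rw [← Finset.sum_add_distrib]
    refine Finset.sum_le_sum fun c _ => ?_
    rw [← mul_add]
    refine mul_le_mul_of_nonneg_left ?_ (Finset.prod_nonneg fun _ _ => unsplitLaw_nonneg L q _)
    rw [abs_sub_comm (letterLaw (c 0) t x)]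
    exact abs_sub_le _ _ _
  simp_rw [lawSpread, Finset.mul_sum]
  rw [Finset.sum_comm]
  calc _ ≤ ∑ _i : Fin 3, ∑ _t : Fin n, ∑ _x : 𝒳, (1 / √(M : ℝ) + 1 / √(M : ℝ)) := by
        refine Finset.sum_le_sum fun i _ => ?_
        rw [Finset.sum_comm]
        refine Finset.sum_le_sum fun t _ => ?_
        rw [Finset.sum_comm]
        exact Finset.sum_le_sum fun x _ => htwo i t x
    _ = _ := by
        simp only [Finset.sum_const, Finset.card_univ, Fintype.card_fin, nsmul_eq_mul]
        push_cast
        ring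

/-- Deterministic codes with identical letter laws exist at every rate below the rate formula. -/
theorem exists_identical_codes {𝒬 : Type*} [Fintype 𝒬] {L : InputLaw 𝒬 𝒳} (h : D.Admissible L)
    {R : ℝ} (hR : 0 < R) (hRF : R < D.rateFormula L) {δ : ℝ} (hδ : 0 < δ) :
    ∃ N : ℕ, ∀ n ≥ N, ∃ (c : Codebooks 𝒳 n (fun _ => ⌈(2 : ℝ) ^ ((n : ℝ) * R)⌉₊))
      (dec : (i : Fin 3) → (Fin n → 𝒴 i) → Fin ⌈(2 : ℝ) ^ ((n : ℝ) * R)⌉₊),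
      (∀ i j t x, letterLaw (c i) t x = letterLaw (c j) t x) ∧ codeError D c dec ≤ δ := by
  obtain ⟨ε₀, hε₀, hlim⟩ := tendsto_unsplitJointError D L h hR.le hRF
  have hlim1 := hlim (ε₀ / 2) (by linarith) (by linarith)
  -- The mean spread is of order n/√M with `M ≥ 2^(nR)`; positivity of `R` makes it vanish.
  have hlim2 : Tendsto (fun n : ℕ => 6 * (Fintype.card 𝒳 : ℝ) *
      (n * ((2 : ℝ) ^ (-(R / 2))) ^ n)) atTop (𝓝 0) := by
    have := (tendsto_self_mul_const_pow_of_lt_one (r := (2 : ℝ) ^ (-(R / 2))) (by positivity)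
      (Real.rpow_lt_one_of_one_lt_of_neg (by norm_num) (by linarith))).const_mul
      (6 * (Fintype.card 𝒳 : ℝ))
    simpa using this
  have hev := (hlim1.add hlim2).eventually (eventually_le_nhds (by simpa using hδ))
  obtain ⟨N, hN⟩ := eventually_atTop.1 hev
  refine ⟨N, fun n hn => ?_⟩
  have hδn := hN n hn
  set M := ⌈(2 : ℝ) ^ ((n : ℝ) * R)⌉₊ with hMdef
  have hM : 0 < M := Nat.ceil_pos.2 (by positivity)
  have hMle : (2 : ℝ) ^ ((n : ℝ) * R) ≤ M := Nat.le_ceil _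
  have hsqrt : 1 / √(M : ℝ) ≤ ((2 : ℝ) ^ (-(R / 2))) ^ n := by
    have e : ((2 : ℝ) ^ (-(R / 2))) ^ n = 1 / √((2 : ℝ) ^ ((n : ℝ) * R)) := by
      rw [Real.sqrt_eq_rpow, ← Real.rpow_mul (by norm_num), ← Real.rpow_natCast,
        ← Real.rpow_mul (by norm_num), one_div, ← Real.rpow_neg (by norm_num)]
      ring_nf
    rw [e]
    exact one_div_le_one_div_of_le (Real.sqrt_pos.2 (by positivity)) (Real.sqrt_le_sqrt hMle)
  -- Error and spread are averaged together, so that one pair of time-sharing sequence and codebooks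
  -- keeps their sum small.
  set f : (Fin n → 𝒬) × Codebooks 𝒳 n (fun _ => M) → ℝ := fun x =>
    uniformProb (fun w => ∃ i, jointDecoder D L (ε₀ / 2) x.1 x.2 i (received D x.2 w i) ≠ some w) +
      lawSpread x.2 with hf
  set W : (Fin n → 𝒬) × Codebooks 𝒳 n (fun _ => M) → ℝ := fun x =>
    timeSharingProb L x.1 * ∏ i, unsplitLaw L x.1 (x.2 i) with hW
  have hW0 : ∀ x, 0 ≤ W x := fun x => mul_nonneg (timeSharingProb_nonneg L _)
    (Finset.prod_nonneg fun _ _ => unsplitLaw_nonneg L _ _)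
  have hTS := sum_timeSharingProb L n
  have hW1 : ∑ x, W x = 1 := by
    rw [Fintype.sum_prod_type]
    simp_rw [hW, ← Finset.mul_sum, sum_prod_unsplitLaw, mul_one]
    exact hTS
  have hWf : ∑ x, W x * f x ≤ δ := by
    refine le_trans ?_ hδn
    have e : ∑ x, W x * f x = unsplitJointError D L (ε₀ / 2) n (fun _ => M) +
        ∑ q : Fin n → 𝒬, timeSharingProb L q *
          ∑ c : Codebooks 𝒳 n (fun _ => M), (∏ i, unsplitLaw L q (c i)) * lawSpread c := by
      rw [Fintype.sum_prod_type, unsplitJointError, ensembleAverage, ← Finset.sum_add_distrib]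
      refine Finset.sum_congr rfl fun q _ => ?_
      rw [← mul_add, ← Finset.sum_add_distrib, Finset.mul_sum]
      refine Finset.sum_congr rfl fun c _ => ?_
      simp only [hW, hf]
      ring
    rw [e]
    refine add_le_add le_rfl ?_
    calc _ ≤ ∑ q : Fin n → 𝒬, timeSharingProb L q *
          (6 * Fintype.card 𝒳 * (n * (1 / √(M : ℝ)))) :=
          Finset.sum_le_sum fun q _ => mul_le_mul_of_nonneg_left (sum_lawSpread_le L hM q)
            (timeSharingProb_nonneg L q)
      _ = 6 * Fintype.card 𝒳 * (n * (1 / √(M : ℝ))) := by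
          rw [← Finset.sum_mul, hTS, one_mul]
      _ ≤ _ := by gcongr
  obtain ⟨⟨q, c⟩, hqc⟩ := exists_le_of_weighted_sum_le hW0 hW1 hWf
  obtain ⟨c', hlaw, hc'⟩ := exists_equal_laws c
  refine ⟨c', fun i y => ownDecoder D L (ε₀ / 2) (fun _ => hM) q c i y, hlaw, ?_⟩
  refine (codeError_le_add D hM L (ε₀ / 2) q c c').trans ((add_le_add le_rfl hc').trans hqc)

/-! ### The symmetric capacity under identical inputs -/

/-- The input law of a code with identical letter laws: the time is uniform. -/
noncomputable def timeLaw {n M : ℕ} (hn : 0 < n) (hM : 0 < M) (b : Fin M → Fin n → 𝒳) :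
    InputLaw (Fin n) 𝒳 where
  pQ := unif n
  pQ_nonneg := unif_nonneg
  pQ_sum := sum_unif hn
  pX := fun t x => letterLaw b t x
  pX_nonneg := fun t x => by
    rw [letterLaw_eq_prob]
    exact prob_nonneg unif_nonneg _ _
  pX_sum := fun t => by
    have := sum_univ_prob_mul (unif M) (fun k => b k t) (fun _ => 1)
    simp_rw [mul_one, sum_unif hM] at this
    simp_rw [letterLaw_eq_prob]
    exact this

/-- The converse for a deterministic code with identical letter laws. -/
theorem code_converse {n : ℕ} (hn : 0 < n) {m : Fin 3 → ℕ} (hm : ∀ i, 0 < m i)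
    (c : Codebooks 𝒳 n m) (dec : (i : Fin 3) → (Fin n → 𝒴 i) → Fin (m i))
    (hid : ∀ i j t x, letterLaw (c i) t x = letterLaw (c j) t x)
    (h : D.Admissible (timeLaw hn (hm 0) (c 0))) :
    (∀ i, (1 - codeError D c dec) * Real.logb 2 (m i) - 1 ≤
      n * ∑ t, (timeLaw hn (hm 0) (c 0)).pQ t *
        entropy ((timeLaw hn (hm 0) (c 0)).pX t) (D.level .coarse)) ∧
    (1 - codeError D c dec) * ∑ i, Real.logb 2 (m i) - 3 ≤
      n * ∑ t, (timeLaw hn (hm 0) (c 0)).pQ t *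
        entropy (prodLaw ((timeLaw hn (hm 0) (c 0)).pX t)) (D.output 0) := by
  classical
  set L := timeLaw hn (hm 0) (c 0) with hL
  have hn' : (n : ℝ) ≠ 0 := by exact_mod_cast hn.ne'
  have hsum : ∀ φ : Fin n → ℝ, n * ∑ t, L.pQ t * φ t = ∑ t, φ t := by
    intro φ
    rw [Finset.mul_sum]
    refine Finset.sum_congr rfl fun t _ => ?_
    change n * ((n : ℝ)⁻¹ * φ t) = φ t
    rw [mul_inv_cancel_left₀ hn']
  rw [hsum, hsum]
  -- The code is the ensemble of point masses at its codebooks. The ensemble's letter condition is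
  -- the hypothesis of identical letter laws.
  refine ensemble_converse D hm L.pX L.pX_nonneg L.pX_sum
    (fun i b => if b = c i then 1 else 0) (fun i b => by split_ifs <;> norm_num)
    (fun i => by simp) (fun i t x => ?_) (fun t x x' hx hx' hC hY =>
      h.determines 0 (unif_pos t) hx hx' hC hY) (fun _ => dec) ?_
  · simp only [ite_mul, one_mul, zero_mul, Finset.sum_ite_eq', Finset.mem_univ, if_true]
    exact hid i 0 t x
  · rw [Finset.sum_eq_single c]
    · simp
    · intro c' _ hc'
      obtain ⟨i, hi⟩ := Function.ne_iff.1 hc'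
      rw [Finset.prod_eq_zero (Finset.mem_univ i) (if_neg hi), zero_mul]
    · simp

/-- The first term of the rate formula is a conditional entropy of a function of one letter, hence
at most log |𝒳|, whatever the size of the time-sharing alphabet. -/
theorem bddAbove_rateFormula
    (hadm : ∀ (k : ℕ) (L : InputLaw (Fin k) 𝒳), D.Admissible L) :
    BddAbove {r : ℝ | ∃ (k : ℕ) (L : InputLaw (Fin k) 𝒳), r = D.rateFormula L} := by
  refine ⟨Real.logb 2 (Fintype.card 𝒳), ?_⟩
  rintro _ ⟨k, L, rfl⟩
  rw [(hadm k L).rateFormula_eq]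
  refine (min_le_left _ _).trans ?_
  calc _ ≤ ∑ q, L.pQ q * Real.logb 2 (Fintype.card 𝒳) :=
        Finset.sum_le_sum fun q _ => mul_le_mul_of_nonneg_left
          (entropy_le_card (L.pX_nonneg q) (L.pX_sum q) _) (L.pQ_nonneg q)
    _ = _ := by rw [← Finset.sum_mul, L.pQ_sum, one_mul]

theorem exists_inputLaw [Nonempty 𝒳] : Nonempty (InputLaw (Fin 1) 𝒳) := by
  have hc : (Fintype.card 𝒳 : ℝ) ≠ 0 := by exact_mod_cast Fintype.card_ne_zero
  exact ⟨⟨fun _ => 1, fun _ => zero_le_one, by simp, fun _ _ => (Fintype.card 𝒳 : ℝ)⁻¹,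
    fun _ _ => by positivity, fun _ => by simp [hc]⟩⟩

/-- The supremum itself is attained in the region because the definition of the region allows a loss
of `ε` in rate: some law beats the supremum minus `ε`. In the converse, a code of length `n` yields
a law with time-sharing alphabet `Fin n`, so all alphabet sizes are needed. -/
theorem exists_isSymmetricCapacity_region [Nonempty 𝒳]
    (hadm : ∀ (k : ℕ) (L : InputLaw (Fin k) 𝒳), D.Admissible L) :
    ∃ C : ℝ, IsSymmetricCapacity D.region C ∧
      IsLUB {r : ℝ | ∃ (k : ℕ) (L : InputLaw (Fin k) 𝒳), r = D.rateFormula L} C := by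
  set S := {r : ℝ | ∃ (k : ℕ) (L : InputLaw (Fin k) 𝒳), r = D.rateFormula L} with hS
  obtain ⟨L₁⟩ := exists_inputLaw (𝒳 := 𝒳)
  have hne : S.Nonempty := ⟨_, 1, L₁, rfl⟩
  have hlub : IsLUB S (sSup S) := isLUB_csSup hne (bddAbove_rateFormula D hadm)
  refine ⟨sSup S, ⟨⟨fun _ => sSup S, ⟨fun _ => ?_, fun ε hε => ?_⟩, min_const_three _⟩, ?_⟩, hlub⟩
  · exact ((hadm 1 L₁).rateFormula_nonneg D).trans (hlub.1 ⟨1, L₁, rfl⟩)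
  · rcases le_or_gt (sSup S) ε with hle | hlt
    · obtain ⟨x₀⟩ := ‹Nonempty 𝒳›
      refine ⟨0, fun n _ => ⟨fun _ => 1, fun _ _ _ => x₀, fun _ _ => 0, fun _ _ _ _ => rfl,
        fun _ => ?_, ?_⟩⟩
      · rw [Nat.cast_one]
        exact Real.rpow_le_one_of_one_le_of_nonpos (by norm_num)
          (mul_nonpos_of_nonneg_of_nonpos (Nat.cast_nonneg n) (by linarith))
      · rw [codeError_eq_zero_of_card_one]
        exact hε.le
    · obtain ⟨_, ⟨k, L, rfl⟩, hL⟩ := exists_lt_of_lt_csSup hne (sub_lt_self (sSup S) hε)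
      obtain ⟨N, hN⟩ := exists_identical_codes D (hadm k L) (sub_pos.2 hlt) hL hε
      refine ⟨N, fun n hn => ?_⟩
      obtain ⟨c, dec, h1, h2⟩ := hN n hn
      exact ⟨_, c, dec, h1, fun _ => Nat.le_ceil _, h2⟩
  · rintro _ ⟨R, ⟨-, hR⟩, rfl⟩
    refine le_of_forall_eps fun ε h0 h1 => ?_
    obtain ⟨N, hN⟩ := hR ε h0
    refine ⟨max N 1, fun n hn => ?_⟩
    obtain ⟨m, c, dec, hid, hm, hC⟩ := hN n ((le_max_left _ _).trans hn)
    have hn0 : 0 < n := (le_max_right N 1).trans hn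
    have hm0 : ∀ i, 0 < m i := fun i => pos_of_two_rpow_le (hm i)
    have h := hadm n (timeLaw hn0 (hm0 0) (c 0))
    obtain ⟨c1, c2⟩ := code_converse D hn0 hm0 c dec hid h
    refine (rate_le_of_converse h1 hC hm c1 c2).trans ?_
    rw [← h.rateFormula_eq]
    have := hlub.1 ⟨n, timeLaw hn0 (hm0 0) (c 0), rfl⟩
    gcongr

end Region

end DetIC

theorem mainTheorem6 {𝒳 𝒰 𝒱 : Type*} {𝒴 : Fin 3 → Type*} [Fintype 𝒳] [Nonempty 𝒳]
    (D : DetIC.Model 𝒳 𝒰 𝒱 𝒴) :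
    (∀ (𝒬 : Type*) [Fintype 𝒬] (L : DetIC.InputLaw 𝒬 𝒳), D.Admissible L →
      DetIC.IsSymmetricCapacity (D.regionWith L) (D.rateFormula L) ∧
      ∀ R : ℝ, 0 ≤ R → R < D.rateFormula L →
        ∃ ε₀ > 0, ∀ ε : ℝ, 0 < ε → ε < ε₀ →
          Tendsto (fun n : ℕ =>
              DetIC.unsplitJointError D L ε n (fun _ => ⌈(2 : ℝ) ^ ((n : ℝ) * R)⌉₊))
            atTop (𝓝 0)) ∧
    ((∀ (k : ℕ) (L : DetIC.InputLaw (Fin k) 𝒳), D.Admissible L) →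
      ∃ C : ℝ, DetIC.IsSymmetricCapacity D.region C ∧
        IsLUB {r : ℝ | ∃ (k : ℕ) (L : DetIC.InputLaw (Fin k) 𝒳), r = D.rateFormula L} C) := by
  refine ⟨fun 𝒬 _ L h => ⟨DetIC.isSymmetricCapacity_regionWith D h,
    fun R hR hRF => DetIC.tendsto_unsplitJointError D L h hR hRF⟩,
    fun h => DetIC.exists_isSymmetricCapacity_region D h⟩
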